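/- Let $\theta>0$, $\Omega\in\,]0,1]$, and let $\mathbb A=(\mathcal S(\mathbb R^2),\star)$ be the algebra of complex-valued Schwartz functions with the Moyal product $$(f\star g)(x)=\frac1{(\pi\theta)^2}\int d^2y\,d^2z\; f(x+y)\,g(x+z)\,e^{-2i\,y^\mu\Theta^{-1}_{\mu\nu}z^\nu},\qquad \Theta=\theta\begin{pmatrix}0&1\\-1&0\end{pmatrix},$$ complex conjugation as involution, and the norm $\|a\|=\|L(a)\|$, where $L(a)\psi=a\star\psi$ on $L^2(\mathbb R^2)$. A state of $\mathbb A$ is a linear functional $\omega:\mathbb A\to\mathbb C$ with $\omega(\bar a\star a)\ge 0$ for all $a$ and $\|\omega\|=1$; $\mathfrak S(\mathbb A)$ is the set of states. Put $\sigma^1=\begin{pmatrix}0&1\\1&0\end{pmatrix}$, $\sigma^2=\begin{pmatrix}0&i\\-i&0\end{pmatrix}$, $\sigma^3=i\sigma^1\sigma^2$, $\tilde x_\mu=2\Theta^{-1}_{\mu\nu}x^\nu$, and consider the Dirac operators $$D_0=-i\sigma^\mu\partial_\mu,\quad D_1=(\mathbb 1_2\otimes\sigma^\mu)(-i\partial_\mu)-\Omega(\sigma^\mu\otimes\sigma^3)\tilde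 x_\mu,\quad D_2=(\sigma^3\otimes\sigma^\mu)(-i\partial_\mu)-\Omega(\sigma^\mu\otimes\mathbb 1_2)\tilde x_\mu .$$ Here $D_0$ acts in $L^2(\mathbb R^2)\otimes\mathbb C^2$, with domain the smooth spinors that are in $L^2$ together with all their derivatives, and $D_1,D_2$ act in $L^2(\mathbb R^2)\otimes\mathbb C^4$, with domain the Schwartz spinors. In all cases $\pi(a)=L(a)\otimes\mathbb 1$. For $k=0,1,2$ let $$d_k(\omega_1,\omega_2)=\sup\{|\omega_1(a)-\omega_2(a)| : a\in\mathbb A,\ \|[D_k,\pi(a)]\|\le 1\}\in[0,\infty],$$ and equip $\mathfrak S(\mathbb A)$ with the topology of the extended (pseudo-)metric $d_k$. Let $f_{00}=2e^{-2\bar zz/\theta}$ with $z=(x_1+ix_2)/\sqrt2$, let $f_{mn}=(\theta^{m+n}m!\,n!)^{-1/2}\,\bar z^{\star m}\star f_{00}\star z^{\star n}$, and write $a=\sum_{m,n}a_{mn}f_{mn}$ for $a\in\mathbb A$, that is, $a_{mn}=\frac1{2\pi\theta}\int \overline{f_{mn}}\,a\,d^2x$. For $s>1$ let $\psi_m(s)=\big(2\pi\theta\,\zeta(s)(m+1)^s\big)^{-1/2}$.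 Then for each $k=0,1,2$: 1. The space $(\mathfrak S(\mathbb A),d_k)$ has infinitely many connected components. 2. Each connected component is path-connected: any two states $\omega_1,\omega_2$ in it are joined inside it by the $d_k$-continuous path $t\mapsto(1-t)\omega_1+t\omega_2$, $t\in[0,1]$. 3. For every $s>1$, $\omega_{\psi(s)}(a)=2\pi\theta\sum_{m,n}\psi_m(s)\psi_n(s)a_{mn}$ defines a state of $\mathbb A$, and the set $\mathfrak S^k_{\psi(s)}=\{\omega\in\mathfrak S(\mathbb A): d_k(\omega,\omega_{\psi(s)})<\infty\}$ is open and closed, and path-connected through the paths in 2. 4. For $s_1\ne s_2$ in $]1,\tfrac54[\,\cup\,]\tfrac54,\tfrac32]$, one has $\omega_{\psi(s_2)}\notin\mathfrak S^k_{\psi(s_1)}$, the sets $\mathfrak S^k_{\psi(s_1)}$ and $\mathfrak S^k_{\psi(s_2)}$ are distinct, and $\omega_{\psi(s_1)}$, $\omega_{\psi(s_2)}$ lie in distinct connected components. -/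

import Mathlib

noncomputable section

open MeasureTheory SchwartzMap Complex
open scoped Matrix Kronecker ENNReal FourierTransform LineDeriv

namespace Moyal

/-- The plane `ℝ²` with its Euclidean structure and Lebesgue measure. -/
abbrev Plane : Type := EuclideanSpace ℝ (Fin 2)

/-- The unit vector of the `μ`-th coordinate axis. -/
def axis (μ : Fin 2) : Plane := EuclideanSpace.single μ 1

/-- The matrix `Θ`. -/
def Theta (θ : ℝ) : Matrix (Fin 2) (Fin 2) ℝ := θ • !![0, 1; -1, 0]

/-- The algebra `𝔸` is the Schwartz space of the plane with the product `mul` below; `phase` is the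
bilinear form `y^μ Θ⁻¹_{μν} z^ν`. -/
def phase (θ : ℝ) (y z : Plane) : ℝ := ∑ μ, ∑ ν, y μ * (Theta θ)⁻¹ μ ν * z ν

/-- The Moyal product
`(f ⋆ g)(x) = (πθ)⁻² ∫ dz ∫ dy f(x + y) g(x + z) exp(-2i y^μ Θ⁻¹_{μν} z^ν)`.
The second factor may take vector values; for spinor-valued `g` this is `(L(f) ⊗ 1) g`.
For a Schwartz function `f` the inner integral is rapidly decreasing in `z`, so that the iterated
integral converges for every `g` in `L²` and for every `g` of polynomial growth. -/
def moyal {F : Type*} [NormedAddCommGroup F] [NormedSpace ℂ F]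
    (θ : ℝ) (f : Plane → ℂ) (g : Plane → F) (x : Plane) : F :=
  ((1 / (Real.pi * θ) ^ 2 : ℝ) : ℂ) •
    ∫ z : Plane, ∫ y : Plane,
      (f (x + y) * Complex.exp (-2 * I * (phase θ y z : ℂ))) • g (x + z)

theorem phase_eq {θ : ℝ} (hθ : 0 < θ) (y z : Plane) :
    phase θ y z = (y 1 * z 0 - y 0 * z 1) / θ := by
  have h : (Theta θ)⁻¹ = !![0, -θ⁻¹; θ⁻¹, 0] := by
    rw [Matrix.inv_eq_right_inv]
    ext i j
    fin_cases i <;> fin_cases j <;> simp [Theta, Matrix.mul_apply, hθ.ne']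
  simp [phase, h, Fin.sum_univ_two]
  field_simp
  ring

/-- The integral operator to which the Moyal product of Schwartz functions reduces after the
integration over the first variable. -/
def twisted (θ : ℝ) (φ g : 𝓢(Plane, ℂ)) (x : Plane) : ℂ :=
  ∫ z : Plane, Complex.exp (2 * I * (phase θ x z : ℂ)) * (φ z * g (x + z))

/-- The rescaled rotation which turns the kernel of the Moyal product into a Fourier kernel. -/
def dualEquiv (θ : ℝ) (hθ : 0 < θ) : Plane ≃L[ℝ] Plane :=
  LinearEquiv.toContinuousLinearEquiv
    { toFun := fun z => !₂[-(z 1) / (Real.pi * θ), z 0 / (Real.pi * θ)]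
      invFun := fun w => !₂[Real.pi * θ * w 1, -(Real.pi * θ * w 0)]
      map_add' := fun z w => by ext i; fin_cases i <;> simp <;> ring
      map_smul' := fun c z => by ext i; fin_cases i <;> simp <;> ring
      left_inv := fun z => by
        have := Real.pi_pos.ne'
        ext i; fin_cases i <;> simp <;> field_simp
      right_inv := fun z => by
        have := Real.pi_pos.ne'
        ext i; fin_cases i <;> simp <;> field_simp }

theorem inner_dualEquiv {θ : ℝ} (hθ : 0 < θ) (y z : Plane) :
    Real.pi * inner ℝ y (dualEquiv θ hθ z) = phase θ y z := by
  have := Real.pi_pos.ne'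
  rw [phase_eq hθ]
  simp [dualEquiv, PiLp.inner_apply, Fin.sum_univ_two]
  field_simp
  ring

theorem phase_add_left (θ : ℝ) (x y z : Plane) :
    phase θ (x + y) z = phase θ x z + phase θ y z := by
  simp [phase, Fin.sum_univ_two]; ring

theorem moyal_eq_twisted {θ : ℝ} (hθ : 0 < θ) (f g : 𝓢(Plane, ℂ)) (x : Plane) :
    moyal θ f g x = ((1 / (Real.pi * θ) ^ 2 : ℝ) : ℂ) *
      twisted θ (compCLMOfContinuousLinearEquiv ℂ (dualEquiv θ hθ) (𝓕 f)) g x := by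
  unfold moyal twisted
  rw [smul_eq_mul]
  congr 2
  ext z
  simp only [smul_eq_mul]
  rw [integral_mul_const, ← mul_assoc]
  congr 1
  have h1 : ∀ y : Plane, f (x + y) * Complex.exp (-2 * I * (phase θ y z : ℂ)) =
      Complex.exp (2 * I * (phase θ x z : ℂ)) *
        (fun u : Plane => f u * Complex.exp (-2 * I * (phase θ u z : ℂ))) (x + y) := by
    intro y
    have : Complex.exp (-2 * I * (phase θ y z : ℂ)) = Complex.exp (2 * I * (phase θ x z : ℂ)) *
        Complex.exp (-2 * I * (phase θ (x + y) z : ℂ)) := by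
      rw [← Complex.exp_add, phase_add_left]
      congr 1
      push_cast
      ring
    simp only [this]
    ring
  simp_rw [h1]
  rw [integral_const_mul, integral_add_left_eq_self
    (fun u : Plane => f u * Complex.exp (-2 * I * (phase θ u z : ℂ)))]
  congr 1
  simp only [compCLMOfContinuousLinearEquiv_apply, Function.comp, fourier_coe]
  rw [Real.fourier_eq']
  congr 1
  ext u
  rw [smul_eq_mul, mul_comm]
  congr 2
  rw [← inner_dualEquiv hθ u z]
  push_cast
  ring

theorem norm_exp_phase (θ : ℝ) (x z : Plane) :
    ‖Complex.exp (2 * I * (phase θ x z : ℂ))‖ = 1 := by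
  have : 2 * I * (phase θ x z : ℂ) = ((2 * phase θ x z : ℝ) : ℂ) * I := by push_cast; ring
  rw [this, Complex.norm_exp_ofReal_mul_I]

/-- The form `phase` as a continuous linear map of the first variable. -/
def phaseL (θ : ℝ) (z : Plane) : Plane →L[ℝ] ℝ :=
  LinearMap.toContinuousLinearMap
    { toFun := fun y => phase θ y z
      map_add' := fun x y => phase_add_left θ x y z
      map_smul' := fun c y => by simp [phase, Fin.sum_univ_two]; ring }

/-- The form `phase` as a continuous linear map of the second variable. -/
def phaseR (θ : ℝ) (y : Plane) : Plane →L[ℝ] ℝ :=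
  LinearMap.toContinuousLinearMap
    { toFun := fun z => phase θ y z
      map_add' := fun x z => by simp [phase, Fin.sum_univ_two]; ring
      map_smul' := fun c z => by simp [phase, Fin.sum_univ_two]; ring }

theorem continuous_phase (θ : ℝ) : Continuous fun p : Plane × Plane => phase θ p.1 p.2 := by
  unfold phase; fun_prop

theorem twisted_decay (θ : ℝ) (k : ℕ) (φ g : 𝓢(Plane, ℂ)) :
    ∃ C, ∀ x, ‖x‖ ^ k * ‖twisted θ φ g x‖ ≤ C := by
  obtain ⟨Ck, hCk⟩ : ∃ C, ∀ x, ‖x‖ ^ k * ‖g x‖ ≤ C :=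
    ⟨_, fun x => norm_pow_mul_le_seminorm ℝ g k x⟩
  obtain ⟨C0, hC0⟩ : ∃ C, ∀ x, ‖g x‖ ≤ C := ⟨_, fun x => norm_le_seminorm ℝ g x⟩
  have hb : Integrable (fun z : Plane => 2 ^ k * (Ck * ‖φ z‖ + C0 * (‖z‖ ^ k * ‖φ z‖))) :=
    (((φ.integrable (μ := volume)).norm.const_mul Ck).add
      ((φ.integrable_pow_mul volume k).const_mul C0)).const_mul _
  refine ⟨∫ z : Plane, 2 ^ k * (Ck * ‖φ z‖ + C0 * (‖z‖ ^ k * ‖φ z‖)), fun x => ?_⟩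
  have h1 : ‖x‖ ^ k * ‖twisted θ φ g x‖ = ‖∫ z : Plane, ((‖x‖ ^ k : ℝ) : ℂ) *
      (Complex.exp (2 * I * (phase θ x z : ℂ)) * (φ z * g (x + z)))‖ := by
    rw [integral_const_mul, norm_mul]; simp [twisted]
  rw [h1]
  refine norm_integral_le_of_norm_le hb (Filter.Eventually.of_forall fun z => ?_)
  rw [norm_mul, norm_mul, norm_exp_phase, norm_mul, one_mul, Complex.norm_real, norm_pow, norm_norm]
  have hx : ‖x‖ ^ k ≤ 2 ^ k * (‖x + z‖ ^ k + ‖z‖ ^ k) := by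
    have h2 : ‖x‖ ≤ ‖x + z‖ + ‖z‖ := by
      simpa using norm_sub_le (x + z) z
    calc ‖x‖ ^ k ≤ (‖x + z‖ + ‖z‖) ^ k := by gcongr
      _ ≤ 2 ^ (k - 1) * (‖x + z‖ ^ k + ‖z‖ ^ k) := add_pow_le (by positivity) (by positivity) k
      _ ≤ _ := by gcongr <;> simp
  calc ‖x‖ ^ k * (‖φ z‖ * ‖g (x + z)‖)
      ≤ (2 ^ k * (‖x + z‖ ^ k + ‖z‖ ^ k)) * (‖φ z‖ * ‖g (x + z)‖) := by gcongr
    _ = 2 ^ k * ((‖x + z‖ ^ k * ‖g (x + z)‖) * ‖φ z‖ + ‖g (x + z)‖ * (‖z‖ ^ k * ‖φ z‖)) := by ring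
    _ ≤ _ := by gcongr; exacts [hCk _, hC0 _]

/-- The product of a Schwartz function with the phase of a fixed first argument. -/
def phaseMul (θ : ℝ) (v : Plane) (φ : 𝓢(Plane, ℂ)) : 𝓢(Plane, ℂ) :=
  smulLeftCLM ℂ (fun z => 2 * I * ((phaseR θ v z : ℝ) : ℂ)) φ

theorem phaseMul_apply (θ : ℝ) (v : Plane) (φ : 𝓢(Plane, ℂ)) (z : Plane) :
    phaseMul θ v φ z = 2 * I * (phase θ v z : ℂ) * φ z := by
  have h : Function.HasTemperateGrowth (fun z : Plane => 2 * I * ((phaseR θ v z : ℝ) : ℂ)) := by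
    have : (fun z : Plane => 2 * I * ((phaseR θ v z : ℝ) : ℂ)) =
        ⇑((ContinuousLinearMap.mul ℝ ℂ (2 * I)) ∘L (Complex.ofRealCLM ∘L phaseR θ v)) := rfl
    rw [this]; exact ContinuousLinearMap.hasTemperateGrowth _
  rw [phaseMul, smulLeftCLM_apply_apply h]
  rfl

theorem twisted_integrable (θ : ℝ) (φ g : 𝓢(Plane, ℂ)) (x : Plane) :
    Integrable fun z : Plane =>
      Complex.exp (2 * I * (phase θ x z : ℂ)) * (φ z * g (x + z)) := by
  obtain ⟨C0, hC0⟩ : ∃ C, ∀ x, ‖g x‖ ≤ C := ⟨_, fun x => norm_le_seminorm ℝ g x⟩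
  have hc := continuous_phase θ
  refine Integrable.mono' ((φ.integrable (μ := volume)).norm.const_mul C0)
    (Continuous.aestronglyMeasurable ?_) (Filter.Eventually.of_forall fun z => ?_)
  · have : Continuous fun z => phase θ x z := hc.comp (by fun_prop : Continuous fun z => (x, z))
    fun_prop
  · rw [norm_mul, norm_exp_phase, norm_mul, one_mul, mul_comm]
    gcongr; exact hC0 _

theorem sum_axis (v : Plane) : v = ∑ μ, v μ • axis μ := by
  ext i; fin_cases i <;> simp [axis, Fin.sum_univ_two]

/-- The derivative of `twisted` at `x`. -/
theorem twisted_hasFDerivAt (θ : ℝ) (φ g : 𝓢(Plane, ℂ)) (x : Plane) :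
    HasFDerivAt (twisted θ φ g)
      (∑ μ, (EuclideanSpace.proj μ : Plane →L[ℝ] ℝ).smulRight
        (twisted θ (phaseMul θ (axis μ) φ) g x + twisted θ φ (∂_{axis μ} g) x)) x := by
  obtain ⟨C0, hC0⟩ : ∃ C, ∀ x, ‖g x‖ ≤ C := ⟨_, fun x => norm_le_seminorm ℝ g x⟩
  obtain ⟨C1, hC1⟩ : ∃ C, ∀ μ x, ‖(∂_{axis μ} g) x‖ ≤ C := by
    refine ⟨∑ μ, SchwartzMap.seminorm ℝ 0 0 (∂_{axis μ} g), fun μ x =>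
      (norm_le_seminorm ℝ (∂_{axis μ} g) x).trans ?_⟩
    exact Finset.single_le_sum (f := fun μ => SchwartzMap.seminorm ℝ 0 0 (∂_{axis μ} g))
      (fun i _ => apply_nonneg _ _) (Finset.mem_univ μ)
  set E : Plane → Plane → ℂ := fun x z => Complex.exp (2 * I * (phase θ x z : ℂ)) with hE
  set D : Fin 2 → Plane → Plane → ℂ := fun μ x z =>
    E x z * (phaseMul θ (axis μ) φ z * g (x + z)) + E x z * (φ z * (∂_{axis μ} g) (x + z)) with hD
  set F' : Plane → Plane → Plane →L[ℝ] ℂ := fun x z =>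
    ∑ μ, (EuclideanSpace.proj μ : Plane →L[ℝ] ℝ).smulRight (D μ x z) with hF'
  have hDint : ∀ μ x, Integrable (D μ x) := fun μ x =>
    (twisted_integrable θ _ g x).add (twisted_integrable θ φ _ x)
  have key : HasFDerivAt (fun x => ∫ z, E x z * (φ z * g (x + z))) (∫ z, F' x z) x := by
    refine hasFDerivAt_integral_of_dominated_of_fderiv_le (𝕜 := ℝ) (F' := F') (s := Set.univ)
      (bound := fun z => ∑ μ : Fin 2, ‖(EuclideanSpace.proj μ : Plane →L[ℝ] ℝ)‖ *
        (‖phaseMul θ (axis μ) φ z‖ * C0 + ‖φ z‖ * C1))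
      Filter.univ_mem (Filter.Eventually.of_forall fun x =>
        (twisted_integrable θ φ g x).aestronglyMeasurable) (twisted_integrable θ φ g x) ?_ ?_ ?_ ?_
    · refine Finset.aestronglyMeasurable_fun_sum _ fun μ _ => ?_
      exact ((ContinuousLinearMap.smulRightL ℝ Plane ℂ
        (EuclideanSpace.proj μ)).continuous).comp_aestronglyMeasurable
          (hDint μ x).aestronglyMeasurable
    · refine Filter.Eventually.of_forall fun z x _ => ?_
      refine (norm_sum_le _ _).trans (Finset.sum_le_sum fun μ _ => ?_)
      rw [ContinuousLinearMap.norm_smulRight_apply]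
      gcongr
      refine (norm_add_le _ _).trans ?_
      simp only [hE, norm_mul, norm_exp_phase, one_mul]
      gcongr
      exacts [hC0 _, hC1 _ _]
    · refine integrable_finsetSum _ fun μ _ => Integrable.const_mul ?_ _
      exact (((phaseMul θ (axis μ) φ).integrable).norm.mul_const _).add
        ((φ.integrable).norm.mul_const _)
    · refine Filter.Eventually.of_forall fun z x _ => ?_
      have h1 : HasFDerivAt (fun x => phase θ x z) (phaseL θ z) x := (phaseL θ z).hasFDerivAt
      have h2 : HasFDerivAt (fun x : Plane => 2 * I * (phase θ x z : ℂ))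
          ((ContinuousLinearMap.mul ℝ ℂ (2 * I)) ∘L (Complex.ofRealCLM ∘L phaseL θ z)) x :=
        ((ContinuousLinearMap.mul ℝ ℂ (2 * I)) ∘L (Complex.ofRealCLM ∘L phaseL θ z)).hasFDerivAt
      have h3 := h2.cexp
      have h4 : HasFDerivAt (fun x : Plane => g (x + z)) (fderiv ℝ g (x + z)) x :=
        (hasFDerivAt_comp_add_right z).2 (g.hasFDerivAt (x + z))
      have h5 := h3.mul (h4.const_mul (φ z))
      refine h5.congr_fderiv ?_
      ext v
      have hp : (phaseL θ z) v = ∑ μ, v μ * phase θ (axis μ) z := by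
        conv_lhs => rw [sum_axis v]
        simp
        rfl
      have hg : fderiv ℝ g (x + z) v = ∑ μ, (v μ : ℂ) * (∂_{axis μ} g) (x + z) := by
        conv_lhs => rw [sum_axis v]
        simp [lineDerivOp_apply_eq_fderiv]
      simp [hF', hD, hE, hp, hg, phaseMul_apply, Fin.sum_univ_two]
      ring
  refine key.congr_fderiv ?_
  rw [hF', integral_finsetSum]
  · refine Finset.sum_congr rfl fun μ _ => ?_
    have h := ContinuousLinearMap.integral_comp_comm
      (ContinuousLinearMap.smulRightL ℝ Plane ℂ (EuclideanSpace.proj μ)) (hDint μ x)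
    have h2 : ∫ z, D μ x z = twisted θ (phaseMul θ (axis μ) φ) g x +
        twisted θ φ (∂_{axis μ} g) x :=
      integral_add (twisted_integrable θ _ g x) (twisted_integrable θ φ _ x)
    rw [h2] at h
    exact h
  · intro μ _
    exact ContinuousLinearMap.integrable_comp
      (ContinuousLinearMap.smulRightL ℝ Plane ℂ (EuclideanSpace.proj μ)) (hDint μ x)

theorem twisted_fderiv (θ : ℝ) (φ g : 𝓢(Plane, ℂ)) :
    fderiv ℝ (twisted θ φ g) = fun x => ∑ μ,
      (ContinuousLinearMap.smulRightL ℝ Plane ℂ (EuclideanSpace.proj μ) : ℂ →L[ℝ] _)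
        (twisted θ (phaseMul θ (axis μ) φ) g x + twisted θ φ (∂_{axis μ} g) x) := by
  ext1 x
  exact (twisted_hasFDerivAt θ φ g x).fderiv

theorem twisted_contDiff_nat (θ : ℝ) (n : ℕ) : ∀ φ g : 𝓢(Plane, ℂ),
    ContDiff ℝ n (twisted θ φ g) := by
  induction n with
  | zero =>
    intro φ g
    rw [Nat.cast_zero, contDiff_zero, continuous_iff_continuousAt]
    exact fun x => (twisted_hasFDerivAt θ φ g x).continuousAt
  | succ n ih =>
    intro φ g
    rw [Nat.cast_succ, contDiff_succ_iff_fderiv]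
    refine ⟨fun x => (twisted_hasFDerivAt θ φ g x).differentiableAt, by simp, ?_⟩
    rw [twisted_fderiv]
    refine ContDiff.sum fun μ _ => ?_
    exact (ContinuousLinearMap.contDiff _).comp ((ih _ _).add (ih _ _))

theorem twisted_iterated_decay (θ : ℝ) (k n : ℕ) : ∀ φ g : 𝓢(Plane, ℂ),
    ∃ C, ∀ x, ‖x‖ ^ k * ‖iteratedFDeriv ℝ n (twisted θ φ g) x‖ ≤ C := by
  induction n with
  | zero => intro φ g; simpa using twisted_decay θ k φ g
  | succ n ih =>
    intro φ g
    choose C1 h1 using fun μ => ih (phaseMul θ (axis μ) φ) g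
    choose C2 h2 using fun μ => ih φ (∂_{axis μ} g)
    set L : Fin 2 → ℂ →L[ℝ] Plane →L[ℝ] ℂ := fun μ =>
      ContinuousLinearMap.smulRightL ℝ Plane ℂ (EuclideanSpace.proj μ) with hL
    refine ⟨∑ μ, ‖L μ‖ * (C1 μ + C2 μ), fun x => ?_⟩
    have hs : ∀ μ, ContDiff ℝ n (twisted θ (phaseMul θ (axis μ) φ) g +
        twisted θ φ (∂_{axis μ} g)) := fun μ =>
      (twisted_contDiff_nat θ n _ _).add (twisted_contDiff_nat θ n _ _)
    have hf : fderiv ℝ (twisted θ φ g) = fun x => ∑ μ, (⇑(L μ) ∘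
        (twisted θ (phaseMul θ (axis μ) φ) g + twisted θ φ (∂_{axis μ} g))) x :=
      twisted_fderiv θ φ g
    rw [← norm_iteratedFDeriv_fderiv, hf, iteratedFDeriv_fun_sum_apply
      (fun μ _ => ((L μ).contDiff.comp (hs μ)).contDiffAt)]
    calc ‖x‖ ^ k * ‖∑ μ, iteratedFDeriv ℝ n (⇑(L μ) ∘
          (twisted θ (phaseMul θ (axis μ) φ) g + twisted θ φ (∂_{axis μ} g))) x‖
        ≤ ‖x‖ ^ k * ∑ μ, ‖L μ‖ * (‖iteratedFDeriv ℝ n (twisted θ (phaseMul θ (axis μ) φ) g) x‖ +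
            ‖iteratedFDeriv ℝ n (twisted θ φ (∂_{axis μ} g)) x‖) := by
          gcongr
          refine (norm_sum_le _ _).trans (Finset.sum_le_sum fun μ _ => ?_)
          refine ((L μ).norm_iteratedFDeriv_comp_left (hs μ).contDiffAt le_rfl).trans ?_
          gcongr
          rw [iteratedFDeriv_add_apply (twisted_contDiff_nat θ n _ _).contDiffAt
            (twisted_contDiff_nat θ n _ _).contDiffAt]
          exact norm_add_le _ _
      _ = ∑ μ, ‖L μ‖ * (‖x‖ ^ k * ‖iteratedFDeriv ℝ n (twisted θ (phaseMul θ (axis μ) φ) g) x‖ +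
            ‖x‖ ^ k * ‖iteratedFDeriv ℝ n (twisted θ φ (∂_{axis μ} g)) x‖) := by
          rw [Finset.mul_sum]
          refine Finset.sum_congr rfl fun μ _ => ?_
          ring
      _ ≤ _ := by
          gcongr with μ
          exacts [h1 μ x, h2 μ x]

/-- `twisted` as a Schwartz function. -/
def twistedSchwartz (θ : ℝ) (φ g : 𝓢(Plane, ℂ)) : 𝓢(Plane, ℂ) where
  toFun := twisted θ φ g
  smooth' := contDiff_infty.2 fun n => twisted_contDiff_nat θ n φ g
  decay' := fun k n => twisted_iterated_decay θ k n φ g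

theorem moyal_eq_schwartz {θ : ℝ} (hθ : 0 < θ) (f g : 𝓢(Plane, ℂ)) :
    moyal θ f g = ⇑(((1 / (Real.pi * θ) ^ 2 : ℝ) : ℂ) • twistedSchwartz θ
      (compCLMOfContinuousLinearEquiv ℂ (dualEquiv θ hθ) (𝓕 f)) g) := by
  ext x
  rw [moyal_eq_twisted hθ]
  rfl

/-- The Moyal product of two Schwartz functions as a Schwartz function: the product of the
algebra `𝔸 = (𝓢, ⋆)`. -/
def mul (θ : ℝ) [hθ : Fact (0 < θ)] (f g : 𝓢(Plane, ℂ)) : 𝓢(Plane, ℂ) where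
  toFun := moyal θ f g
  smooth' := by rw [moyal_eq_schwartz hθ.out]; exact SchwartzMap.smooth (_ : 𝓢(Plane, ℂ)) _
  decay' := by rw [moyal_eq_schwartz hθ.out]; exact SchwartzMap.decay' _

/-- Complex conjugation, the involution of `𝔸`. -/
def conjugate (a : 𝓢(Plane, ℂ)) : 𝓢(Plane, ℂ) :=
  postcompCLM (𝕜 := ℝ) (Complex.conjCLE : ℂ →L[ℝ] ℂ) a

/-- The C*-norm of `𝔸`: the operator norm of `L(a) : ψ ↦ a ⋆ ψ` on `L²(ℝ²)`. For `ψ` in `L²` the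
iterated integral that defines `a ⋆ ψ` converges at every point. -/
def cstarNorm (θ : ℝ) (a : 𝓢(Plane, ℂ)) : ℝ≥0∞ :=
  ⨆ (ψ : Plane → ℂ) (_ : MemLp ψ 2 volume) (_ : eLpNorm ψ 2 volume ≤ 1),
    eLpNorm (moyal θ a ψ) 2 volume

open scoped ComplexOrder in
/-- A state of the pre-C*-algebra `𝔸`: a positive linear functional of norm one. -/
structure State (θ : ℝ) [Fact (0 < θ)] where
  /-- the underlying linear functional -/
  toLin : 𝓢(Plane, ℂ) →ₗ[ℂ] ℂ
  positive : ∀ a, 0 ≤ toLin (mul θ (conjugate a) a)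
  norm_one : IsLUB {r : ℝ | ∃ a, cstarNorm θ a ≤ 1 ∧ r = ‖toLin a‖} 1

/-! ### Dirac operators and the spectral distance -/

/-- The matrices `σ¹, σ²` (indices shifted to `0, 1`). -/
def sigma : Fin 2 → Matrix (Fin 2) (Fin 2) ℂ := ![!![0, 1; 1, 0], !![0, I; -I, 0]]

/-- `σ³ = i σ¹ σ²`. -/
def sigma3 : Matrix (Fin 2) (Fin 2) ℂ := I • (sigma 0 * sigma 1)

/-- A spinor field with components indexed by `ι`. -/
abbrev Spinor (ι : Type) : Type := Plane → EuclideanSpace ℂ ι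

/-- The partial derivative `∂_μ ψ`. -/
def partialD {ι : Type} [Fintype ι] (μ : Fin 2) (ψ : Spinor ι) : Spinor ι :=
  fun x => fderiv ℝ ψ x (axis μ)

/-- A matrix acting on the components of a spinor. -/
def act {ι : Type} [Fintype ι] (M : Matrix ι ι ℂ) (v : EuclideanSpace ℂ ι) : EuclideanSpace ℂ ι :=
  WithLp.toLp 2 (M *ᵥ v.ofLp)

/-- `x̃_μ = 2 Θ⁻¹_{μν} x^ν`. -/
def xTilde (θ : ℝ) (μ : Fin 2) (x : Plane) : ℝ := 2 * ∑ ν, (Theta θ)⁻¹ μ ν * x ν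

/-- `γ^μ (-i ∂_μ)`. -/
def freeDirac {ι : Type} [Fintype ι] (γ : Fin 2 → Matrix ι ι ℂ) (ψ : Spinor ι) : Spinor ι :=
  fun x => ∑ μ, (-I) • act (γ μ) (partialD μ ψ x)

/-- `γ^μ (-i ∂_μ) - Ω γ^{μ+2} m(x̃_μ)`; the second family of matrices is `γ'`. -/
def harmonicDirac {ι : Type} [Fintype ι] (θ Ω : ℝ) (γ γ' : Fin 2 → Matrix ι ι ℂ)
    (ψ : Spinor ι) : Spinor ι :=
  fun x => freeDirac γ ψ x - ∑ μ, ((Ω * xTilde θ μ x : ℝ) : ℂ) • act (γ' μ) (ψ x)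

/-- `D_0 = -i σ^μ ∂_μ`. -/
def D0 : Spinor (Fin 2) → Spinor (Fin 2) := freeDirac sigma

/-- `D_1 = (1 ⊗ σ^μ)(-i ∂_μ) - Ω (σ^μ ⊗ σ³) m(x̃_μ)`. -/
def D1 (θ Ω : ℝ) : Spinor (Fin 2 × Fin 2) → Spinor (Fin 2 × Fin 2) :=
  harmonicDirac θ Ω (fun μ => 1 ⊗ₖ sigma μ) (fun μ => sigma μ ⊗ₖ sigma3)

/-- `D_2 = (σ³ ⊗ σ^μ)(-i ∂_μ) - Ω (σ^μ ⊗ 1) m(x̃_μ)`. -/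
def D2 (θ Ω : ℝ) : Spinor (Fin 2 × Fin 2) → Spinor (Fin 2 × Fin 2) :=
  harmonicDirac θ Ω (fun μ => sigma3 ⊗ₖ sigma μ) (fun μ => sigma μ ⊗ₖ 1)

/-- The domain of `D_0`: smooth spinors which are in `L²` together with all their derivatives. -/
def domL2 : Set (Spinor (Fin 2)) :=
  {ψ | ContDiff ℝ ((⊤ : ℕ∞) : WithTop ℕ∞) ψ ∧ ∀ n : ℕ, MemLp (iteratedFDeriv ℝ n ψ) 2 volume}

/-- The domain of `D_1` and `D_2`: Schwartz spinors. -/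
def domSchwartz : Set (Spinor (Fin 2 × Fin 2)) :=
  {ψ | ∃ u : 𝓢(Plane, EuclideanSpace ℂ (Fin 2 × Fin 2)), ψ = u}

/-- The norm of the commutator `[D, π(a)]`, where `π(a) = L(a) ⊗ 1` acts componentwise and `D` has
domain `Dom`: the supremum of its `L²`-norm on the unit ball of the dense subspace `Dom`. -/
def commutatorNorm {ι : Type} [Fintype ι] (θ : ℝ) (Dom : Set (Spinor ι))
    (D : Spinor ι → Spinor ι) (a : 𝓢(Plane, ℂ)) : ℝ≥0∞ :=
  ⨆ (ψ : Spinor ι) (_ : ψ ∈ Dom) (_ : eLpNorm ψ 2 volume ≤ 1),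
    eLpNorm (D (moyal θ a ψ) - moyal θ a (D ψ)) 2 volume

/-- The Lipschitz seminorm `‖[D_k, π(a)]‖` of the triple `𝔛(k)`. -/
def lipNorm (θ Ω : ℝ) (k : Fin 3) (a : 𝓢(Plane, ℂ)) : ℝ≥0∞ :=
  ![commutatorNorm θ domL2 D0 a, commutatorNorm θ domSchwartz (D1 θ Ω) a,
    commutatorNorm θ domSchwartz (D2 θ Ω) a] k

/-- The spectral distance `d_k`, with values in `[0, ∞]`. -/
def spectralDist {θ : ℝ} [Fact (0 < θ)] (Ω : ℝ) (k : Fin 3) (ω₁ ω₂ : State θ) : ℝ≥0∞ :=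
  ⨆ (a : 𝓢(Plane, ℂ)) (_ : lipNorm θ Ω k a ≤ 1), ENNReal.ofReal ‖ω₁.toLin a - ω₂.toLin a‖

/-- The state space of `𝔸`, to be equipped with the distance `d_k`. -/
def StateSpace (θ _Ω : ℝ) (_k : Fin 3) [Fact (0 < θ)] : Type := State θ

/-- The value `ω(a)`. -/
def StateSpace.eval {θ Ω : ℝ} {k : Fin 3} [Fact (0 < θ)] (ω : StateSpace θ Ω k)
    (a : 𝓢(Plane, ℂ)) : ℂ := State.toLin ω a

/-- The extended metric `d_k` and its topology. -/
instance (θ Ω : ℝ) (k : Fin 3) [Fact (0 < θ)] : PseudoEMetricSpace (StateSpace θ Ω k) where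
  edist ω₁ ω₂ := spectralDist Ω k ω₁ ω₂
  edist_self ω := by simp [spectralDist]
  edist_comm ω₁ ω₂ := by simp only [spectralDist, norm_sub_rev]
  edist_triangle ω₁ ω₂ ω₃ := by
    refine iSup₂_le fun a ha => ?_
    refine le_trans ?_ (add_le_add (le_iSup₂ (f := fun a _ => ENNReal.ofReal
      ‖State.toLin ω₁ a - State.toLin ω₂ a‖) a ha) (le_iSup₂ (f := fun a _ => ENNReal.ofReal
      ‖State.toLin ω₂ a - State.toLin ω₃ a‖) a ha))
    rw [← ENNReal.ofReal_add (norm_nonneg _) (norm_nonneg _)]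
    exact ENNReal.ofReal_le_ofReal (norm_sub_le_norm_sub_add_norm_sub _ _ _)

/-! ### The matrix basis and the states `ω_{ψ(s)}` -/

/-- The complex coordinate `z = (x₁ + i x₂) / √2`. -/
def zCoord (x : Plane) : ℂ := ((x 0 : ℂ) + I * (x 1 : ℂ)) / (Real.sqrt 2 : ℂ)

/-- `g ↦ g ⋆ z`. The inner integral of the product kernel is rapidly decreasing, hence the
iterated integral also converges for the polynomial `z` as second factor. -/
def mulZ (θ : ℝ) (g : Plane → ℂ) : Plane → ℂ := moyal θ g zCoord

/-- `g ↦ z̄ ⋆ g`, obtained from `z̄ ⋆ g = (ḡ ⋆ z)‾`. -/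
def zbarMul (θ : ℝ) (g : Plane → ℂ) : Plane → ℂ :=
  fun x => (starRingEnd ℂ) (mulZ θ (fun u => (starRingEnd ℂ) (g u)) x)

/-- `f_{00} = 2 exp (-2 H / θ)` with `H = z̄ z`. -/
def ground (θ : ℝ) (x : Plane) : ℂ :=
  2 * Complex.exp (-(2 / θ : ℂ) * ((starRingEnd ℂ) (zCoord x) * zCoord x))

/-- The matrix basis `f_{mn} = (θ^{m+n} m! n!)^{-1/2} z̄^{⋆m} ⋆ f_{00} ⋆ z^{⋆n}`. -/
def basisFun (θ : ℝ) (m n : ℕ) (x : Plane) : ℂ :=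
  ((1 / Real.sqrt (θ ^ (m + n) * m.factorial * n.factorial) : ℝ) : ℂ) *
    (zbarMul θ)^[m] ((mulZ θ)^[n] (ground θ)) x

/-- The coefficient `a_{mn}` of `a = ∑ a_{mn} f_{mn}`. -/
def coeff (θ : ℝ) (a : 𝓢(Plane, ℂ)) (m n : ℕ) : ℂ :=
  ((1 / (2 * Real.pi * θ) : ℝ) : ℂ) *
    ∫ x : Plane, (starRingEnd ℂ) (basisFun θ m n x) * a x

/-- The coefficient `ψ_m(s) = (2πθ)^{-1/2} (ζ(s) (m+1)^s)^{-1/2}`. -/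
def psi (θ s : ℝ) (m : ℕ) : ℝ :=
  1 / Real.sqrt (2 * Real.pi * θ) *
    Real.sqrt (1 / ((riemannZeta (s : ℂ)).re * ((m : ℝ) + 1) ^ s))

/-- `ω` is the vector state `ω_{ψ(s)} : a ↦ 2πθ ∑_{m,n} ψ_m(s)^* ψ_n(s) a_{mn}`. -/
def IsPsiState {θ Ω : ℝ} {k : Fin 3} [Fact (0 < θ)] (s : ℝ) (ω : StateSpace θ Ω k) : Prop :=
  ∀ a : 𝓢(Plane, ℂ), HasSum (fun p : ℕ × ℕ =>
    ((2 * Real.pi * θ : ℝ) : ℂ) * ((psi θ s p.1 : ℂ) * (psi θ s p.2 : ℂ) * coeff θ a p.1 p.2))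
    (ω.eval a)

/-- The set of states at finite distance `d_k` from `ω`. -/
def finiteClass {θ Ω : ℝ} {k : Fin 3} [Fact (0 < θ)] (ω : StateSpace θ Ω k) :
    Set (StateSpace θ Ω k) :=
  {η | edist η ω < ⊤}

/-- Any two states of `C` are joined inside `C` by the `d_k`-continuous path
`t ↦ (1 - t) ω₁ + t ω₂` of convex combinations. -/
def SegmentConnected {θ Ω : ℝ} {k : Fin 3} [Fact (0 < θ)] (C : Set (StateSpace θ Ω k)) : Prop :=
  ∀ ω₁ ∈ C, ∀ ω₂ ∈ C, ∃ γ : Path ω₁ ω₂,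
    (∀ t, γ t ∈ C) ∧
    ∀ t a, (γ t).eval a = (1 - (t : ℝ) : ℂ) * ω₁.eval a + ((t : ℝ) : ℂ) * ω₂.eval a

end Moyal

end

noncomputable section

open MeasureTheory SchwartzMap Complex
open scoped Matrix Kronecker ENNReal FourierTransform LineDeriv

namespace Moyal

/-! In an extended pseudometric space, the states at finite distance from a given one form a ball of
radius `⊤`, which is open and closed. Convex combinations of states are states, and a segment
between two states at finite distance is Lipschitz, so each such class is path-connected and is a
connected component (`connectedComponent_eq_finiteClass`). The point that needs an argument is that
a mixture has norm one: a bounded approximate unit supplies one element that nearly norms both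
states at once (`exists_approxUnit`, `State.eventually_approxUnit`).

It remains to find infinitely many states at mutually infinite distance. For all three Dirac
operators the commutator with `π(a)` is a combination of the operators `L(∂_μ a)` with constant
matrices (`freeDirac_comm`, `harmonicDirac_comm`); hence the Lipschitz seminorm is at most a
constant times the sum of the norms of `L(∂_μ a)` (`exists_lipNorm_le`).

The functions `f_{mn}` are matrix units, and the derivative `∂₀ + i∂₁` is, up to a constant, the
commutator with `z`. It sends the diagonal element `∑ α_m f_{mm}` to a weighted shift with weights
`(α_{m+1} - α_m) √(θ(m+1))`. Since `√(m+1) - √m ≤ 1/√(m+1)`, the coefficients `α_m = c(√N - √m)`, `m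
< N`, give admissible elements with `c` independent of `N` (`exists_ramp_lipNorm_le`).

On diagonal elements `ω_{ψ(s)}` is the expectation for the zeta distribution `w_s(m) =
1/(ζ(s)(m+1)^s)`. For `s₁ < s₂` the two states differ on the ramp by `c(√N ∑_{m<N}(w_{s₁} - w_{s₂})
- ∑_{m<N}(w_{s₁} - w_{s₂})√m)`. For large `N` the first sum is nonpositive, because the distribution
for `s₁` has the heavier tail; the second sum is unbounded as soon as `s₁ ≤ 3/2`, because `∑
(m+1)^{1/2-s₁}` diverges. So the distance is infinite (`edist_psiPoint`).

The analytic facts come from writing `L(a)` as a superposition of magnetic translations weighted by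
the rescaled Fourier transform `symbol θ a`. Associativity, the trace property, the adjoint, the
`L²` bounds and the Leibniz rule are all read off from that integral. -/

/-- The kernel `exp (2i x^μ Θ⁻¹_{μν} z^ν)`. -/
def wave (θ : ℝ) (x z : Plane) : ℂ := Complex.exp (2 * I * (phase θ x z : ℂ))

theorem norm_wave (θ : ℝ) (x z : Plane) : ‖wave θ x z‖ = 1 := norm_exp_phase θ x z

@[fun_prop]
theorem Continuous.wave {X : Type*} [TopologicalSpace X] {f g : X → Plane} (θ : ℝ)
    (hf : Continuous f) (hg : Continuous g) : Continuous fun t => wave θ (f t) (g t) := by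
  unfold Moyal.wave phase; fun_prop

theorem phase_add_right (θ : ℝ) (x y z : Plane) :
    phase θ x (y + z) = phase θ x y + phase θ x z := by
  simp [phase, Fin.sum_univ_two]; ring

theorem wave_add_left (θ : ℝ) (x y z : Plane) :
    wave θ (x + y) z = wave θ x z * wave θ y z := by
  rw [wave, wave, wave, ← Complex.exp_add, phase_add_left]; congr 1; push_cast; ring

theorem wave_add_right (θ : ℝ) (x y z : Plane) :
    wave θ x (y + z) = wave θ x y * wave θ x z := by
  rw [wave, wave, wave, ← Complex.exp_add, phase_add_right]; congr 1; push_cast; ring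

theorem wave_conj (θ : ℝ) (x z : Plane) :
    (starRingEnd ℂ) (wave θ x z) = Complex.exp (-2 * I * (phase θ x z : ℂ)) := by
  rw [wave, ← Complex.exp_conj]; congr 1; simp [Complex.conj_ofNat]

theorem wave_neg_right (θ : ℝ) (x z : Plane) :
    wave θ x (-z) = (starRingEnd ℂ) (wave θ x z) := by
  rw [wave_conj, wave]; congr 1
  have : phase θ x (-z) = - phase θ x z := by simp [phase, Fin.sum_univ_two]; ring
  rw [this]; push_cast; ring

variable {θ : ℝ} [hθ : Fact (0 < θ)]

theorem phase_swap (x z : Plane) : phase θ z x = - phase θ x z := by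
  rw [phase_eq hθ.out, phase_eq hθ.out]; ring

theorem wave_swap (x z : Plane) : wave θ z x = (starRingEnd ℂ) (wave θ x z) := by
  rw [wave_conj, wave, phase_swap]; congr 1; push_cast; ring

theorem wave_self (x : Plane) : wave θ x x = 1 := by
  have : phase θ x x = 0 := by rw [phase_eq hθ.out]; ring
  simp [wave, this]

theorem wave_mul_conj (θ : ℝ) (x z : Plane) : wave θ x z * (starRingEnd ℂ) (wave θ x z) = 1 := by
  rw [Complex.mul_conj, Complex.normSq_eq_norm_sq, norm_wave]; simp

/-- The rotation by a right angle which underlies `dualEquiv`. -/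
def rot : Plane ≃ₗᵢ[ℝ] Plane where
  toFun := fun z => !₂[-(z 1), z 0]
  invFun := fun w => !₂[w 1, -(w 0)]
  map_add' := fun z w => by ext i; fin_cases i <;> simp; ring
  map_smul' := fun c z => by ext i; fin_cases i <;> simp
  left_inv := fun z => by ext i; fin_cases i <;> simp
  right_inv := fun z => by ext i; fin_cases i <;> simp
  norm_map' := fun z => by
    simp [EuclideanSpace.norm_eq, Fin.sum_univ_two, add_comm]

theorem dualEquiv_eq (z : Plane) : dualEquiv θ hθ.out z = (Real.pi * θ)⁻¹ • rot z := by
  ext i; fin_cases i <;> simp [dualEquiv, rot] <;> ring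

/-- The map is `(πθ)⁻¹` times an isometry of a two-dimensional space, which gives the Jacobian
factor. -/
theorem integral_comp_dualEquiv {F : Type*} [NormedAddCommGroup F] [NormedSpace ℝ F]
    (f : Plane → F) :
    ∫ z, f (dualEquiv θ hθ.out z) = ((Real.pi * θ) ^ 2) • ∫ w, f w := by
  simp_rw [dualEquiv_eq]
  have h := (rot.measurePreserving).integral_comp rot.toHomeomorph.measurableEmbedding
    (fun w => f ((Real.pi * θ)⁻¹ • w))
  rw [h, Measure.integral_comp_smul]
  congr 1
  rw [finrank_euclideanSpace_fin, inv_pow, inv_inv, abs_of_nonneg (sq_nonneg _)]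

/-- The constant `(πθ)⁻²`. -/
def cnst (θ : ℝ) : ℂ := ((1 / (Real.pi * θ) ^ 2 : ℝ) : ℂ)

theorem cnst_ne_zero : cnst θ ≠ 0 := by
  have := hθ.out.ne'
  have := Real.pi_pos.ne'
  unfold cnst
  norm_cast
  positivity

/-- The symbol of `a`: the operator `L(a)` is the superposition of the magnetic translations
`ψ ↦ wave θ · z * ψ (· + z)` with weight `symbol a z`. -/
def symbol (θ : ℝ) [hθ : Fact (0 < θ)] : 𝓢(Plane, ℂ) →ₗ[ℂ] 𝓢(Plane, ℂ) where
  toFun a := cnst θ • compCLMOfContinuousLinearEquiv ℂ (dualEquiv θ hθ.out) (𝓕 a)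
  map_add' a b := by rw [FourierTransform.fourier_add, map_add, smul_add]
  map_smul' c a := by
    rw [FourierTransform.fourier_smul, map_smul, smul_comm]; rfl

theorem symbol_apply (a : 𝓢(Plane, ℂ)) (z : Plane) :
    symbol θ a z = cnst θ * ∫ u, wave θ z u * a u := by
  change cnst θ • (compCLMOfContinuousLinearEquiv ℂ (dualEquiv θ hθ.out) (𝓕 a) : 𝓢(Plane, ℂ)) z = _
  rw [compCLMOfContinuousLinearEquiv_apply, Function.comp, fourier_coe, Real.fourier_eq', smul_eq_mul]
  congr 2
  ext u
  rw [wave_swap u z, wave_conj, smul_eq_mul, ← inner_dualEquiv hθ.out u z]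
  congr 2
  push_cast
  ring

theorem symbol_surjective (φ : 𝓢(Plane, ℂ)) : ∃ a, symbol θ a = φ := by
  refine ⟨(cnst θ)⁻¹ • 𝓕⁻ (compCLMOfContinuousLinearEquiv ℂ (dualEquiv θ hθ.out).symm φ :
    𝓢(Plane, ℂ)), ?_⟩
  rw [map_smul]
  change (cnst θ)⁻¹ • (cnst θ • compCLMOfContinuousLinearEquiv ℂ (dualEquiv θ hθ.out) (𝓕 (𝓕⁻ _)))
    = φ
  rw [smul_smul, inv_mul_cancel₀ cnst_ne_zero, one_smul, FourierTransform.fourier_fourierInv_eq]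
  ext z
  simp [compCLMOfContinuousLinearEquiv_apply]

/-- This is Fourier inversion after the change of variables `dualEquiv`, whose Jacobian cancels the
constant `cnst`. -/
theorem symbol_inversion (a : 𝓢(Plane, ℂ)) (x : Plane) :
    a x = ∫ z, wave θ x z * symbol θ a z := by
  have h1 : 𝓕⁻ (𝓕 a) = a := FourierTransform.fourierInv_fourier_eq a
  have h2 : a x = ∫ v, Complex.exp ((2 * Real.pi * inner ℝ v x : ℝ) * I) • (𝓕 a) v := by
    conv_lhs => rw [← h1]
    rw [fourierInv_coe, Real.fourierInv_eq']
  have h3 := integral_comp_dualEquiv (θ := θ)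
    (fun v => Complex.exp ((2 * Real.pi * inner ℝ v x : ℝ) * I) • (𝓕 a) v)
  rw [← h2] at h3
  have h4 : ∀ z, wave θ x z * symbol θ a z = cnst θ *
      (Complex.exp ((2 * Real.pi * inner ℝ (dualEquiv θ hθ.out z) x : ℝ) * I) •
        (𝓕 a) (dualEquiv θ hθ.out z)) := by
    intro z
    change wave θ x z * (cnst θ • (compCLMOfContinuousLinearEquiv ℂ (dualEquiv θ hθ.out) (𝓕 a) :
      𝓢(Plane, ℂ)) z) = _
    rw [compCLMOfContinuousLinearEquiv_apply, Function.comp, smul_eq_mul, smul_eq_mul,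
      real_inner_comm, wave, ← inner_dualEquiv hθ.out x z]
    rw [mul_left_comm]
    congr 3
    push_cast
    ring
  simp_rw [h4]
  rw [integral_const_mul, h3, cnst, Complex.real_smul, ← mul_assoc, ← Complex.ofReal_mul,
    one_div, inv_mul_cancel₀]
  · simp
  · have := hθ.out.ne'
    have := Real.pi_pos.ne'
    positivity

/-- The substitution `u = x + y` in the inner integral turns it into a Fourier transform of `a` and
splits off the phase `wave θ x z`. What remains is a superposition of the translations `ψ ↦ wave θ ·
z * ψ (· + z)`. -/
theorem moyal_eq_integral {F : Type*} [NormedAddCommGroup F] [NormedSpace ℂ F] [CompleteSpace F]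
    (a : 𝓢(Plane, ℂ)) (ψ : Plane → F) (x : Plane) :
    moyal θ a ψ x = ∫ z, (wave θ x z * symbol θ a z) • ψ (x + z) := by
  unfold moyal
  rw [← integral_smul]
  congr 1
  ext z
  rw [integral_smul_const, smul_smul]
  congr 1
  rw [symbol_apply, ← integral_add_left_eq_self (fun u => wave θ z u * a u) x,
    mul_left_comm]
  change cnst θ * _ = _
  rw [← integral_const_mul (wave θ x z)]
  congr 2
  funext y
  rw [wave_add_right, wave_swap x z, ← mul_assoc, ← mul_assoc, wave_mul_conj, one_mul,
    wave_swap y z, wave_conj, mul_comm]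

theorem mul_apply (f g : 𝓢(Plane, ℂ)) (x : Plane) :
    mul θ f g x = ∫ z, wave θ x z * symbol θ f z * g (x + z) := by
  change moyal θ f g x = _
  rw [moyal_eq_integral]
  rfl

@[simp] theorem conjugate_apply (a : 𝓢(Plane, ℂ)) (x : Plane) :
    conjugate a x = (starRingEnd ℂ) (a x) := rfl

theorem conjugate_conjugate (a : 𝓢(Plane, ℂ)) : conjugate (conjugate a) = a := by
  ext x; simp

theorem symbol_conjugate (a : 𝓢(Plane, ℂ)) (z : Plane) :
    symbol θ (conjugate a) z = (starRingEnd ℂ) (symbol θ a (-z)) := by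
  rw [symbol_apply, symbol_apply, map_mul, ← integral_conj, cnst, Complex.conj_ofReal]
  congr 2
  ext u
  rw [map_mul, ← wave_swap, wave_neg_right, ← wave_swap, conjugate_apply]

/-- The Moyal product as a superposition of right translations. -/
theorem mul_apply_right (f g : 𝓢(Plane, ℂ)) (x : Plane) :
    mul θ f g x = ∫ y, wave θ y x * symbol θ g (-y) * f (x + y) := by
  have hi : ∀ (h : 𝓢(Plane, ℂ)) (y : Plane), Integrable fun z => wave θ z y * h z := by
    intro h y
    have h1 := h.continuous
    refine (h.integrable (μ := volume)).mono
      (Continuous.aestronglyMeasurable (by fun_prop)) (Filter.Eventually.of_forall fun z => ?_)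
    rw [norm_mul, norm_wave, one_mul]
  -- both sides are the double integral of `symbol f` and `symbol g` against the same kernel
  have key : mul θ f g x = ∫ z, ∫ y, wave θ x z * symbol θ f z * (wave θ (x + z) y * symbol θ g y) := by
    rw [mul_apply]
    congr 1
    ext z
    rw [integral_const_mul, ← symbol_inversion]
  rw [key, integral_integral_swap, ← integral_neg_eq_self]
  · congr 1
    ext y
    have h1 : ∀ z, wave θ x z * symbol θ f z * (wave θ (x + z) (-y) * symbol θ g (-y)) =
        wave θ y x * symbol θ g (-y) * (wave θ (x + y) z * symbol θ f z) := by
      intro z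
      rw [wave_add_left, wave_add_left, wave_neg_right, wave_neg_right, ← wave_swap x y,
        ← wave_swap z y]
      ring
    simp_rw [h1]
    rw [integral_const_mul, ← symbol_inversion]
  · have hp : Integrable (fun p : Plane × Plane => symbol θ f p.1 * symbol θ g p.2)
        (volume.prod volume) := (symbol θ f).integrable.mul_prod (symbol θ g).integrable
    refine hp.mono ?_ (Filter.Eventually.of_forall fun p => ?_)
    · refine Continuous.aestronglyMeasurable ?_
      have h3 := (symbol θ f).continuous
      have h4 := (symbol θ g).continuous
      simp only [Function.uncurry_def]
      fun_prop
    · simp [Function.uncurry_def, norm_wave]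

/-- Conjugation carries the superposition of right translations in `mul_apply_right` into the one of
left translations in `mul_apply`. -/
theorem conjugate_mul (f g : 𝓢(Plane, ℂ)) :
    conjugate (mul θ f g) = mul θ (conjugate g) (conjugate f) := by
  ext x
  rw [conjugate_apply, mul_apply_right, mul_apply, ← integral_conj]
  congr 1
  ext y
  rw [symbol_conjugate, map_mul, map_mul, ← wave_swap, conjugate_apply]

theorem norm_le_const (f : 𝓢(Plane, ℂ)) : ∃ C, 0 ≤ C ∧ ∀ x, ‖f x‖ ≤ C :=
  ⟨SchwartzMap.seminorm ℝ 0 0 f, apply_nonneg _ _, fun x => norm_le_seminorm ℝ f x⟩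

/-- Multiplication by `f` on the left and by `h` on the right are superpositions of two kinds of
magnetic translations which commute with each other, so that associativity is Fubini's theorem.
Boundedness of `g` and integrability of both symbols justify the exchange. -/
theorem mul_assoc' (f g h : 𝓢(Plane, ℂ)) :
    mul θ (mul θ f g) h = mul θ f (mul θ g h) := by
  ext x
  rw [mul_apply_right, mul_apply]
  simp_rw [mul_apply_right g h, mul_apply f g, ← integral_const_mul]
  rw [integral_integral_swap]
  · congr 1
    ext z
    congr 1
    ext y
    rw [wave_add_left, wave_add_right, add_right_comm]
    ring
  · obtain ⟨C, hC, hg⟩ := norm_le_const g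
    have hs : Integrable fun y : Plane => symbol θ h (-y) := (symbol θ h).integrable.comp_neg
    have hp : Integrable (fun p : Plane × Plane => C * (‖symbol θ h (-p.1)‖ * ‖symbol θ f p.2‖))
        (volume.prod volume) := (hs.norm.mul_prod (symbol θ f).integrable.norm).const_mul C
    refine hp.mono' ?_ (Filter.Eventually.of_forall fun p => ?_)
    · refine Continuous.aestronglyMeasurable ?_
      have h3 := (symbol θ f).continuous
      have h4 := (symbol θ h).continuous
      have h5 := g.continuous
      simp only [Function.uncurry_def]
      fun_prop
    · simp only [Function.uncurry_def, norm_mul, norm_wave, one_mul]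
      calc _ = ‖g (x + p.1 + p.2)‖ * (‖symbol θ h (-p.1)‖ * ‖symbol θ f p.2‖) := by ring
        _ ≤ _ := by gcongr; exact hg _

/-- The shift `x ↦ x + z` leaves the phase unchanged, as `wave θ z z = 1`; the integral over `z`
then restores `f` by inversion. Consequently the integral is a trace. -/
theorem integral_mul (f g : 𝓢(Plane, ℂ)) : ∫ x, mul θ f g x = ∫ x, f x * g x := by
  have hg : Integrable g (volume : Measure Plane) := g.integrable
  have hf : Integrable (symbol θ f) (volume : Measure Plane) := (symbol θ f).integrable
  have h3 := (symbol θ f).continuous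
  have h5 := g.continuous
  simp_rw [mul_apply]
  rw [integral_integral_swap]
  · have h1 : ∀ z, ∫ x, wave θ x z * symbol θ f z * g (x + z) =
        ∫ u, wave θ u z * symbol θ f z * g u := by
      intro z
      rw [← integral_add_right_eq_self (fun u => wave θ u z * symbol θ f z * g u) z]
      simp_rw [wave_add_left, wave_self, mul_one]
    simp_rw [h1]
    rw [integral_integral_swap]
    · congr 1
      ext u
      rw [integral_mul_const, ← symbol_inversion]
    · have hp : Integrable (fun p : Plane × Plane => symbol θ f p.1 * g p.2)
          (volume.prod volume) := hf.mul_prod hg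
      refine hp.mono ?_ (Filter.Eventually.of_forall fun p => ?_)
      · refine Continuous.aestronglyMeasurable ?_
        simp only [Function.uncurry_def]
        fun_prop
      · simp [Function.uncurry_def, norm_wave]
  · have hp : Integrable (fun p : Plane × Plane => g (p.1 + p.2) * symbol θ f p.2)
        (volume.prod volume) :=
      (measurePreserving_add_prod volume volume (G := Plane)).integrable_comp_of_integrable
        (hg.mul_prod hf)
    refine hp.mono ?_ (Filter.Eventually.of_forall fun p => ?_)
    · refine Continuous.aestronglyMeasurable ?_
      simp only [Function.uncurry_def]
      fun_prop
    · simp [Function.uncurry_def, norm_wave, mul_comm]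

/-! ### Bounds on `L²` -/

section Bound
variable {F : Type*} [NormedAddCommGroup F] [NormedSpace ℂ F] [CompleteSpace F]

theorem memLp_comp_add {F : Type*} [NormedAddCommGroup F] {ψ : Plane → F} (hψ : MemLp ψ 2 volume) (x : Plane) :
    MemLp (fun z => ψ (x + z)) 2 volume :=
  hψ.comp_measurePreserving (measurePreserving_add_left volume x)

theorem memLp_kernel (a : 𝓢(Plane, ℂ)) (x : Plane) (p : ℝ≥0∞) :
    MemLp (fun z => wave θ x z * symbol θ a z) p volume := by
  have h := (symbol θ a).continuous
  refine ((symbol θ a).memLp p volume).of_le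
    (Continuous.aestronglyMeasurable (by fun_prop)) (Filter.Eventually.of_forall fun z => ?_)
  rw [norm_mul, norm_wave, one_mul]

omit [CompleteSpace F] in
theorem integrable_kernel_smul (a : 𝓢(Plane, ℂ)) {ψ : Plane → F} (hψ : MemLp ψ 2 volume)
    (x : Plane) : Integrable fun z => (wave θ x z * symbol θ a z) • ψ (x + z) :=
  memLp_one_iff_integrable.1 ((memLp_comp_add hψ x).smul (memLp_kernel a x 2))

/-- At every point the product is an integral against `ψ`, so that a change on a null set alters no
value. This makes `L(a)` well defined on classes. -/
theorem moyal_congr_ae (a : 𝓢(Plane, ℂ)) {ψ χ : Plane → F} (h : ψ =ᵐ[volume] χ) :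
    moyal θ a ψ = moyal θ a χ := by
  ext x
  rw [moyal_eq_integral, moyal_eq_integral]
  refine integral_congr_ae ?_
  have h1 := (measurePreserving_add_left (volume : Measure Plane) x).quasiMeasurePreserving.ae_eq_comp h
  filter_upwards [h1] with z hz
  have hz' : ψ (x + z) = χ (x + z) := hz
  rw [hz']

theorem moyal_add_right (a : 𝓢(Plane, ℂ)) {ψ χ : Plane → F} (hψ : MemLp ψ 2 volume)
    (hχ : MemLp χ 2 volume) : moyal θ a (ψ + χ) = moyal θ a ψ + moyal θ a χ := by
  ext x
  rw [Pi.add_apply, moyal_eq_integral, moyal_eq_integral, moyal_eq_integral,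
    ← integral_add (integrable_kernel_smul a hψ x) (integrable_kernel_smul a hχ x)]
  congr 1
  ext z
  rw [← smul_add]; rfl

theorem moyal_smul_right (a : 𝓢(Plane, ℂ)) (c : ℂ) (ψ : Plane → F) :
    moyal θ a (c • ψ) = c • moyal θ a ψ := by
  ext x
  rw [Pi.smul_apply, moyal_eq_integral, moyal_eq_integral, ← integral_smul]
  congr 1
  ext z
  rw [smul_comm]; rfl

theorem moyal_add_left (a b : 𝓢(Plane, ℂ)) {ψ : Plane → F} (hψ : MemLp ψ 2 volume) :
    moyal θ (⇑(a + b)) ψ = moyal θ a ψ + moyal θ b ψ := by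
  ext x
  rw [Pi.add_apply, moyal_eq_integral, moyal_eq_integral, moyal_eq_integral,
    ← integral_add (integrable_kernel_smul a hψ x) (integrable_kernel_smul b hψ x)]
  congr 1
  ext z
  rw [map_add, ← add_smul, ← mul_add]; rfl

theorem moyal_smul_left (a : 𝓢(Plane, ℂ)) (c : ℂ) (ψ : Plane → F) :
    moyal θ (⇑(c • a)) ψ = c • moyal θ a ψ := by
  ext x
  rw [Pi.smul_apply, moyal_eq_integral, moyal_eq_integral, ← integral_smul]
  congr 1
  ext z
  rw [map_smul, smul_smul, mul_left_comm]; rfl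

theorem aestronglyMeasurable_moyal (a : 𝓢(Plane, ℂ)) {ψ : Plane → F}
    (hψ : AEStronglyMeasurable ψ volume) : AEStronglyMeasurable (moyal θ a ψ) volume := by
  have h : moyal θ a ψ = fun x => ∫ z, (wave θ x z * symbol θ a z) • ψ (x + z) := by
    ext x; exact moyal_eq_integral a ψ x
  rw [h]
  have hs := (symbol θ a).continuous
  refine AEStronglyMeasurable.integral_prod_right'
    (f := fun p : Plane × Plane => (wave θ p.1 p.2 * symbol θ a p.2) • ψ (p.1 + p.2)) ?_
  refine AEStronglyMeasurable.smul (Continuous.aestronglyMeasurable (by fun_prop)) ?_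
  have h2 : AEStronglyMeasurable (fun p : Plane × Plane => ψ p.1) (volume.prod volume) := hψ.comp_fst
  exact h2.comp_measurePreserving (measurePreserving_add_prod volume volume (G := Plane))

/-- Cauchy–Schwarz for the measure `f dμ`, obtained by splitting `f g = √f · (√f g)`. -/
theorem lintegral_mul_sq_le {α : Type*} [MeasurableSpace α] {μ : Measure α} {f g : α → ℝ≥0∞}
    (hf : AEMeasurable f μ) (hg : AEMeasurable g μ) :
    (∫⁻ z, f z * g z ∂μ) ^ 2 ≤ (∫⁻ z, f z ∂μ) * ∫⁻ z, f z * g z ^ 2 ∂μ := by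
  have h := ENNReal.lintegral_mul_le_Lp_mul_Lq μ Real.HolderConjugate.two_two
    (f := fun z => f z ^ (1 / 2 : ℝ)) (g := fun z => f z ^ (1 / 2 : ℝ) * g z)
    (hf.pow_const _) ((hf.pow_const _).mul hg)
  have e1 : ∀ t : ℝ≥0∞, t ^ (1 / 2 : ℝ) * t ^ (1 / 2 : ℝ) = t := by
    intro t
    rw [← ENNReal.rpow_add_of_nonneg _ _ (by norm_num) (by norm_num)]; norm_num
  have e2 : ∀ t : ℝ≥0∞, (t ^ (1 / 2 : ℝ)) ^ 2 = t := fun t => by rw [sq, e1]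
  simp only [Pi.mul_apply, ← mul_assoc, e1, ENNReal.rpow_ofNat, mul_pow, e2] at h
  calc _ ≤ ((∫⁻ z, f z ∂μ) ^ (1 / 2 : ℝ) * (∫⁻ z, f z * g z ^ 2 ∂μ) ^ (1 / 2 : ℝ)) ^ 2 := by gcongr
    _ = _ := by rw [mul_pow, e2, e2]

/-- The operator norm of `L(a)` is at most the `L¹`-norm of the symbol. -/
theorem eLpNorm_moyal_le (a : 𝓢(Plane, ℂ)) {ψ : Plane → F}
    (hψ : AEStronglyMeasurable ψ volume) :
    eLpNorm (moyal θ a ψ) 2 volume ≤ (∫⁻ z, ‖symbol θ a z‖ₑ) * eLpNorm ψ 2 volume := by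
  set S := ∫⁻ z, ‖symbol θ a z‖ₑ with hS
  have hs := (symbol θ a).continuous
  have hm : AEMeasurable (fun z => ‖symbol θ a z‖ₑ) (volume : Measure Plane) := by fun_prop
  -- Young's inequality: Cauchy–Schwarz for the weight `|symbol|` pointwise in `x`, followed by
  -- Tonelli and translation invariance.
  have h1 : ∀ x, ‖moyal θ a ψ x‖ₑ ^ 2 ≤ S * ∫⁻ z, ‖symbol θ a z‖ₑ * ‖ψ (x + z)‖ₑ ^ 2 := by
    intro x
    have hψx : AEStronglyMeasurable (fun z => ψ (x + z)) volume :=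
      hψ.comp_measurePreserving (measurePreserving_add_left volume x)
    refine le_trans ?_ (lintegral_mul_sq_le hm hψx.enorm)
    gcongr
    rw [moyal_eq_integral]
    refine (enorm_integral_le_lintegral_enorm _).trans (le_of_eq ?_)
    congr 1
    ext z
    rw [enorm_smul, enorm_mul]
    have : ‖wave θ x z‖ₑ = 1 := by rw [← ofReal_norm, norm_wave]; simp
    rw [this, one_mul]
  have h2 : ∫⁻ x, ‖moyal θ a ψ x‖ₑ ^ 2 ≤ S ^ 2 * ∫⁻ x, ‖ψ x‖ₑ ^ 2 := by
    have hj : AEMeasurable (fun p : Plane × Plane => ‖symbol θ a p.2‖ₑ * ‖ψ (p.1 + p.2)‖ₑ ^ 2)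
        (volume.prod volume) := by
      have h2 : AEStronglyMeasurable (fun p : Plane × Plane => ψ p.1) (volume.prod volume) :=
        hψ.comp_fst
      have h3 := h2.comp_measurePreserving (measurePreserving_add_prod volume volume (G := Plane))
      have h4 : AEMeasurable (fun p : Plane × Plane => ‖ψ (p.1 + p.2)‖ₑ) (volume.prod volume) :=
        h3.enorm
      have h5 : AEMeasurable (fun p : Plane × Plane => ‖symbol θ a p.2‖ₑ)
        (volume.prod volume) := by fun_prop
      exact h5.mul (h4.pow_const 2)
    calc _ ≤ ∫⁻ x, S * ∫⁻ z, ‖symbol θ a z‖ₑ * ‖ψ (x + z)‖ₑ ^ 2 := lintegral_mono h1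
      _ = S * ∫⁻ x, ∫⁻ z, ‖symbol θ a z‖ₑ * ‖ψ (x + z)‖ₑ ^ 2 :=
        lintegral_const_mul'' _ hj.lintegral_prod_right'
      _ = S * ∫⁻ z, ∫⁻ x, ‖symbol θ a z‖ₑ * ‖ψ (x + z)‖ₑ ^ 2 := by
        rw [lintegral_lintegral_swap hj]
      _ = S * ∫⁻ z, ‖symbol θ a z‖ₑ * ∫⁻ x, ‖ψ x‖ₑ ^ 2 := by
        congr 2
        ext z
        rw [lintegral_const_mul' _ _ enorm_ne_top,
          lintegral_add_right_eq_self (fun x => ‖ψ x‖ₑ ^ 2) z]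
      _ = _ := by
        rw [lintegral_mul_const'' _ hm]; ring
  have e : ∀ f : Plane → F, eLpNorm f 2 volume = (∫⁻ x, ‖f x‖ₑ ^ 2) ^ (1 / 2 : ℝ) := by
    intro f
    rw [eLpNorm_eq_lintegral_rpow_enorm_toReal (by norm_num) (by norm_num)]
    simp
  rw [e, e]
  calc _ ≤ (S ^ 2 * ∫⁻ x, ‖ψ x‖ₑ ^ 2) ^ (1 / 2 : ℝ) := by gcongr
    _ = _ := by
      rw [ENNReal.mul_rpow_of_nonneg _ _ (by norm_num), ← ENNReal.rpow_two, ← ENNReal.rpow_mul]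
      norm_num

theorem lintegral_enorm_symbol_ne_top (a : 𝓢(Plane, ℂ)) : ∫⁻ z, ‖symbol θ a z‖ₑ ≠ ⊤ :=
  ((symbol θ a).integrable (μ := volume)).2.ne

theorem memLp_moyal (a : 𝓢(Plane, ℂ)) {ψ : Plane → F} (hψ : MemLp ψ 2 volume) :
    MemLp (moyal θ a ψ) 2 volume :=
  ⟨aestronglyMeasurable_moyal a hψ.1, (eLpNorm_moyal_le a hψ.1).trans_lt
    (ENNReal.mul_lt_top (lintegral_enorm_symbol_ne_top a).lt_top hψ.2)⟩

end Bound

/-! ### The left regular representation and the C*-norm -/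

/-- The Hilbert space `L²(ℝ²)`. -/
abbrev Hilb : Type := Lp ℂ 2 (volume : Measure Plane)

/-- The operator `ψ ↦ a ⋆ ψ` on `L²(ℝ²)`. -/
def leftOp (θ : ℝ) [hθ : Fact (0 < θ)] (a : 𝓢(Plane, ℂ)) : Hilb →L[ℂ] Hilb :=
  LinearMap.mkContinuous
    { toFun := fun ψ => (memLp_moyal (θ := θ) a (Lp.memLp ψ)).toLp
      map_add' := fun ψ χ => by
        rw [← MemLp.toLp_add]
        congr 1
        rw [moyal_congr_ae a (Lp.coeFn_add ψ χ), moyal_add_right a (Lp.memLp ψ) (Lp.memLp χ)]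
      map_smul' := fun c ψ => by
        rw [RingHom.id_apply, ← MemLp.toLp_const_smul]
        congr 1
        rw [moyal_congr_ae a (Lp.coeFn_smul c ψ), moyal_smul_right] }
    (∫⁻ z, ‖symbol θ a z‖ₑ).toReal (fun ψ => by
      change ‖(memLp_moyal (θ := θ) a (Lp.memLp ψ)).toLp‖ ≤ _
      rw [Lp.norm_toLp, Lp.norm_def, ← ENNReal.toReal_mul]
      exact ENNReal.toReal_mono (ENNReal.mul_ne_top (lintegral_enorm_symbol_ne_top a)
        (Lp.memLp ψ).2.ne) (eLpNorm_moyal_le a (Lp.memLp ψ).1))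

theorem leftOp_apply (a : 𝓢(Plane, ℂ)) (ψ : Hilb) :
    leftOp θ a ψ = (memLp_moyal (θ := θ) a (Lp.memLp ψ)).toLp := rfl

/-- The left regular representation of the Moyal algebra on `L²(ℝ²)`. -/
def leftRep (θ : ℝ) [hθ : Fact (0 < θ)] : 𝓢(Plane, ℂ) →ₗ[ℂ] Hilb →L[ℂ] Hilb where
  toFun := leftOp θ
  map_add' a b := by
    ext1 ψ
    rw [add_apply, leftOp_apply, leftOp_apply, leftOp_apply,
      ← MemLp.toLp_add]
    congr 1
    exact moyal_add_left a b (Lp.memLp ψ)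
  map_smul' c a := by
    ext1 ψ
    rw [RingHom.id_apply, smul_apply, leftOp_apply, leftOp_apply,
      ← MemLp.toLp_const_smul]
    congr 1
    exact moyal_smul_left a c ψ

theorem leftRep_apply (a : 𝓢(Plane, ℂ)) (ψ : Hilb) :
    leftRep θ a ψ = (memLp_moyal (θ := θ) a (Lp.memLp ψ)).toLp := rfl

theorem norm_leftRep_le (a : 𝓢(Plane, ℂ)) :
    ‖leftRep θ a‖ ≤ ∫ z, ‖symbol θ a z‖ := by
  rw [integral_norm_eq_lintegral_enorm (symbol θ a).integrable.aestronglyMeasurable]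
  refine (leftRep θ a).opNorm_le_bound ENNReal.toReal_nonneg fun ψ => ?_
  rw [leftRep_apply, Lp.norm_toLp, Lp.norm_def, ← ENNReal.toReal_mul]
  exact ENNReal.toReal_mono (ENNReal.mul_ne_top (lintegral_enorm_symbol_ne_top a)
    (Lp.memLp ψ).2.ne) (eLpNorm_moyal_le a (Lp.memLp ψ).1)

theorem leftRep_toLp_of_memLp (a : 𝓢(Plane, ℂ)) {ψ : Plane → ℂ} (hψ : MemLp ψ 2 volume) :
    leftRep θ a hψ.toLp = (memLp_moyal (θ := θ) a hψ).toLp := by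
  rw [leftRep_apply]
  congr 1
  exact moyal_congr_ae a hψ.coeFn_toLp

theorem leftRep_toLp (a g : 𝓢(Plane, ℂ)) :
    leftRep θ a (g.toLp 2) = (mul θ a g).toLp 2 :=
  leftRep_toLp_of_memLp a (g.memLp 2)

theorem dense_toLp : DenseRange fun g : 𝓢(Plane, ℂ) => (g.toLp 2 : Hilb) :=
  denseRange_toLpCLM (F := ℂ) (μ := (volume : Measure Plane)) ENNReal.ofNat_ne_top

theorem leftRep_ext {A B : Hilb →L[ℂ] Hilb}
    (h : ∀ g : 𝓢(Plane, ℂ), A (g.toLp 2) = B (g.toLp 2)) : A = B := by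
  have := dense_toLp.equalizer A.continuous B.continuous (funext h)
  ext1 ψ
  exact congrFun this ψ

theorem leftRep_mul (a b : 𝓢(Plane, ℂ)) :
    leftRep θ (mul θ a b) = leftRep θ a * leftRep θ b := by
  refine leftRep_ext fun g => ?_
  rw [mul_apply_eq_comp, leftRep_toLp, leftRep_toLp, leftRep_toLp, mul_assoc']

theorem inner_toLp (f g : 𝓢(Plane, ℂ)) :
    inner ℂ (f.toLp 2 : Hilb) (g.toLp 2) = ∫ x, (starRingEnd ℂ) (f x) * g x := by
  refine (inner_toL2_toL2_eq f g volume).trans (integral_congr_ae (Filter.Eventually.of_forall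
    fun x => ?_))
  simp [mul_comm]

/-- By the trace property and associativity, `∫ f̄ (a ⋆ g) = ∫ (f̄ ⋆ a) g`, and `f̄ ⋆ a` is the
conjugate of `ā ⋆ f`. -/
theorem inner_toLp_mul (a f g : 𝓢(Plane, ℂ)) :
    inner ℂ (f.toLp 2 : Hilb) ((mul θ a g).toLp 2) =
      inner ℂ ((mul θ (conjugate a) f).toLp 2 : Hilb) (g.toLp 2) := by
  rw [inner_toLp, inner_toLp]
  have h1 := integral_mul (θ := θ) (conjugate f) (mul θ a g)
  have h2 := integral_mul (θ := θ) (mul θ (conjugate f) a) g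
  rw [mul_assoc', h1] at h2
  simp only [conjugate_apply] at h2
  rw [h2]
  congr 1
  ext x
  rw [← conjugate_apply, conjugate_mul, conjugate_conjugate]

theorem leftRep_conjugate (a : 𝓢(Plane, ℂ)) :
    leftRep θ (conjugate a) = star (leftRep θ a) := by
  rw [ContinuousLinearMap.star_eq_adjoint]
  refine leftRep_ext fun g => ?_
  refine ext_inner_right ℂ fun v => ?_
  rw [ContinuousLinearMap.adjoint_inner_left]
  have h : Continuous fun v : Hilb => inner ℂ (leftRep θ (conjugate a) (g.toLp 2)) v := by fun_prop
  have h' : Continuous fun v : Hilb => inner ℂ (g.toLp 2 : Hilb) (leftRep θ a v) := by fun_prop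
  refine congrFun (dense_toLp.equalizer h h' (funext fun f => ?_)) v
  simp only [Function.comp]
  rw [leftRep_toLp, leftRep_toLp, inner_toLp_mul]

theorem norm_leftRep_conjugate (a : 𝓢(Plane, ℂ)) :
    ‖leftRep θ (conjugate a)‖ = ‖leftRep θ a‖ := by
  rw [leftRep_conjugate, ContinuousLinearMap.star_eq_adjoint]
  exact LinearIsometryEquiv.norm_map ContinuousLinearMap.adjoint _

/-- The supremum over functions and the operator norm on classes agree because `L(a)` depends only
on the class. This makes the operator theory available for `State.norm_one`. -/
theorem cstarNorm_eq (a : 𝓢(Plane, ℂ)) : cstarNorm θ a = ENNReal.ofReal ‖leftRep θ a‖ := by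
  have hfin : cstarNorm θ a ≤ ENNReal.ofReal ‖leftRep θ a‖ := by
    refine iSup₂_le fun ψ hψ => iSup_le fun h1 => ?_
    have h2 := (leftRep θ a).le_opNorm hψ.toLp
    rw [leftRep_toLp_of_memLp, Lp.norm_toLp, Lp.norm_toLp] at h2
    rw [← ENNReal.ofReal_toReal (memLp_moyal (θ := θ) a hψ).2.ne]
    refine ENNReal.ofReal_le_ofReal (h2.trans ?_)
    have : (eLpNorm ψ 2 volume).toReal ≤ 1 := by
      simpa using ENNReal.toReal_mono ENNReal.one_ne_top h1
    exact mul_le_of_le_one_right (norm_nonneg _) this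
  refine le_antisymm hfin ?_
  have hne : cstarNorm θ a ≠ ⊤ := ne_top_of_le_ne_top ENNReal.ofReal_ne_top hfin
  refine ENNReal.ofReal_le_of_le_toReal ?_
  refine ContinuousLinearMap.opNorm_le_of_unit_norm ENNReal.toReal_nonneg fun ψ hψ => ?_
  rw [leftRep_apply, Lp.norm_toLp]
  refine ENNReal.toReal_mono hne ?_
  have h1 : eLpNorm ψ 2 volume ≤ 1 := by
    rw [← ENNReal.ofReal_toReal (Lp.memLp ψ).2.ne, ← Lp.norm_def, hψ]; simp
  exact le_iSup_of_le (ψ : Plane → ℂ) (le_iSup_of_le (Lp.memLp ψ) (le_iSup_of_le h1 le_rfl))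

theorem cstarNorm_le_one_iff (a : 𝓢(Plane, ℂ)) : cstarNorm θ a ≤ 1 ↔ ‖leftRep θ a‖ ≤ 1 := by
  rw [cstarNorm_eq, ENNReal.ofReal_le_one]

/-! ### The approximate unit -/

/-- On symbols the product is a twisted convolution, so approximate units can be sought among
probability densities shrinking to the origin. -/
theorem symbol_mul (e a : 𝓢(Plane, ℂ)) (u : Plane) :
    symbol θ (mul θ e a) u = ∫ z, symbol θ e z * (symbol θ a (u - z) * wave θ z u) := by
  have h3 := (symbol θ e).continuous
  have h5 := a.continuous
  rw [symbol_apply]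
  simp_rw [mul_apply, ← integral_const_mul (wave θ u _)]
  rw [integral_integral_swap]
  · rw [← integral_const_mul]
    congr 1
    ext z
    have h1 : ∀ x, wave θ u x * (wave θ x z * symbol θ e z * a (x + z)) =
        symbol θ e z * wave θ z u * (fun y => wave θ (u - z) y * a y) (x + z) := by
      intro x
      have e1 : wave θ (u - z) (x + z) = wave θ u x * wave θ u z * wave θ x z := by
        have : u - z = u + -z := sub_eq_add_neg u z
        have e2 : wave θ (-z) (x + z) = wave θ x z := by
          rw [wave_swap (x + z) (-z), wave_neg_right, Complex.conj_conj, wave_add_left, wave_self,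
            mul_one]
        rw [this, wave_add_left, e2, wave_add_right]
      have e3 := wave_mul_conj θ u z
      rw [← wave_swap] at e3
      simp only [e1]
      linear_combination (-(wave θ u x * wave θ x z * symbol θ e z * a (x + z))) * e3
    simp_rw [h1]
    rw [integral_const_mul, integral_add_right_eq_self (fun y => wave θ (u - z) y * a y) z,
      symbol_apply a (u - z)]
    ring
  · have hp : Integrable (fun p : Plane × Plane => a (p.1 + p.2) * symbol θ e p.2)
        (volume.prod volume) :=
      (measurePreserving_add_prod volume volume (G := Plane)).integrable_comp_of_integrable
        ((a.integrable (μ := volume)).mul_prod ((symbol θ e).integrable (μ := volume)))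
    refine hp.mono ?_ (Filter.Eventually.of_forall fun p => ?_)
    · refine Continuous.aestronglyMeasurable ?_
      simp only [Function.uncurry_def]
      fun_prop
    · simp [Function.uncurry_def, norm_wave, mul_comm]

/-- The `L¹`-distance of `φ` from its magnetic translate by `z`. -/
def translateDist (θ : ℝ) (φ : 𝓢(Plane, ℂ)) (z : Plane) : ℝ :=
  ∫ u, ‖φ (u - z) * wave θ z u - φ u‖

/-- The exponent 3 exceeds the dimension of the plane, so the bound is integrable. -/
theorem one_add_norm_pow_mul_le (φ : 𝓢(Plane, ℂ)) :
    ∃ C, 0 ≤ C ∧ ∀ u, ‖φ u‖ ≤ C * (1 + ‖u‖) ^ (-(3 : ℝ)) := by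
  refine ⟨2 ^ 3 * ((Finset.Iic (3, 0)).sup fun m => SchwartzMap.seminorm ℝ m.1 m.2) φ,
    mul_nonneg (by norm_num) (apply_nonneg _ _), fun u => ?_⟩
  have h := one_add_le_sup_seminorm_apply (𝕜 := ℝ) (m := (3, 0)) le_rfl le_rfl φ u
  rw [norm_iteratedFDeriv_zero] at h
  have h1 : (0 : ℝ) < 1 + ‖u‖ := by positivity
  rw [Real.rpow_neg h1.le, ← div_eq_mul_inv, le_div_iff₀ (by positivity), mul_comm]
  exact_mod_cast h

-- Dominated convergence: for `‖z‖ ≤ 1` the decay of `φ` bounds all translates by one integrable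
-- function, and the magnetic phase tends to 1.
omit hθ in
theorem tendsto_translateDist (φ : 𝓢(Plane, ℂ)) :
    Filter.Tendsto (translateDist θ φ) (nhds 0) (nhds 0) := by
  obtain ⟨C, hC, hφ⟩ := one_add_norm_pow_mul_le φ
  have hc := φ.continuous
  have h0 : translateDist θ φ 0 = 0 := by
    have : ∀ u, wave θ 0 u = 1 := fun u => by simp [wave, phase]
    simp [translateDist, this]
  rw [← h0]
  have hint : Integrable fun u : Plane => (1 + ‖u‖) ^ (-(3 : ℝ)) :=
    integrable_one_add_norm (by rw [finrank_euclideanSpace_fin]; norm_num)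
  refine tendsto_integral_filter_of_dominated_convergence
    (fun u => C * (2 ^ 3 * (1 + ‖u‖) ^ (-(3 : ℝ))) + ‖φ u‖) ?_ ?_ ?_ ?_
  · exact Filter.Eventually.of_forall fun z => Continuous.aestronglyMeasurable (by fun_prop)
  · filter_upwards [Metric.closedBall_mem_nhds (0 : Plane) one_pos] with z hz
    refine Filter.Eventually.of_forall fun u => ?_
    rw [norm_norm]
    refine (norm_sub_le _ _).trans ?_
    gcongr
    rw [norm_mul, norm_wave, mul_one]
    refine (hφ _).trans ?_
    gcongr
    have hz1 : ‖z‖ ≤ 1 := by simpa using hz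
    have h1 : (1 + ‖u‖) ≤ 2 * (1 + ‖u - z‖) := by
      have : ‖u‖ ≤ ‖u - z‖ + ‖z‖ := by simpa using norm_add_le (u - z) z
      linarith [norm_nonneg (u - z)]
    have h2 : (0 : ℝ) < 1 + ‖u - z‖ := by positivity
    have h3 : (0 : ℝ) < 1 + ‖u‖ := by positivity
    rw [Real.rpow_neg h2.le, Real.rpow_neg h3.le, ← div_eq_mul_inv, inv_eq_one_div,
      div_le_div_iff₀ (by positivity) (by positivity), one_mul]
    norm_cast
    push_cast
    calc (1 + ‖u‖) ^ 3 ≤ (2 * (1 + ‖u - z‖)) ^ 3 := by gcongr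
      _ = _ := by ring
  · exact ((hint.const_mul _).const_mul _).add φ.integrable.norm
  · refine Filter.Eventually.of_forall fun u => ?_
    refine Continuous.tendsto (f := fun z => ‖φ (u - z) * wave θ z u - φ u‖) ?_ 0
    fun_prop

/-- As `φ` is a probability density, the symbol of `e ⋆ a - a` is the `φ`-average of the differences
between the symbol of `a` and its magnetic translates. Only translations by less than `r` enter, and
the `L¹`-norm of the symbol bounds the operator norm. -/
theorem norm_leftRep_approx_le {φ : 𝓢(Plane, ℂ)} {ρ : Plane → ℝ} (hρ : ∀ z, φ z = ρ z)
    (hρ0 : ∀ z, 0 ≤ ρ z) (h1 : ∫ z, ρ z = 1) {e : 𝓢(Plane, ℂ)} (he : symbol θ e = φ)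
    (a : 𝓢(Plane, ℂ)) {r ε : ℝ} (hsupp : ∀ z, ρ z ≠ 0 → ‖z‖ < r)
    (hr : ∀ z, ‖z‖ < r → translateDist θ (symbol θ a) z ≤ ε) :
    ‖leftRep θ (mul θ e a - a)‖ ≤ ε := by
  have hc := (symbol θ a).continuous
  have hcφ := φ.continuous
  have hρn : ∀ z, ‖φ z‖ = ρ z := fun z => by rw [hρ, Complex.norm_real, Real.norm_of_nonneg (hρ0 z)]
  have hρi : Integrable ρ volume := by
    have := (φ.integrable (μ := volume)).norm; simpa only [hρn] using this
  have hφ1 : ∫ z, φ z = 1 := by simp_rw [hρ]; rw [integral_complex_ofReal, h1]; simp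
  have ha := (symbol θ a).integrable (μ := volume)
  have hjoint : Integrable (fun p : Plane × Plane =>
      φ p.2 * (symbol θ a (p.1 - p.2) * wave θ p.2 p.1 - symbol θ a p.1))
      (volume.prod volume) := by
    have hp : Integrable (fun p : Plane × Plane => symbol θ a (p.1 - p.2) * φ p.2)
        (volume.prod volume) :=
      (measurePreserving_sub_prod volume volume (G := Plane)).integrable_comp_of_integrable
        (ha.mul_prod (φ.integrable (μ := volume)))
    have hp2 : Integrable (fun p : Plane × Plane => symbol θ a p.1 * φ p.2)
        (volume.prod volume) := ha.mul_prod (φ.integrable (μ := volume))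
    refine (hp.norm.add hp2.norm).mono' (Continuous.aestronglyMeasurable (by fun_prop))
      (Filter.Eventually.of_forall fun p => ?_)
    rw [norm_mul]
    simp only [Pi.add_apply, norm_mul]
    calc _ ≤ ‖φ p.2‖ * (‖symbol θ a (p.1 - p.2) * wave θ p.2 p.1‖ + ‖symbol θ a p.1‖) := by
          gcongr; exact norm_sub_le _ _
      _ = _ := by rw [norm_mul, norm_wave]; ring
  refine (norm_leftRep_le _).trans ?_
  have hdiff : ∀ u, symbol θ (mul θ e a - a) u =
      ∫ z, φ z * (symbol θ a (u - z) * wave θ z u - symbol θ a u) := by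
    intro u
    obtain ⟨C, hC, hCa⟩ := norm_le_const (symbol θ a)
    have i1 : Integrable (fun z => φ z * (symbol θ a (u - z) * wave θ z u)) volume := by
      refine ((φ.integrable (μ := volume)).norm.mul_const C).mono'
        (Continuous.aestronglyMeasurable (by fun_prop)) (Filter.Eventually.of_forall fun z => ?_)
      rw [norm_mul, norm_mul, norm_wave, mul_one]
      gcongr
      exact hCa _
    have i2 : Integrable (fun z => φ z * symbol θ a u) volume := φ.integrable.mul_const _
    simp_rw [mul_sub]
    rw [integral_sub i1 i2, integral_mul_const, hφ1, one_mul, map_sub, sub_apply, symbol_mul, he]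
  simp_rw [hdiff]
  have hswap : ∫ u, ∫ z, ‖φ z * (symbol θ a (u - z) * wave θ z u - symbol θ a u)‖ =
      ∫ z, ρ z * translateDist θ (symbol θ a) z := by
    rw [integral_integral_swap hjoint.norm]
    congr 1
    ext z
    rw [translateDist, ← integral_const_mul]
    simp_rw [norm_mul (φ z), hρn]
  calc _ ≤ ∫ u, ∫ z, ‖φ z * (symbol θ a (u - z) * wave θ z u - symbol θ a u)‖ :=
        integral_mono hjoint.integral_prod_left.norm hjoint.norm.integral_prod_left
          fun u => norm_integral_le_integral_norm _
    _ = ∫ z, ρ z * translateDist θ (symbol θ a) z := hswap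
    _ ≤ ∫ z, ρ z * ε := by
        refine integral_mono_of_nonneg (Filter.Eventually.of_forall fun z => ?_)
          (hρi.mul_const _) (Filter.Eventually.of_forall fun z => ?_)
        · exact mul_nonneg (hρ0 z) (integral_nonneg fun _ => norm_nonneg _)
        · by_cases hz : ρ z = 0
          · simp [hz]
          · exact mul_le_mul_of_nonneg_left (hr z (hsupp z hz)) (hρ0 z)
    _ = ε := by rw [integral_mul_const, h1, one_mul]

/-- The Moyal algebra has a bounded left approximate unit. -/
theorem exists_approxUnit : ∃ e : ℕ → 𝓢(Plane, ℂ), (∀ n, ‖leftRep θ (e n)‖ ≤ 1) ∧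
    ∀ a, Filter.Tendsto (fun n => ‖leftRep θ (mul θ (e n) a - a)‖) Filter.atTop (nhds 0) := by
  let f : ℕ → ContDiffBump (0 : Plane) := fun n =>
    ⟨1 / (2 * ((n : ℝ) + 1)), 1 / ((n : ℝ) + 1), by positivity, by
      have : (0 : ℝ) < n + 1 := by positivity
      rw [div_lt_div_iff₀ (by positivity) this]; linarith⟩
  let ρ : ℕ → Plane → ℝ := fun n => (f n).normed volume
  have hcs : ∀ n, HasCompactSupport (fun z => (ρ n z : ℂ)) := fun n =>
    (f n).hasCompactSupport_normed.comp_left (g := fun t : ℝ => (t : ℂ)) (by simp)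
  have hcd : ∀ n, ContDiff ℝ ((⊤ : ℕ∞) : WithTop ℕ∞) (fun z => (ρ n z : ℂ)) := fun n =>
    Complex.ofRealCLM.contDiff.comp (f n).contDiff_normed
  let φ : ℕ → 𝓢(Plane, ℂ) := fun n => (hcs n).toSchwartzMap (hcd n)
  have hφ : ∀ n z, φ n z = ρ n z := fun n z => rfl
  -- Every Schwartz function is a symbol, so the normalized bumps are symbols of elements of the
  -- algebra.
  choose e he using fun n => symbol_surjective (θ := θ) (φ n)
  have hρ0 : ∀ n z, 0 ≤ ρ n z := fun n z => (f n).nonneg_normed z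
  have hρ1 : ∀ n, ∫ z, ρ n z = 1 := fun n => (f n).integral_normed
  refine ⟨e, fun n => ?_, fun a => ?_⟩
  · refine (norm_leftRep_le _).trans ?_
    rw [he]
    simp_rw [hφ, Complex.norm_real, Real.norm_of_nonneg (hρ0 n _)]
    rw [hρ1]
  · rw [Metric.tendsto_atTop]
    intro ε hε
    have h := tendsto_translateDist (θ := θ) (symbol θ a)
    rw [Metric.tendsto_nhds_nhds] at h
    obtain ⟨δ, hδ, h⟩ := h (ε / 2) (by positivity)
    obtain ⟨N, hN⟩ := exists_nat_one_div_lt hδ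
    refine ⟨N, fun n hn => ?_⟩
    have hle : ‖leftRep θ (mul θ (e n) a - a)‖ ≤ ε / 2 := by
      refine norm_leftRep_approx_le (hφ n) (hρ0 n) (hρ1 n) (he n) a (r := δ) ?_ ?_
      · intro z hz
        have : z ∈ Function.support ((f n).normed volume) := hz
        rw [(f n).support_normed_eq, mem_ball_zero_iff] at this
        refine this.trans (lt_of_le_of_lt ?_ hN)
        have : (N : ℝ) ≤ n := by exact_mod_cast hn
        exact one_div_le_one_div_of_le (by positivity) (by linarith)
      · intro z hz
        have := h (x := z) (by simpa using hz)
        rw [Real.dist_eq, sub_zero] at this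
        exact (le_abs_self _).trans this.le
    rw [Real.dist_eq, sub_zero, abs_norm]
    linarith

/-! ### States: Cauchy–Schwarz and convex combinations -/

theorem mul_add' (a b c : 𝓢(Plane, ℂ)) : mul θ a (b + c) = mul θ a b + mul θ a c := by
  have h := moyal_add_right (θ := θ) a (b.memLp 2 volume) (c.memLp 2 volume)
  ext x
  exact congrFun h x

theorem add_mul' (a b c : 𝓢(Plane, ℂ)) : mul θ (a + b) c = mul θ a c + mul θ b c := by
  have h := moyal_add_left (θ := θ) a b (c.memLp 2 volume)
  ext x
  exact congrFun h x

theorem mul_smul' (c : ℂ) (a b : 𝓢(Plane, ℂ)) : mul θ a (c • b) = c • mul θ a b := by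
  have h := moyal_smul_right (θ := θ) a c (b : Plane → ℂ)
  ext x
  exact congrFun h x

theorem smul_mul' (c : ℂ) (a b : 𝓢(Plane, ℂ)) : mul θ (c • a) b = c • mul θ a b := by
  have h := moyal_smul_left (θ := θ) a c (b : Plane → ℂ)
  ext x
  exact congrFun h x

@[simp] theorem conjugate_add (a b : 𝓢(Plane, ℂ)) :
    conjugate (a + b) = conjugate a + conjugate b := by ext x; simp

@[simp] theorem conjugate_smul (c : ℂ) (a : 𝓢(Plane, ℂ)) :
    conjugate (c • a) = (starRingEnd ℂ) c • conjugate a := by ext x; simp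

namespace State

theorem norm_le (ω : State θ) (a : 𝓢(Plane, ℂ)) : ‖ω.toLin a‖ ≤ ‖leftRep θ a‖ := by
  have key : ∀ b, ‖leftRep θ b‖ ≤ 1 → ‖ω.toLin b‖ ≤ 1 := fun b hb =>
    ω.norm_one.1 ⟨b, (cstarNorm_le_one_iff b).2 hb, rfl⟩
  refine le_of_forall_pos_le_add fun ε hε => ?_
  -- The added `ε` keeps the scaling factor finite when the norm of `a` vanishes.
  set t := ‖leftRep θ a‖ + ε with ht
  have htpos : 0 < t := by positivity
  have h := key (((t⁻¹ : ℝ) : ℂ) • a) (by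
    rw [map_smul, norm_smul, Complex.norm_real, Real.norm_of_nonneg (by positivity),
      inv_mul_le_one₀ htpos]
    linarith)
  rwa [map_smul, norm_smul, Complex.norm_real, Real.norm_of_nonneg (by positivity),
    inv_mul_le_one₀ htpos] at h

open scoped ComplexOrder in
theorem im_self (ω : State θ) (a : 𝓢(Plane, ℂ)) : (ω.toLin (mul θ (conjugate a) a)).im = 0 :=
  (Complex.nonneg_iff.1 (ω.positive a)).2.symm

/-- Polarization: the values on the squares of `a + b` and `a + i b` are real, which gives the
imaginary and the real part of the identity. -/
theorem conj_symm (ω : State θ) (a b : 𝓢(Plane, ℂ)) :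
    (starRingEnd ℂ) (ω.toLin (mul θ (conjugate b) a)) = ω.toLin (mul θ (conjugate a) b) := by
  have h1 := ω.im_self (a + b)
  have h2 := ω.im_self (a + I • b)
  have ha := ω.im_self a
  have hb := ω.im_self b
  simp only [conjugate_add, conjugate_smul, mul_add', add_mul', mul_smul', smul_mul', map_add,
    map_smul, Complex.add_im, smul_eq_mul, Complex.mul_im, Complex.conj_I, Complex.neg_re,
    Complex.neg_im, Complex.I_re, Complex.I_im, Complex.mul_re, Complex.add_re] at h1 h2
  apply Complex.ext
  · rw [Complex.conj_re]
    linarith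
  · rw [Complex.conj_im]
    linarith

/-- The positive semidefinite form `(a, b) ↦ ω(ā ⋆ b)`. -/
@[reducible]
def core (ω : State θ) : PreInnerProductSpace.Core ℂ 𝓢(Plane, ℂ) where
  inner a b := ω.toLin (mul θ (conjugate a) b)
  conj_inner_symm a b := ω.conj_symm a b
  re_inner_nonneg a := by
    open scoped ComplexOrder in
    exact (Complex.nonneg_iff.1 (ω.positive a)).1
  add_left a b c := by rw [conjugate_add, add_mul', map_add]
  smul_left a b c := by rw [conjugate_smul, smul_mul', map_smul, smul_eq_mul]

theorem norm_mul_sq_le (ω : State θ) (a b : 𝓢(Plane, ℂ)) :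
    ‖ω.toLin (mul θ (conjugate a) b)‖ ^ 2 ≤
      (ω.toLin (mul θ (conjugate a) a)).re * (ω.toLin (mul θ (conjugate b) b)).re := by
  have h := @InnerProductSpace.Core.inner_mul_inner_self_le ℂ 𝓢(Plane, ℂ) _ _ _ ω.core a b
  have e : ‖ω.toLin (mul θ (conjugate b) a)‖ = ‖ω.toLin (mul θ (conjugate a) b)‖ := by
    rw [← ω.conj_symm, Complex.norm_conj]
  change ‖ω.toLin (mul θ (conjugate a) b)‖ * ‖ω.toLin (mul θ (conjugate b) a)‖ ≤ _ at h
  rw [e, ← sq] at h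
  exact h

theorem re_star_mul_le (ω : State θ) (b : 𝓢(Plane, ℂ)) :
    (ω.toLin (mul θ (conjugate b) b)).re ≤ ‖leftRep θ b‖ ^ 2 := by
  refine (Complex.re_le_norm _).trans ((ω.norm_le _).trans ?_)
  rw [leftRep_mul, sq]
  exact (norm_mul_le _ _).trans_eq (by rw [norm_leftRep_conjugate])

/-- The values of a state on the squares of an approximate unit tend to `1`. -/
theorem eventually_approxUnit (ω : State θ) {e : ℕ → 𝓢(Plane, ℂ)}
    (he : ∀ a, Filter.Tendsto (fun n => ‖leftRep θ (mul θ (e n) a - a)‖) Filter.atTop (nhds 0))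
    {ε : ℝ} (hε : 0 < ε) :
    ∀ᶠ n in Filter.atTop, 1 - ε ≤ (ω.toLin (mul θ (e n) (conjugate (e n)))).re := by
  -- Take `a` in the unit ball nearly norming `ω`; then `ω(e_n ⋆ a)` is close to `ω(a)`, and
  -- Cauchy–Schwarz bounds its square by `ω(e_n ⋆ ē_n) ω(ā ⋆ a)`.
  obtain ⟨r, ⟨a, ha, rfl⟩, hr⟩ := (lt_isLUB_iff ω.norm_one).1 (by linarith : 1 - ε / 4 < 1)
  rw [cstarNorm_le_one_iff] at ha
  have h2 : ∀ᶠ n in Filter.atTop, ‖leftRep θ (mul θ (e n) a - a)‖ < ε / 4 :=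
    (he a).eventually_lt_const (by positivity)
  filter_upwards [h2] with n hn
  have h3 := ω.norm_mul_sq_le (conjugate (e n)) a
  rw [conjugate_conjugate] at h3
  set s := (ω.toLin (mul θ (e n) (conjugate (e n)))).re
  have h4 : 1 - ε / 2 ≤ ‖ω.toLin (mul θ (e n) a)‖ := by
    have h5 := (ω.norm_le _).trans hn.le
    rw [map_sub] at h5
    have := norm_sub_norm_le (ω.toLin a) (ω.toLin (mul θ (e n) a))
    rw [norm_sub_rev] at this
    linarith
  have h6 : (ω.toLin (mul θ (conjugate a) a)).re ≤ 1 :=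
    (ω.re_star_mul_le a).trans (pow_le_one₀ (norm_nonneg _) ha)
  have h7 : 0 ≤ s := by
    have := Complex.nonneg_iff.1 (ω.positive (conjugate (e n)))
    rw [conjugate_conjugate] at this
    exact this.1
  have h8 : 0 ≤ (ω.toLin (mul θ (conjugate a) a)).re :=
    (Complex.nonneg_iff.1 (ω.positive a)).1
  have h9 : ‖ω.toLin (mul θ (e n) a)‖ ^ 2 ≤ s := h3.trans (mul_le_of_le_one_right h7 h6)
  -- With `x ≥ 1 - ε/2` one has `x² ≥ 2x - 1 ≥ 1 - ε`.
  nlinarith [sq_nonneg (‖ω.toLin (mul θ (e n) a)‖ - 1)]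

open scoped ComplexOrder in
/-- The convex combination `(1 - t) ω₁ + t ω₂`. -/
def mix (ω₁ ω₂ : State θ) (t : ℝ) (ht : t ∈ Set.Icc (0 : ℝ) 1) : State θ where
  toLin := ((1 - t : ℝ) : ℂ) • ω₁.toLin + (t : ℂ) • ω₂.toLin
  positive a := by
    have h1 : (0 : ℂ) ≤ ((1 - t : ℝ) : ℂ) := by
      rw [Complex.zero_le_real]; linarith [ht.2]
    have h2 : (0 : ℂ) ≤ (t : ℂ) := by rw [Complex.zero_le_real]; exact ht.1
    simp only [LinearMap.add_apply, LinearMap.smul_apply, smul_eq_mul]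
    exact add_nonneg (mul_nonneg h1 (ω₁.positive a)) (mul_nonneg h2 (ω₂.positive a))
  norm_one := by
    have ht1 : 0 ≤ 1 - t := by linarith [ht.2]
    refine ⟨?_, fun u hu => ?_⟩
    · rintro _ ⟨a, ha, rfl⟩
      have h1 : ‖ω₁.toLin a‖ ≤ 1 := ω₁.norm_one.1 ⟨a, ha, rfl⟩
      have h2 : ‖ω₂.toLin a‖ ≤ 1 := ω₂.norm_one.1 ⟨a, ha, rfl⟩
      simp only [LinearMap.add_apply, LinearMap.smul_apply, smul_eq_mul]
      refine (norm_add_le _ _).trans ?_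
      rw [norm_mul, norm_mul, Complex.norm_real, Complex.norm_real, Real.norm_of_nonneg ht1,
        Real.norm_of_nonneg ht.1]
      nlinarith [ht.1]
    · refine le_of_forall_pos_le_add fun ε hε => ?_
      -- Elements norming the two states separately would not help: a single element must be nearly
      -- norming for both. The element `e_n ⋆ ē_n` is, for large `n`.
      obtain ⟨e, he1, he⟩ := exists_approxUnit (θ := θ)
      obtain ⟨n, h1, h2⟩ := ((ω₁.eventually_approxUnit he hε).and
        (ω₂.eventually_approxUnit he hε)).exists
      have h3 : ‖leftRep θ (mul θ (e n) (conjugate (e n)))‖ ≤ 1 := by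
        rw [leftRep_mul]
        refine (norm_mul_le _ _).trans ?_
        rw [norm_leftRep_conjugate]
        exact mul_le_one₀ (he1 n) (norm_nonneg _) (he1 n)
      have h4 := hu ⟨_, (cstarNorm_le_one_iff _).2 h3, rfl⟩
      simp only [LinearMap.add_apply, LinearMap.smul_apply, smul_eq_mul] at h4
      have h5 := (Complex.re_le_norm _).trans h4
      rw [Complex.add_re, Complex.re_ofReal_mul, Complex.re_ofReal_mul] at h5
      nlinarith [ht.1]

end State

/-! ### Connected components of an extended metric space of states -/

section Components
variable {Ω : ℝ} {k : Fin 3}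

theorem edist_eq (ω₁ ω₂ : StateSpace θ Ω k) : edist ω₁ ω₂ =
    ⨆ (a : 𝓢(Plane, ℂ)) (_ : lipNorm θ Ω k a ≤ 1),
      ENNReal.ofReal ‖State.toLin ω₁ a - State.toLin ω₂ a‖ := rfl

/-- The convex combination of two states as a point of the metric space of states. -/
def segment (ω₁ ω₂ : StateSpace θ Ω k) (t : unitInterval) : StateSpace θ Ω k :=
  State.mix ω₁ ω₂ t t.2

theorem segment_eval (ω₁ ω₂ : StateSpace θ Ω k) (t : unitInterval) (a : 𝓢(Plane, ℂ)) :
    (segment ω₁ ω₂ t).eval a = (1 - (t : ℝ) : ℂ) * ω₁.eval a + ((t : ℝ) : ℂ) * ω₂.eval a := by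
  change (((1 - (t : ℝ) : ℝ) : ℂ) • State.toLin ω₁ + ((t : ℝ) : ℂ) • State.toLin ω₂) a = _
  rw [LinearMap.add_apply, LinearMap.smul_apply, LinearMap.smul_apply]
  push_cast
  rfl

/-- Two points of a segment differ as functionals by `(s - t)(ω₁ - ω₂)`, and the distance scales
accordingly. -/
theorem edist_segment_le (ω₁ ω₂ : StateSpace θ Ω k) (t s : unitInterval) :
    edist (segment ω₁ ω₂ t) (segment ω₁ ω₂ s) ≤
      ENNReal.ofReal |(t : ℝ) - s| * edist ω₁ ω₂ := by
  rw [edist_eq]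
  refine iSup₂_le fun a ha => ?_
  have h : State.toLin (segment ω₁ ω₂ t) a - State.toLin (segment ω₁ ω₂ s) a =
      ((s - t : ℝ) : ℂ) * (State.toLin ω₁ a - State.toLin ω₂ a) := by
    have h1 := segment_eval ω₁ ω₂ t a
    have h2 := segment_eval ω₁ ω₂ s a
    simp only [StateSpace.eval] at h1 h2
    rw [h1, h2]
    push_cast
    ring
  rw [h, norm_mul, Complex.norm_real, Real.norm_eq_abs, abs_sub_comm,
    ENNReal.ofReal_mul (abs_nonneg _)]
  gcongr
  rw [edist_eq]
  exact le_iSup₂ (f := fun a _ => ENNReal.ofReal ‖State.toLin ω₁ a - State.toLin ω₂ a‖) a ha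

theorem StateSpace.ext {ω₁ ω₂ : StateSpace θ Ω k} (h : ∀ a, ω₁.eval a = ω₂.eval a) :
    ω₁ = ω₂ := by
  have h' : State.toLin ω₁ = State.toLin ω₂ := LinearMap.ext h
  change State θ at ω₁ ω₂
  cases ω₁; cases ω₂
  congr

/-- The path of convex combinations between two states at finite distance. -/
def segmentPath (ω₁ ω₂ : StateSpace θ Ω k) (h : edist ω₁ ω₂ ≠ ⊤) : Path ω₁ ω₂ where
  toFun := segment ω₁ ω₂
  continuous_toFun := by
    have hl : LipschitzWith (edist ω₁ ω₂).toNNReal (segment ω₁ ω₂) := fun t s => by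
      rw [ENNReal.coe_toNNReal h, edist_dist, Subtype.dist_eq, Real.dist_eq, mul_comm]
      exact edist_segment_le ω₁ ω₂ t s
    exact hl.continuous
  source' := StateSpace.ext fun a => by rw [segment_eval]; simp
  target' := StateSpace.ext fun a => by rw [segment_eval]; simp

theorem finiteClass_eq_eball (ω : StateSpace θ Ω k) : finiteClass ω = Metric.eball ω ⊤ := rfl

theorem isClopen_finiteClass (ω : StateSpace θ Ω k) : IsClopen (finiteClass ω) := by
  rw [finiteClass_eq_eball]
  exact ⟨Metric.isClosed_eball_top, Metric.isOpen_eball⟩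

theorem self_mem_finiteClass (ω : StateSpace θ Ω k) : ω ∈ finiteClass ω := by
  change edist ω ω < ⊤
  simp

theorem edist_ne_top_of_mem {ω ω₁ ω₂ : StateSpace θ Ω k} (h₁ : ω₁ ∈ finiteClass ω)
    (h₂ : ω₂ ∈ finiteClass ω) : edist ω₁ ω₂ ≠ ⊤ := by
  refine ((edist_triangle_right ω₁ ω₂ ω).trans_lt ?_).ne
  exact ENNReal.add_lt_top.2 ⟨h₁, h₂⟩

theorem segmentConnected_finiteClass (ω : StateSpace θ Ω k) :
    SegmentConnected (finiteClass ω) := by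
  intro ω₁ h₁ ω₂ h₂
  have h := edist_ne_top_of_mem h₁ h₂
  refine ⟨segmentPath ω₁ ω₂ h, fun t => ?_, segment_eval ω₁ ω₂⟩
  change edist (segment ω₁ ω₂ t) ω < ⊤
  have h0 : segment ω₁ ω₂ 0 = ω₁ := (segmentPath ω₁ ω₂ h).source
  have h3 := edist_segment_le ω₁ ω₂ t 0
  rw [h0] at h3
  exact (edist_triangle _ ω₁ ω).trans_lt (ENNReal.add_lt_top.2
    ⟨h3.trans_lt (ENNReal.mul_lt_top ENNReal.ofReal_lt_top h.lt_top), h₁⟩)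

theorem isPathConnected_finiteClass (ω : StateSpace θ Ω k) : IsPathConnected (finiteClass ω) := by
  refine ⟨ω, self_mem_finiteClass ω, fun {η} hη => ?_⟩
  obtain ⟨γ, hγ, -⟩ := segmentConnected_finiteClass ω ω (self_mem_finiteClass ω) η hη
  exact ⟨γ, hγ⟩

/-- A clopen set containing `ω` contains its component; conversely the class is connected through
segments. -/
theorem connectedComponent_eq_finiteClass (ω : StateSpace θ Ω k) :
    connectedComponent ω = finiteClass ω :=
  Set.Subset.antisymm
    ((isClopen_finiteClass ω).connectedComponent_subset (self_mem_finiteClass ω))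
    ((isPathConnected_finiteClass ω).isConnected.isPreconnected.subset_connectedComponent
      (self_mem_finiteClass ω))

end Components

/-! ### Differentiation of the product and the Leibniz rule -/

/-- The Fourier transform turns a derivative into multiplication by a linear form; the factor `π` is
absorbed by `dualEquiv`. -/
theorem symbol_lineDeriv (a : 𝓢(Plane, ℂ)) (v z : Plane) :
    symbol θ (∂_{v} a) z = 2 * I * (phase θ v z : ℂ) * symbol θ a z := by
  have hg : Function.HasTemperateGrowth (fun x : Plane => inner ℝ x v) := by
    have : (fun x : Plane => inner ℝ x v) = ⇑(innerSL ℝ v) := by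
      ext x; rw [innerSL_apply_apply, real_inner_comm]
    rw [this]; exact ContinuousLinearMap.hasTemperateGrowth _
  change cnst θ • (compCLMOfContinuousLinearEquiv ℂ (dualEquiv θ hθ.out) (𝓕 (∂_{v} a)) :
    𝓢(Plane, ℂ)) z = _ * (cnst θ • (compCLMOfContinuousLinearEquiv ℂ (dualEquiv θ hθ.out) (𝓕 a) :
    𝓢(Plane, ℂ)) z)
  rw [compCLMOfContinuousLinearEquiv_apply, compCLMOfContinuousLinearEquiv_apply,
    Function.comp, Function.comp, fourier_lineDerivOp_eq, smul_apply,
    smulLeftCLM_apply_apply hg, ← inner_dualEquiv hθ.out, real_inner_comm]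
  simp only [smul_eq_mul, Complex.real_smul]
  push_cast
  ring

/-- The form `phase` as a functional of its first variable. -/
def phaseForm (θ : ℝ) (w : Plane) : Plane →L[ℝ] ℝ :=
  θ⁻¹ • (w 0 • EuclideanSpace.proj 1 - w 1 • EuclideanSpace.proj 0)

theorem phaseForm_apply (w y : Plane) : phaseForm θ w y = phase θ y w := by
  rw [phase_eq hθ.out]
  simp [phaseForm]
  field_simp

theorem norm_phaseForm_le (w : Plane) : ‖phaseForm θ w‖ ≤ 2 * θ⁻¹ * ‖w‖ := by
  refine ContinuousLinearMap.opNorm_le_bound _ ?_ fun y => ?_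
  · have := hθ.out.le; positivity
  have h : ∀ (u : Plane) i, |u i| ≤ ‖u‖ := fun u i => PiLp.norm_apply_le u i
  have e : phaseForm θ w y = θ⁻¹ * (w 0 * y 1 - w 1 * y 0) := rfl
  rw [e]
  rw [norm_mul, Real.norm_of_nonneg (inv_nonneg.2 hθ.out.le)]
  have h1 : ‖w 0 * y 1 - w 1 * y 0‖ ≤ ‖w‖ * ‖y‖ + ‖w‖ * ‖y‖ := by
    refine (norm_sub_le _ _).trans ?_
    rw [norm_mul, norm_mul]
    gcongr <;> exact h _ _
  calc _ ≤ θ⁻¹ * (‖w‖ * ‖y‖ + ‖w‖ * ‖y‖) := by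
        gcongr; exact inv_nonneg.2 hθ.out.le
    _ = _ := by ring

/-- The differential of `x ↦ wave θ x w * φ (w - x)`. -/
def kernelD (θ : ℝ) (φ : 𝓢(Plane, ℂ)) (x w : Plane) : Plane →L[ℝ] ℂ :=
  wave θ x w • ((2 * I * φ (w - x)) • (Complex.ofRealCLM ∘L phaseForm θ w) - fderiv ℝ φ (w - x))

theorem hasFDerivAt_wave_left (x w : Plane) :
    HasFDerivAt (fun y => wave θ y w)
      (wave θ x w • ((2 * I) • (Complex.ofRealCLM ∘L phaseForm θ w))) x := by
  have h : (fun y => wave θ y w) =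
      fun y => Complex.exp (((2 * I) • (Complex.ofRealCLM ∘L phaseForm θ w)) y) := by
    ext y
    simp [wave, phaseForm_apply]
  rw [h]
  have h2 := (((2 * I) • (Complex.ofRealCLM ∘L phaseForm θ w) : Plane →L[ℝ] ℂ).hasFDerivAt
    (x := x)).cexp
  refine h2.congr_fderiv ?_
  congr 1
  simp [wave, phaseForm_apply]

theorem hasFDerivAt_kernel (φ : 𝓢(Plane, ℂ)) (x w : Plane) :
    HasFDerivAt (fun y => wave θ y w * φ (w - y)) (kernelD θ φ x w) x := by
  have h1 : HasFDerivAt (fun y : Plane => w - y) (-ContinuousLinearMap.id ℝ Plane) x :=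
    (hasFDerivAt_id x).const_sub w
  have h2 := (φ.hasFDerivAt (w - x)).comp x h1
  refine ((hasFDerivAt_wave_left x w).mul h2).congr_fderiv ?_
  ext v
  simp [kernelD]
  ring

omit hθ in
theorem continuous_kernelD (φ : 𝓢(Plane, ℂ)) (x : Plane) : Continuous (kernelD θ φ x) := by
  have h1 : Continuous (fderiv ℝ φ) := (fderivCLM ℝ Plane ℂ φ).continuous
  have h2 := φ.continuous
  have h3 : Continuous (phaseForm θ) := by unfold phaseForm; fun_prop
  unfold kernelD
  fun_prop

/-- One power of `1 + ‖w‖` is lost to the linear growth of the phase form, hence decay of order 4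
for `φ` and its differential leaves order 3. Uniformity for `x` in a ball is what differentiation
under the integral requires. -/
theorem norm_kernelD_le (φ : 𝓢(Plane, ℂ)) (x₀ : Plane) :
    ∃ C, 0 ≤ C ∧ ∀ x ∈ Metric.ball x₀ 1, ∀ w, ‖kernelD θ φ x w‖ ≤ C * (1 + ‖w‖) ^ (-(3 : ℝ)) := by
  set C0 := 2 ^ 4 * ((Finset.Iic (4, 1)).sup fun m => SchwartzMap.seminorm ℝ m.1 m.2) φ
  have hC0 : 0 ≤ C0 := mul_nonneg (by norm_num) (apply_nonneg _ _)
  have d0 : ∀ u, (1 + ‖u‖) ^ 4 * ‖φ u‖ ≤ C0 := fun u => by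
    simpa using one_add_le_sup_seminorm_apply (𝕜 := ℝ) (m := (4, 1)) (k := 4) (n := 0)
      le_rfl (by simp) φ u
  have d1 : ∀ u, (1 + ‖u‖) ^ 4 * ‖fderiv ℝ φ u‖ ≤ C0 := fun u => by
    have := one_add_le_sup_seminorm_apply (𝕜 := ℝ) (m := (4, 1)) (k := 4) (n := 1)
      le_rfl le_rfl φ u
    rwa [norm_iteratedFDeriv_one] at this
  have hθ0 := hθ.out.le
  -- For `‖x - x₀‖ < 1` this gives `1 + ‖w‖ ≤ R (1 + ‖w - x‖)`, which transfers decay in `w - x` to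
  -- decay in `w`.
  set R := 2 + ‖x₀‖ with hR
  refine ⟨R ^ 4 * ((4 * θ⁻¹ + 1) * C0), by positivity, fun x hx w => ?_⟩
  have h1 : (1 + ‖w‖) ≤ R * (1 + ‖w - x‖) := by
    have e1 : ‖w‖ ≤ ‖w - x‖ + ‖x‖ := by simpa using norm_add_le (w - x) x
    have e2 : ‖x‖ ≤ ‖x - x₀‖ + ‖x₀‖ := by simpa using norm_add_le (x - x₀) x₀
    have e3 : ‖x - x₀‖ < 1 := by simpa [dist_eq_norm] using hx
    have : 0 ≤ ‖x₀‖ * ‖w - x‖ := by positivity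
    rw [hR]
    nlinarith [norm_nonneg (w - x)]
  have hpos : (0 : ℝ) < 1 + ‖w‖ := by positivity
  have h2 : ‖kernelD θ φ x w‖ ≤ (1 + ‖w‖) * ((4 * θ⁻¹) * ‖φ (w - x)‖ + ‖fderiv ℝ φ (w - x)‖) := by
    rw [kernelD, norm_smul, norm_wave, one_mul]
    refine (norm_sub_le _ _).trans ?_
    rw [norm_smul, norm_mul]
    have e1 : ‖Complex.ofRealCLM ∘L phaseForm θ w‖ ≤ 2 * θ⁻¹ * ‖w‖ :=
      (ContinuousLinearMap.opNorm_comp_le _ _).trans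
        (by simpa using norm_phaseForm_le (θ := θ) w)
    have e2 : ‖(2 * I : ℂ)‖ = 2 := by simp
    rw [e2]
    calc _ ≤ 2 * ‖φ (w - x)‖ * (2 * θ⁻¹ * ‖w‖) + ‖fderiv ℝ φ (w - x)‖ := by gcongr
      _ ≤ 2 * ‖φ (w - x)‖ * (2 * θ⁻¹ * (1 + ‖w‖)) + (1 + ‖w‖) * ‖fderiv ℝ φ (w - x)‖ := by
        gcongr
        · linarith
        · exact le_mul_of_one_le_left (norm_nonneg _) (by linarith [norm_nonneg w])
      _ = _ := by ring
  rw [Real.rpow_neg hpos.le, ← div_eq_mul_inv, le_div_iff₀ (by positivity)]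
  norm_cast
  calc ‖kernelD θ φ x w‖ * (1 + ‖w‖) ^ 3
      ≤ (1 + ‖w‖) * ((4 * θ⁻¹) * ‖φ (w - x)‖ + ‖fderiv ℝ φ (w - x)‖) * (1 + ‖w‖) ^ 3 := by gcongr
    _ = (1 + ‖w‖) ^ 4 * ((4 * θ⁻¹) * ‖φ (w - x)‖ + ‖fderiv ℝ φ (w - x)‖) := by ring
    _ ≤ (R * (1 + ‖w - x‖)) ^ 4 * ((4 * θ⁻¹) * ‖φ (w - x)‖ + ‖fderiv ℝ φ (w - x)‖) := by gcongr
    _ = R ^ 4 * ((4 * θ⁻¹) * ((1 + ‖w - x‖) ^ 4 * ‖φ (w - x)‖) +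
          (1 + ‖w - x‖) ^ 4 * ‖fderiv ℝ φ (w - x)‖) := by ring
    _ ≤ R ^ 4 * ((4 * θ⁻¹) * C0 + C0) := by gcongr; exacts [d0 _, d1 _]
    _ = _ := by ring

section Leibniz
variable {F : Type*} [NormedAddCommGroup F] [NormedSpace ℂ F] [CompleteSpace F]

/-- The variable `w = x + z` removes `x` from the argument of `ψ`; the phase is unchanged because
`wave θ x x = 1`. -/
theorem moyal_eq_integral_sub (a : 𝓢(Plane, ℂ)) (ψ : Plane → F) (x : Plane) :
    moyal θ a ψ x = ∫ w, (wave θ x w * symbol θ a (w - x)) • ψ w := by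
  rw [moyal_eq_integral, ← integral_add_left_eq_self
    (fun w => (wave θ x w * symbol θ a (w - x)) • ψ w) x]
  congr 1
  ext z
  rw [wave_add_right, wave_self, one_mul, add_sub_cancel_left]

omit [CompleteSpace F] in
theorem integrable_kernel_sub_smul (a : 𝓢(Plane, ℂ)) {ψ : Plane → F} (hψ : MemLp ψ 2 volume)
    (x : Plane) : Integrable fun w => (wave θ x w * symbol θ a (w - x)) • ψ w := by
  have h := (integrable_kernel_smul (θ := θ) a hψ x).comp_sub_right x
  refine h.congr (Filter.Eventually.of_forall fun w => ?_)
  have e : wave θ x (w - x) = wave θ x w := by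
    rw [sub_eq_add_neg, wave_add_right, wave_neg_right, wave_self]; simp
  simp only [e, add_sub_cancel]

/-- All dependence on `x` sits in the kernel, so no derivative of `ψ` is needed. The dominating
function is a product of two `L²` functions. -/
theorem hasFDerivAt_moyal (a : 𝓢(Plane, ℂ)) {ψ : Plane → F} (hc : Continuous ψ)
    (hψ : MemLp ψ 2 volume) (x : Plane) :
    Integrable (fun w => (kernelD θ (symbol θ a) x w).smulRight (ψ w)) ∧
    HasFDerivAt (moyal θ a ψ) (∫ w, (kernelD θ (symbol θ a) x w).smulRight (ψ w)) x := by
  obtain ⟨C, hC, hbd⟩ := norm_kernelD_le (θ := θ) (symbol θ a) x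
  have hm : ∀ y, AEStronglyMeasurable
      (fun w => (kernelD θ (symbol θ a) y w).smulRight (ψ w)) volume := fun y => by
    have h1 := continuous_kernelD (θ := θ) (symbol θ a) y
    have h2 : (fun w => (kernelD θ (symbol θ a) y w).smulRight (ψ w)) = fun w =>
        ((ContinuousLinearMap.lsmul ℝ ℂ (E := F)).flip (ψ w)).comp (kernelD θ (symbol θ a) y w) := by
      ext w v; simp
    rw [h2]
    exact Continuous.aestronglyMeasurable (by fun_prop)
  have hL2 : MemLp (fun w : Plane => C * (1 + ‖w‖) ^ (-(3 : ℝ))) 2 volume := by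
    refine MemLp.const_mul ?_ C
    have hcont : Continuous fun w : Plane => (1 + ‖w‖) ^ (-(3 : ℝ)) :=
      Continuous.rpow_const (by fun_prop) fun w => Or.inl (by positivity)
    refine (memLp_two_iff_integrable_sq hcont.aestronglyMeasurable).2 ?_
    have h6 : Integrable fun w : Plane => (1 + ‖w‖) ^ (-(6 : ℝ)) :=
      integrable_one_add_norm (by rw [finrank_euclideanSpace_fin]; norm_num)
    refine h6.congr (Filter.Eventually.of_forall fun w => ?_)
    have : (0 : ℝ) < 1 + ‖w‖ := by positivity
    simp only
    rw [← Real.rpow_natCast, ← Real.rpow_mul this.le]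
    norm_num
  have hbi : Integrable (fun w => C * (1 + ‖w‖) ^ (-(3 : ℝ)) * ‖ψ w‖) volume :=
    hL2.integrable_mul hψ.norm
  have hle : ∀ y ∈ Metric.ball x 1, ∀ w, ‖(kernelD θ (symbol θ a) y w).smulRight (ψ w)‖ ≤
      C * (1 + ‖w‖) ^ (-(3 : ℝ)) * ‖ψ w‖ := fun y hy w => by
    have hb := hbd y hy w
    refine ContinuousLinearMap.opNorm_le_bound _ (by positivity) fun v => ?_
    rw [ContinuousLinearMap.smulRight_apply, norm_smul]
    calc _ ≤ ‖kernelD θ (symbol θ a) y w‖ * ‖v‖ * ‖ψ w‖ := by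
          gcongr; exact ContinuousLinearMap.le_opNorm _ _
      _ ≤ C * (1 + ‖w‖) ^ (-(3 : ℝ)) * ‖v‖ * ‖ψ w‖ := by gcongr
      _ = _ := by ring
  refine ⟨hbi.mono' (hm x) (Filter.Eventually.of_forall (hle x (Metric.mem_ball_self one_pos))), ?_⟩
  have h0 : moyal θ a ψ = fun y => ∫ w, (wave θ y w * symbol θ a (w - y)) • ψ w := by
    ext y; exact moyal_eq_integral_sub a ψ y
  rw [h0]
  refine hasFDerivAt_integral_of_dominated_of_fderiv_le (𝕜 := ℝ) (s := Metric.ball x 1)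
    (Metric.ball_mem_nhds x one_pos) (Filter.Eventually.of_forall fun y =>
      (integrable_kernel_sub_smul a hψ y).aestronglyMeasurable)
    (integrable_kernel_sub_smul a hψ x) (hm x)
    (Filter.Eventually.of_forall fun w y hy => hle y hy w) hbi
    (Filter.Eventually.of_forall fun w y _ => ?_)
  exact (hasFDerivAt_kernel (symbol θ a) y w).smul_const (ψ w)

theorem hasFDerivAt_wave_right (x w : Plane) :
    HasFDerivAt (fun y => wave θ x y)
      (-(wave θ x w • ((2 * I) • (Complex.ofRealCLM ∘L phaseForm θ x)))) w := by
  have h : (fun y => wave θ x y) = fun y => wave θ (-y) x := by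
    ext y
    rw [wave_swap x (-y), wave_neg_right, Complex.conj_conj]
  rw [h]
  have h1 : HasFDerivAt (fun y : Plane => -y) (-ContinuousLinearMap.id ℝ Plane) w :=
    (hasFDerivAt_id w).neg
  have h2 := (hasFDerivAt_wave_left (θ := θ) (-w) x).comp w h1
  refine h2.congr_fderiv ?_
  have h3 : wave θ (-w) x = wave θ x w := (congrFun h w).symm
  ext v
  simp [h3]

/-- The Leibniz rule for the Moyal product with a Schwartz function. -/
theorem fderiv_moyal (a : 𝓢(Plane, ℂ)) {ψ : Plane → F} (hc : ContDiff ℝ 1 ψ)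
    (hψ : MemLp ψ 2 volume) {v : Plane} (hψ' : MemLp (fun y => fderiv ℝ ψ y v) 2 volume)
    (x : Plane) :
    fderiv ℝ (moyal θ a ψ) x v =
      moyal θ (∂_{v} a : 𝓢(Plane, ℂ)) ψ x + moyal θ a (fun y => fderiv ℝ ψ y v) x := by
  obtain ⟨hi, hd⟩ := hasFDerivAt_moyal (θ := θ) a hc.continuous hψ x
  set φ := symbol θ a with hφ
  rw [hd.fderiv, ContinuousLinearMap.integral_apply hi, moyal_eq_integral_sub,
    moyal_eq_integral_sub]
  simp only [ContinuousLinearMap.smulRight_apply]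
  -- the derivative of the kernel in the integration variable
  set K : Plane → ℂ := fun w => wave θ x w * φ (w - x) with hK
  set K' : Plane → ℂ := fun w => 2 * I * (phase θ x v : ℂ) * K w + wave θ x w * (∂_{v} φ) (w - x)
    with hK'
  -- The derivative of the kernel in `x` is the kernel of `∂_v a` minus the derivative in `w`; the
  -- latter is moved onto `ψ` by integration by parts.
  have e1 : ∀ w, kernelD θ φ x w v = wave θ x w * symbol θ (∂_{v} a) (w - x) - K' w := by
    intro w
    have : phase θ v (w - x) = phase θ v w + phase θ x v := by
      rw [sub_eq_add_neg, phase_add_right]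
      congr 1
      rw [phase_eq hθ.out, phase_eq hθ.out]
      simp; ring
    rw [symbol_lineDeriv, this]
    simp [kernelD, hK', hK, phaseForm_apply, lineDerivOp_apply_eq_fderiv]
    ring
  have hKd : ∀ w, HasLineDerivAt ℝ K (K' w) w v := by
    intro w
    have h1 : HasFDerivAt (fun y : Plane => y - x) (ContinuousLinearMap.id ℝ Plane) w :=
      (hasFDerivAt_id w).sub_const x
    have h2 := (hasFDerivAt_wave_right (θ := θ) x w).mul ((φ.hasFDerivAt (w - x)).comp w h1)
    have key : ∀ D : Plane →L[ℝ] ℂ, HasFDerivAt K D w → D v = K' w →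
      HasLineDerivAt ℝ K (K' w) w v := fun D hD e => e ▸ hD.hasLineDerivAt v
    refine key _ h2 ?_
    have : phase θ v x = - phase θ x v := phase_swap x v
    simp [hK', hK, phaseForm_apply, lineDerivOp_apply_eq_fderiv, this]
    ring
  have i1 := integrable_kernel_sub_smul (θ := θ) (∂_{v} a) hψ x
  have i2 : Integrable (fun w => K' w • ψ w) := by
    have h := hi.apply_continuousLinearMap v
    simp only [ContinuousLinearMap.smulRight_apply, e1, sub_smul] at h
    have := i1.sub h
    refine this.congr (Filter.Eventually.of_forall fun w => ?_)
    simp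
  have i3 : Integrable (fun w => K w • fderiv ℝ ψ w v) := integrable_kernel_sub_smul a hψ' x
  have i4 : Integrable (fun w => K w • ψ w) := integrable_kernel_sub_smul a hψ x
  have hp := integral_bilinear_hasLineDerivAt_right_eq_neg_left_of_integrable
    (μ := (volume : Measure Plane)) (B := ContinuousLinearMap.lsmul ℝ ℂ (E := F))
    (f := K) (f' := K') (g := ψ) (g' := fun w => fderiv ℝ ψ w v) (v := v) i2 i3 i4
    (fun w _ => hKd w) (fun w _ => ((hc.differentiable one_ne_zero) w).hasFDerivAt.hasLineDerivAt v)
  simp only [ContinuousLinearMap.lsmul_apply] at hp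
  rw [hp]
  simp_rw [e1, sub_smul]
  rw [integral_sub i1 i2, sub_eq_add_neg]

/-- The commutator of `L(a)` with the multiplication by a linear form. -/
theorem phase_smul_moyal (a : 𝓢(Plane, ℂ)) {ψ : Plane → F} (v : Plane) (hψ : MemLp ψ 2 volume)
    (hψ' : MemLp (fun y => (phase θ v y : ℂ) • ψ y) 2 volume) (x : Plane) :
    (phase θ v x : ℂ) • moyal θ a ψ x - moyal θ a (fun y => (phase θ v y : ℂ) • ψ y) x =
      (I / 2) • moyal θ (∂_{v} a : 𝓢(Plane, ℂ)) ψ x := by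
  have i1 : Integrable fun z => (phase θ v x : ℂ) • (wave θ x z * symbol θ a z) • ψ (x + z) :=
    (integrable_kernel_smul a hψ x).smul _
  rw [moyal_eq_integral, moyal_eq_integral, moyal_eq_integral, ← integral_smul, ← integral_smul,
    ← integral_sub i1 (integrable_kernel_smul a hψ' x)]
  congr 1
  ext z
  rw [smul_smul, smul_smul, smul_smul, ← sub_smul, symbol_lineDeriv, phase_add_right]
  congr 1
  push_cast
  linear_combination (- wave θ x z * symbol θ a z * phase θ v z) * I_sq

end Leibniz

/-! ### Commutators with the Dirac operators -/

/-- The partial derivative `∂_μ a` in the algebra. -/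
def pd (μ : Fin 2) (a : 𝓢(Plane, ℂ)) : 𝓢(Plane, ℂ) := ∂_{axis μ} a

theorem moyal_clm {F G : Type*} [NormedAddCommGroup F] [NormedSpace ℂ F] [CompleteSpace F]
    [NormedAddCommGroup G] [NormedSpace ℂ G] [CompleteSpace G] (T : F →L[ℂ] G)
    (a : 𝓢(Plane, ℂ)) {ψ : Plane → F} (hψ : MemLp ψ 2 volume) (x : Plane) :
    moyal θ a (fun y => T (ψ y)) x = T (moyal θ a ψ x) := by
  rw [moyal_eq_integral, moyal_eq_integral,
    ← ContinuousLinearMap.integral_comp_comm T (integrable_kernel_smul a hψ x)]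
  simp_rw [map_smul]

theorem eLpNorm_moyal_scalar_le (b : 𝓢(Plane, ℂ)) {ψ : Plane → ℂ} (hψ : MemLp ψ 2 volume) :
    eLpNorm (moyal θ b ψ) 2 volume ≤ cstarNorm θ b * eLpNorm ψ 2 volume := by
  have h := (leftRep θ b).le_opNorm hψ.toLp
  rw [leftRep_toLp_of_memLp, Lp.norm_toLp, Lp.norm_toLp] at h
  rw [cstarNorm_eq, ← ENNReal.ofReal_toReal (memLp_moyal (θ := θ) b hψ).2.ne,
    ← ENNReal.ofReal_toReal hψ.2.ne, ← ENNReal.ofReal_mul (norm_nonneg _)]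
  exact ENNReal.ofReal_le_ofReal h

section Spinors
variable {ι : Type} [Fintype ι]

/-- Componentwise estimate and triangle inequality; the crude factor is harmless, since only a
finite constant independent of `b` matters. -/
theorem eLpNorm_moyal_spinor_le [DecidableEq ι] (b : 𝓢(Plane, ℂ)) {ψ : Spinor ι}
    (hψ : MemLp ψ 2 volume) :
    eLpNorm (moyal θ b ψ) 2 volume ≤
      (Fintype.card ι : ℝ≥0∞) * (cstarNorm θ b * eLpNorm ψ 2 volume) := by
  set c : ι → Plane → ℂ := fun i y => ψ y i
  have hc : ∀ i, MemLp (c i) 2 volume := fun i =>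
    hψ.of_le (((EuclideanSpace.proj i : EuclideanSpace ℂ ι →L[ℂ] ℂ).continuous).comp_aestronglyMeasurable hψ.1)
      (Filter.Eventually.of_forall fun y => PiLp.norm_apply_le (ψ y) i)
  have hle : ∀ i, eLpNorm (c i) 2 volume ≤ eLpNorm ψ 2 volume := fun i =>
    eLpNorm_mono fun y => PiLp.norm_apply_le (ψ y) i
  have hs : moyal θ b ψ = ∑ i, fun x => EuclideanSpace.single i (moyal θ b (c i) x) := by
    ext x i
    have h := moyal_clm (θ := θ) (EuclideanSpace.proj i : EuclideanSpace ℂ ι →L[ℂ] ℂ) b hψ x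
    rw [Finset.sum_apply]
    simp only [WithLp.ofLp_sum, Finset.sum_apply, PiLp.single_apply]
    rw [Finset.sum_ite_eq Finset.univ i, if_pos (Finset.mem_univ i)]
    exact h.symm
  rw [hs]
  have hn : ∀ i, eLpNorm (fun x => EuclideanSpace.single i (moyal θ b (c i) x)) 2 volume =
      eLpNorm (moyal θ b (c i)) 2 volume := fun i =>
    eLpNorm_congr_norm_ae (Filter.Eventually.of_forall fun x => by simp)
  have hm : ∀ i, AEStronglyMeasurable
      (fun x => (EuclideanSpace.single i (moyal θ b (c i) x) : EuclideanSpace ℂ ι)) volume :=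
    fun i => by
      have hcont : Continuous fun t : ℂ => (EuclideanSpace.single i t : EuclideanSpace ℂ ι) :=
        (PiLp.continuous_toLp 2 _).comp (continuous_single (A := fun _ : ι => ℂ) i)
      exact hcont.comp_aestronglyMeasurable (memLp_moyal b (hc i)).1
  calc _ ≤ ∑ i, eLpNorm (fun x => (EuclideanSpace.single i (moyal θ b (c i) x) :
          EuclideanSpace ℂ ι)) 2 volume := eLpNorm_sum_le (fun i _ => hm i) one_le_two
    _ ≤ ∑ _i : ι, cstarNorm θ b * eLpNorm ψ 2 volume := by
        refine Finset.sum_le_sum fun i _ => ?_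
        rw [hn]
        exact (eLpNorm_moyal_scalar_le b (hc i)).trans (by gcongr; exact hle i)
    _ = _ := by simp

/-- A matrix acting on spinor components as a continuous linear map. -/
def actL (M : Matrix ι ι ℂ) : EuclideanSpace ℂ ι →L[ℂ] EuclideanSpace ℂ ι :=
  LinearMap.toContinuousLinearMap
    { toFun := act M
      map_add' := fun v w => by simp [act, Matrix.mulVec_add]
      map_smul' := fun c v => by simp [act, Matrix.mulVec_smul] }

theorem actL_apply (M : Matrix ι ι ℂ) (v : EuclideanSpace ℂ ι) : actL M v = act M v := rfl

theorem memLp_act {ψ : Spinor ι} (M : Matrix ι ι ℂ) (hψ : MemLp ψ 2 volume) :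
    MemLp (fun x => act M (ψ x)) 2 volume := (actL M).comp_memLp' hψ

/-- By the Leibniz rule the terms in which `ψ` is differentiated cancel, so the commutator is of
order zero. -/
theorem freeDirac_comm (γ : Fin 2 → Matrix ι ι ℂ) (a : 𝓢(Plane, ℂ)) {ψ : Spinor ι}
    (hc : ContDiff ℝ 1 ψ) (hψ : MemLp ψ 2 volume) (hd : ∀ μ, MemLp (partialD μ ψ) 2 volume)
    (x : Plane) :
    freeDirac γ (moyal θ a ψ) x - moyal θ a (freeDirac γ ψ) x =
      ∑ μ, (-I) • actL (γ μ) (moyal θ (pd μ a) ψ x) := by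
  have h1 : ∀ μ, partialD μ (moyal θ a ψ) x =
      moyal θ (pd μ a) ψ x + moyal θ a (partialD μ ψ) x := fun μ =>
    fderiv_moyal a hc hψ (hd μ) x
  have hm : ∀ μ, MemLp (fun y => (-I) • act (γ μ) (partialD μ ψ y)) 2 volume := fun μ =>
    (memLp_act (γ μ) (hd μ)).const_smul (-I)
  have h2 : freeDirac γ ψ = (fun y => (-I) • act (γ 0) (partialD 0 ψ y)) +
      fun y => (-I) • act (γ 1) (partialD 1 ψ y) := by
    funext y; simp only [freeDirac, Fin.sum_univ_two, Pi.add_apply]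
  have h3 : ∀ μ, moyal θ a (fun y => (-I) • act (γ μ) (partialD μ ψ y)) x =
      (-I) • actL (γ μ) (moyal θ a (partialD μ ψ) x) := fun μ =>
    moyal_clm ((-I) • actL (γ μ)) a (hd μ) x
  rw [h2, moyal_add_right a (hm 0) (hm 1), Pi.add_apply, h3, h3, freeDirac]
  simp only [Fin.sum_univ_two, ← actL_apply, h1, map_add, smul_add]
  abel

omit hθ in
theorem xTilde_eq (μ : Fin 2) (x : Plane) : xTilde θ μ x = 2 * phase θ (axis μ) x := by
  rw [xTilde, phase]
  fin_cases μ <;> simp [axis, Fin.sum_univ_two]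

/-- The harmonic term adds nothing new: by `phase_smul_moyal` and `x̃_μ = 2 phase`, the commutator
of multiplication by `x̃_μ` with `L(a)` is `i L(∂_μ a)`. -/
theorem harmonicDirac_comm (Ω : ℝ) (γ γ' : Fin 2 → Matrix ι ι ℂ) (a : 𝓢(Plane, ℂ)) {ψ : Spinor ι}
    (hc : ContDiff ℝ 1 ψ) (hψ : MemLp ψ 2 volume) (hd : ∀ μ, MemLp (partialD μ ψ) 2 volume)
    (hx : ∀ μ, MemLp (fun y => (phase θ (axis μ) y : ℂ) • ψ y) 2 volume) (x : Plane) :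
    harmonicDirac θ Ω γ γ' (moyal θ a ψ) x - moyal θ a (harmonicDirac θ Ω γ γ' ψ) x =
      ∑ μ, ((-I) • actL (γ μ) - (Ω * I) • actL (γ' μ)) (moyal θ (pd μ a) ψ x) := by
  have h0 := freeDirac_comm (θ := θ) γ a hc hψ hd x
  set T : Fin 2 → EuclideanSpace ℂ ι →L[ℂ] EuclideanSpace ℂ ι := fun μ =>
    (2 * Ω : ℂ) • actL (γ' μ) with hT
  set X : Fin 2 → Spinor ι := fun μ y => (phase θ (axis μ) y : ℂ) • ψ y with hX
  have e : ∀ (χ : Spinor ι) μ y, ((Ω * xTilde θ μ y : ℝ) : ℂ) • act (γ' μ) (χ y) =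
      T μ ((phase θ (axis μ) y : ℂ) • χ y) := by
    intro χ μ y
    rw [xTilde_eq, hT, smul_apply, map_smul, smul_smul, actL_apply]
    congr 1
    push_cast
    ring
  have hf : MemLp (freeDirac γ ψ) 2 volume := by
    have h2 : freeDirac γ ψ = (fun y => (-I) • act (γ 0) (partialD 0 ψ y)) +
        fun y => (-I) • act (γ 1) (partialD 1 ψ y) := by
      funext y; simp only [freeDirac, Fin.sum_univ_two, Pi.add_apply]
    rw [h2]
    exact ((memLp_act (γ 0) (hd 0)).const_smul (-I)).add ((memLp_act (γ 1) (hd 1)).const_smul (-I))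
  have hTX : ∀ μ, MemLp (fun y => (-T μ) (X μ y)) 2 volume := fun μ => (-T μ).comp_memLp' (hx μ)
  have h2 : harmonicDirac θ Ω γ γ' ψ = freeDirac γ ψ +
      ((fun y => (-T 0) (X 0 y)) + fun y => (-T 1) (X 1 y)) := by
    funext y
    simp only [harmonicDirac, Fin.sum_univ_two, e, Pi.add_apply, hX, neg_apply]
    abel
  rw [h2, moyal_add_right a hf ((hTX 0).add (hTX 1)), moyal_add_right a (hTX 0) (hTX 1),
    Pi.add_apply, Pi.add_apply, moyal_clm (-T 0) a (hx 0) x, moyal_clm (-T 1) a (hx 1) x]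
  have hk : ∀ μ, T μ ((phase θ (axis μ) x : ℂ) • moyal θ a ψ x) = T μ (moyal θ a (X μ) x) +
      (Ω * I) • actL (γ' μ) (moyal θ (pd μ a) ψ x) := by
    intro μ
    have := phase_smul_moyal a (axis μ) hψ (hx μ) x
    rw [sub_eq_iff_eq_add'] at this
    rw [this, map_add]
    congr 1
    rw [hT, smul_apply, map_smul, smul_smul]
    congr 1
    ring
  rw [harmonicDirac]
  simp only [e, Fin.sum_univ_two, hk] at h0 ⊢
  rw [sub_eq_iff_eq_add] at h0
  rw [h0]
  simp only [sub_apply, smul_apply, neg_apply]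
  abel

/-- The bound on a commutator which is a combination of the operators `L(∂_μ a)`. -/
theorem eLpNorm_comm_le [DecidableEq ι] (T : Fin 2 → EuclideanSpace ℂ ι →L[ℂ] EuclideanSpace ℂ ι)
    (a : 𝓢(Plane, ℂ)) {ψ : Spinor ι} (hψ : MemLp ψ 2 volume) (h1 : eLpNorm ψ 2 volume ≤ 1) :
    eLpNorm (fun x => ∑ μ, T μ (moyal θ (pd μ a) ψ x)) 2 volume ≤
      (∑ μ, ‖T μ‖ₑ) * (Fintype.card ι : ℝ≥0∞) * ∑ μ, cstarNorm θ (pd μ a) := by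
  have hs : (fun x => ∑ μ, T μ (moyal θ (pd μ a) ψ x)) =
      ∑ μ, fun x => T μ (moyal θ (pd μ a) ψ x) := by
    ext x; rw [Finset.sum_apply]
  have hm : ∀ μ, MemLp (moyal θ (pd μ a) ψ) 2 volume := fun μ => memLp_moyal _ hψ
  rw [hs]
  calc _ ≤ ∑ μ, eLpNorm (fun x => T μ (moyal θ (pd μ a) ψ x)) 2 volume :=
        eLpNorm_sum_le (fun μ _ => ((T μ).comp_memLp' (hm μ)).1) one_le_two
    _ ≤ ∑ μ, ‖T μ‖ₑ * ((Fintype.card ι : ℝ≥0∞) * ∑ ν, cstarNorm θ (pd ν a)) := by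
        refine Finset.sum_le_sum fun μ _ => ?_
        refine (eLpNorm_le_mul_eLpNorm_of_ae_le_mul (c := ‖T μ‖)
          (Filter.Eventually.of_forall fun x => (T μ).le_opNorm _) 2).trans ?_
        rw [ofReal_norm]
        gcongr
        refine (eLpNorm_moyal_spinor_le _ hψ).trans ?_
        gcongr
        calc _ ≤ cstarNorm θ (pd μ a) * 1 := by gcongr
          _ ≤ _ := by
            rw [mul_one]
            exact Finset.single_le_sum (f := fun ν => cstarNorm θ (pd ν a))
              (fun _ _ => zero_le) (Finset.mem_univ μ)
    _ = _ := by rw [← Finset.sum_mul, mul_assoc]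

end Spinors

theorem commutatorNorm_D0_le (a : 𝓢(Plane, ℂ)) :
    commutatorNorm θ domL2 D0 a ≤
      (∑ μ, ‖(-I) • actL (sigma μ)‖ₑ) * (Fintype.card (Fin 2) : ℝ≥0∞) *
        ∑ μ, cstarNorm θ (pd μ a) := by
  refine iSup₂_le fun ψ hψ => iSup_le fun h1 => ?_
  obtain ⟨hc, hL⟩ := hψ
  have hc1 : ContDiff ℝ 1 ψ := hc.of_le (by exact_mod_cast le_top)
  have h2 : MemLp ψ 2 volume := (hL 0).congr_norm hc1.continuous.aestronglyMeasurable
    (Filter.Eventually.of_forall fun x => norm_iteratedFDeriv_zero)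
  have h3 : ∀ μ, MemLp (partialD μ ψ) 2 volume := fun μ => by
    have h4 : MemLp (fderiv ℝ ψ) 2 volume :=
      (hL 1).congr_norm (hc1.continuous_fderiv one_ne_zero).aestronglyMeasurable
        (Filter.Eventually.of_forall fun x => norm_iteratedFDeriv_one ..)
    exact (ContinuousLinearMap.apply ℝ (EuclideanSpace ℂ (Fin 2)) (axis μ)).comp_memLp' h4
  have h5 : D0 (moyal θ a ψ) - moyal θ a (D0 ψ) = fun x =>
      ∑ μ, ((-I) • actL (sigma μ)) (moyal θ (pd μ a) ψ x) := by
    funext x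
    exact freeDirac_comm sigma a hc1 h2 h3 x
  rw [h5]
  exact eLpNorm_comm_le _ a h2 h1

theorem commutatorNorm_harmonic_le (Ω : ℝ)
    (γ γ' : Fin 2 → Matrix (Fin 2 × Fin 2) (Fin 2 × Fin 2) ℂ) (a : 𝓢(Plane, ℂ)) :
    commutatorNorm θ domSchwartz (harmonicDirac θ Ω γ γ') a ≤
      (∑ μ, ‖(-I) • actL (γ μ) - (Ω * I) • actL (γ' μ)‖ₑ) *
        (Fintype.card (Fin 2 × Fin 2) : ℝ≥0∞) * ∑ μ, cstarNorm θ (pd μ a) := by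
  refine iSup₂_le fun ψ hψ => iSup_le fun h1 => ?_
  obtain ⟨u, rfl⟩ := hψ
  have h3 : ∀ μ, MemLp (partialD μ (u : Spinor (Fin 2 × Fin 2))) 2 volume := fun μ =>
    (∂_{axis μ} u : 𝓢(Plane, EuclideanSpace ℂ (Fin 2 × Fin 2))).memLp 2 volume |>.ae_eq
      (Filter.Eventually.of_forall fun x => lineDerivOp_apply_eq_fderiv _ _ _)
  have h4 : ∀ μ, MemLp (fun y => (phase θ (axis μ) y : ℂ) • u y) 2 volume := fun μ => by
    have hg : Function.HasTemperateGrowth fun z : Plane => ((phaseR θ (axis μ) z : ℝ) : ℂ) := by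
      have : (fun z : Plane => ((phaseR θ (axis μ) z : ℝ) : ℂ)) =
          ⇑(Complex.ofRealCLM ∘L phaseR θ (axis μ)) := rfl
      rw [this]; exact ContinuousLinearMap.hasTemperateGrowth _
    refine ((smulLeftCLM (EuclideanSpace ℂ (Fin 2 × Fin 2))
      (fun z : Plane => ((phaseR θ (axis μ) z : ℝ) : ℂ)) u).memLp 2 volume).ae_eq
      (Filter.Eventually.of_forall fun x => ?_)
    rw [smulLeftCLM_apply_apply hg]
    rfl
  have h5 : harmonicDirac θ Ω γ γ' (moyal θ a u) - moyal θ a (harmonicDirac θ Ω γ γ' u) = fun x =>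
      ∑ μ, ((-I) • actL (γ μ) - (Ω * I) • actL (γ' μ)) (moyal θ (pd μ a) u x) := by
    funext x
    exact harmonicDirac_comm Ω γ γ' a (u.smooth 1) (u.memLp 2 volume) h3 h4 x
  rw [h5]
  exact eLpNorm_comm_le _ a (u.memLp 2 volume) h1

/-- All Lipschitz seminorms are bounded by the norms of the partial derivatives. -/
theorem exists_lipNorm_le (Ω : ℝ) (k : Fin 3) : ∃ K : ℝ≥0∞, K ≠ ⊤ ∧
    ∀ a : 𝓢(Plane, ℂ), lipNorm θ Ω k a ≤ K * ∑ μ, cstarNorm θ (pd μ a) := by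
  fin_cases k
  · exact ⟨_, ENNReal.mul_ne_top (ENNReal.sum_ne_top.2 fun _ _ => enorm_ne_top)
      (ENNReal.natCast_ne_top _), commutatorNorm_D0_le⟩
  · exact ⟨_, ENNReal.mul_ne_top (ENNReal.sum_ne_top.2 fun _ _ => enorm_ne_top)
      (ENNReal.natCast_ne_top _), commutatorNorm_harmonic_le Ω _ _⟩
  · exact ⟨_, ENNReal.mul_ne_top (ENNReal.sum_ne_top.2 fun _ _ => enorm_ne_top)
      (ENNReal.natCast_ne_top _), commutatorNorm_harmonic_le Ω _ _⟩

/-! ### The Gaussian as a Schwartz function -/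

section Gaussian

/-- The real Gaussian on the plane. -/
def gaussFun (b : ℝ) (x : Plane) : ℝ := Real.exp (-b * ‖x‖ ^ 2)

theorem hasFDerivAt_gaussFun (b : ℝ) (x : Plane) :
    HasFDerivAt (gaussFun b) (gaussFun b x • ((-2 * b) • innerSL ℝ x)) x := by
  have h := (((hasStrictFDerivAt_norm_sq x).hasFDerivAt).const_mul (-b)).exp
  refine h.congr_fderiv ?_
  ext v
  simp [gaussFun]
  ring

theorem fderiv_gaussFun (b : ℝ) :
    fderiv ℝ (gaussFun b) = fun x => gaussFun b x • ((-2 * b) • innerSL ℝ : Plane →L[ℝ] _) x := by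
  ext1 x; rw [(hasFDerivAt_gaussFun b x).fderiv]; rfl

theorem contDiff_gaussFun (b : ℝ) {n : WithTop ℕ∞} : ContDiff ℝ n (gaussFun b) := by
  unfold gaussFun
  exact (contDiff_const.mul (contDiff_norm_sq ℝ)).exp

/-- The differential of the Gaussian is the Gaussian times a linear map. The Leibniz bound thus
reduces order `n + 1` to orders at most `n`, the polynomial growth being absorbed into a larger `k`.
-/
theorem gaussFun_decay {b : ℝ} (hb : 0 < b) (n : ℕ) : ∀ k : ℕ,
    ∃ C, ∀ x, (1 + ‖x‖) ^ k * ‖iteratedFDeriv ℝ n (gaussFun b) x‖ ≤ C := by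
  induction n using Nat.strong_induction_on with
  | _ n ih =>
  intro k
  rcases n with _ | n
  -- Here `(1 + r)^k ≤ k! e^{1+r}`, and `r - b r² ≤ 1/(4b)` by completing the square.
  · refine ⟨k.factorial * Real.exp (1 + 1 / (4 * b)), fun x => ?_⟩
    rw [norm_iteratedFDeriv_zero, gaussFun, Real.norm_of_nonneg (Real.exp_pos _).le]
    have h1 := Real.pow_div_factorial_le_exp (1 + ‖x‖) (by positivity) k
    rw [div_le_iff₀ (by positivity)] at h1
    calc _ ≤ Real.exp (1 + ‖x‖) * k.factorial * Real.exp (-b * ‖x‖ ^ 2) := by gcongr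
      _ = k.factorial * Real.exp (1 + ‖x‖ + -b * ‖x‖ ^ 2) := by rw [Real.exp_add (1 + ‖x‖)]; ring
      _ ≤ _ := by
        gcongr ?_ * Real.exp ?_
        have : b * (‖x‖ - 1 / (2 * b)) ^ 2 = b * ‖x‖ ^ 2 - ‖x‖ + 1 / (4 * b) := by
          field_simp; ring
        have h2 : 0 ≤ b * (‖x‖ - 1 / (2 * b)) ^ 2 := by positivity
        linarith
  · set L : Plane →L[ℝ] Plane →L[ℝ] ℝ := (-2 * b) • innerSL ℝ with hL
    have htg : ∀ j, ∃ p C, ∀ x, ‖iteratedFDeriv ℝ j L x‖ ≤ C * (1 + ‖x‖) ^ p := fun j =>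
      (L.hasTemperateGrowth).2 j
    choose p B hB using htg
    choose C hC using fun i : Fin (n + 1) => ih i i.2 (k + p (n - i))
    refine ⟨∑ i : Fin (n + 1), (n.choose i) * (B (n - i) * C i), fun x => ?_⟩
    have hx : (0 : ℝ) < 1 + ‖x‖ := by positivity
    have h1 : ‖iteratedFDeriv ℝ (n + 1) (gaussFun b) x‖ ≤ ∑ i ∈ Finset.range (n + 1),
        (n.choose i) * ‖iteratedFDeriv ℝ i (gaussFun b) x‖ * ‖iteratedFDeriv ℝ (n - i) L x‖ := by
      rw [← norm_iteratedFDeriv_fderiv, fderiv_gaussFun]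
      exact norm_iteratedFDeriv_smul_le (𝕜 := ℝ) (N := (n : WithTop ℕ∞)) (contDiff_gaussFun b)
        L.contDiff x le_rfl
    rw [Finset.sum_range] at h1
    refine (mul_le_mul_of_nonneg_left h1 (by positivity)).trans ?_
    rw [Finset.mul_sum]
    refine Finset.sum_le_sum fun i _ => ?_
    have hB0 : 0 ≤ B (n - i) := by
      have := (norm_nonneg _).trans (hB (n - i) x)
      exact nonneg_of_mul_nonneg_left this (by positivity)
    calc _ ≤ (1 + ‖x‖) ^ k * ((n.choose i) * ‖iteratedFDeriv ℝ i (gaussFun b) x‖ *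
          (B (n - i) * (1 + ‖x‖) ^ p (n - i))) := by gcongr; exact hB _ _
      _ = (n.choose i) * (B (n - i) *
          ((1 + ‖x‖) ^ (k + p (n - i)) * ‖iteratedFDeriv ℝ i (gaussFun b) x‖)) := by
        rw [pow_add]; ring
      _ ≤ _ := by gcongr; exact hC i x

/-- The Gaussian as a Schwartz function. -/
def gauss {b : ℝ} (hb : 0 < b) : 𝓢(Plane, ℝ) where
  toFun := gaussFun b
  smooth' := contDiff_gaussFun b
  decay' k n := by
    obtain ⟨C, hC⟩ := gaussFun_decay hb n k
    refine ⟨C, fun x => le_trans ?_ (hC x)⟩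
    gcongr
    linarith

end Gaussian

/-! ### Ladder operators: Moyal multiplication by `z` and `z̄` -/

section Ladder

theorem zCoord_eq_clm : ∃ T : Plane →L[ℝ] ℂ, zCoord = ⇑T := by
  refine ⟨((1 / (Real.sqrt 2 : ℂ)) • (Complex.ofRealCLM ∘L (EuclideanSpace.proj 0 : Plane →L[ℝ] ℝ) +
    I • (Complex.ofRealCLM ∘L (EuclideanSpace.proj 1 : Plane →L[ℝ] ℝ)))), ?_⟩
  ext x
  simp [zCoord]
  ring

theorem hasTemperateGrowth_zCoord : Function.HasTemperateGrowth zCoord := by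
  obtain ⟨T, hT⟩ := zCoord_eq_clm
  rw [hT]; exact T.hasTemperateGrowth

theorem hasTemperateGrowth_conj_zCoord :
    Function.HasTemperateGrowth fun x => (starRingEnd ℂ) (zCoord x) := by
  obtain ⟨T, hT⟩ := zCoord_eq_clm
  have : (fun x => (starRingEnd ℂ) (zCoord x)) = ⇑((Complex.conjCLE : ℂ →L[ℝ] ℂ) ∘L T) := by
    rw [hT]; rfl
  rw [this]; exact ContinuousLinearMap.hasTemperateGrowth _

/-- Multiplication by `z`. -/
def mz : 𝓢(Plane, ℂ) →L[ℂ] 𝓢(Plane, ℂ) := smulLeftCLM ℂ zCoord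

/-- Multiplication by `z̄`. -/
def mzb : 𝓢(Plane, ℂ) →L[ℂ] 𝓢(Plane, ℂ) := smulLeftCLM ℂ fun x => (starRingEnd ℂ) (zCoord x)

/-- The derivative `∂₀ + i ∂₁`. -/
def dp : 𝓢(Plane, ℂ) →L[ℂ] 𝓢(Plane, ℂ) :=
  LineDeriv.lineDerivOpCLM ℂ 𝓢(Plane, ℂ) (axis 0) + I • LineDeriv.lineDerivOpCLM ℂ 𝓢(Plane, ℂ) (axis 1)

/-- The derivative `∂₀ - i ∂₁`. -/
def dm : 𝓢(Plane, ℂ) →L[ℂ] 𝓢(Plane, ℂ) :=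
  LineDeriv.lineDerivOpCLM ℂ 𝓢(Plane, ℂ) (axis 0) - I • LineDeriv.lineDerivOpCLM ℂ 𝓢(Plane, ℂ) (axis 1)

@[simp] theorem mz_apply (g : 𝓢(Plane, ℂ)) (x : Plane) : mz g x = zCoord x * g x := by
  rw [mz, smulLeftCLM_apply_apply hasTemperateGrowth_zCoord, smul_eq_mul]

@[simp] theorem mzb_apply (g : 𝓢(Plane, ℂ)) (x : Plane) :
    mzb g x = (starRingEnd ℂ) (zCoord x) * g x := by
  rw [mzb, smulLeftCLM_apply_apply hasTemperateGrowth_conj_zCoord, smul_eq_mul]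

theorem dp_eq (g : 𝓢(Plane, ℂ)) : dp g = pd 0 g + I • pd 1 g := rfl

theorem dm_eq (g : 𝓢(Plane, ℂ)) : dm g = pd 0 g - I • pd 1 g := rfl

/-- The constant `θ / (2√2)`. -/
def kap (θ : ℝ) : ℂ := ((θ / (2 * Real.sqrt 2) : ℝ) : ℂ)

/-- `g ↦ g ⋆ z`. -/
def Rz (θ : ℝ) : 𝓢(Plane, ℂ) →L[ℂ] 𝓢(Plane, ℂ) := mz - kap θ • dp

/-- `g ↦ g ⋆ z̄`. -/
def Rzb (θ : ℝ) : 𝓢(Plane, ℂ) →L[ℂ] 𝓢(Plane, ℂ) := mzb + kap θ • dm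

/-- `g ↦ z ⋆ g`. -/
def Lz (θ : ℝ) : 𝓢(Plane, ℂ) →L[ℂ] 𝓢(Plane, ℂ) := mz + kap θ • dp

/-- `g ↦ z̄ ⋆ g`. -/
def Lzb (θ : ℝ) : 𝓢(Plane, ℂ) →L[ℂ] 𝓢(Plane, ℂ) := mzb - kap θ • dm

omit hθ in
theorem Rz_eq (g : 𝓢(Plane, ℂ)) : Rz θ g = mz g - kap θ • dp g := rfl
omit hθ in
theorem Rzb_eq (g : 𝓢(Plane, ℂ)) : Rzb θ g = mzb g + kap θ • dm g := rfl
omit hθ in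
theorem Lz_eq (g : 𝓢(Plane, ℂ)) : Lz θ g = mz g + kap θ • dp g := rfl
omit hθ in
theorem Lzb_eq (g : 𝓢(Plane, ℂ)) : Lzb θ g = mzb g - kap θ • dm g := rfl

theorem pd_mul (μ : Fin 2) (f g : 𝓢(Plane, ℂ)) :
    pd μ (mul θ f g) = mul θ (pd μ f) g + mul θ f (pd μ g) := by
  ext x
  have hm : MemLp (fun y => fderiv ℝ g y (axis μ)) 2 volume :=
    ((pd μ g).memLp 2 volume).ae_eq
      (Filter.Eventually.of_forall fun x => lineDerivOp_apply_eq_fderiv _ _ _)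
  have h := fderiv_moyal (θ := θ) f (g.smooth 1) (g.memLp 2 volume) hm x
  have e : (fun y => fderiv ℝ g y (axis μ)) = ⇑(pd μ g) := by
    ext y; exact (lineDerivOp_apply_eq_fderiv _ _ _).symm
  rw [e] at h
  exact (lineDerivOp_apply_eq_fderiv _ _ _).trans h

theorem dp_mul (f g : 𝓢(Plane, ℂ)) :
    dp (mul θ f g) = mul θ (dp f) g + mul θ f (dp g) := by
  simp only [dp_eq, pd_mul, add_mul', mul_add', smul_mul', mul_smul', smul_add]
  abel

theorem neg_mul' (f g : 𝓢(Plane, ℂ)) : mul θ (-f) g = - mul θ f g := by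
  rw [← neg_one_smul ℂ, smul_mul', neg_one_smul]

theorem mul_neg' (f g : 𝓢(Plane, ℂ)) : mul θ f (-g) = - mul θ f g := by
  rw [← neg_one_smul ℂ, mul_smul', neg_one_smul]

theorem sub_mul' (f g h : 𝓢(Plane, ℂ)) : mul θ (f - g) h = mul θ f h - mul θ g h := by
  rw [sub_eq_add_neg, add_mul', neg_mul', ← sub_eq_add_neg]

theorem mul_sub' (f g h : 𝓢(Plane, ℂ)) : mul θ f (g - h) = mul θ f g - mul θ f h := by
  rw [sub_eq_add_neg, mul_add', mul_neg', ← sub_eq_add_neg]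

theorem dm_mul (f g : 𝓢(Plane, ℂ)) :
    dm (mul θ f g) = mul θ (dm f) g + mul θ f (dm g) := by
  simp only [dm_eq, pd_mul, sub_mul', mul_sub', smul_mul', mul_smul', smul_add]
  abel

/-- Multiplication by the linear form `phase θ v`. -/
def mphase (θ : ℝ) (v : Plane) : 𝓢(Plane, ℂ) →L[ℂ] 𝓢(Plane, ℂ) :=
  smulLeftCLM ℂ fun z => ((phaseR θ v z : ℝ) : ℂ)

omit hθ in
theorem mphase_apply (v : Plane) (g : 𝓢(Plane, ℂ)) (x : Plane) :
    mphase θ v g x = (phase θ v x : ℂ) * g x := by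
  have hg : Function.HasTemperateGrowth fun z : Plane => ((phaseR θ v z : ℝ) : ℂ) := by
    have : (fun z : Plane => ((phaseR θ v z : ℝ) : ℂ)) =
        ⇑(Complex.ofRealCLM ∘L phaseR θ v) := rfl
    rw [this]; exact ContinuousLinearMap.hasTemperateGrowth _
  rw [mphase, smulLeftCLM_apply_apply hg]
  rfl

theorem mphase_mul (μ : Fin 2) (f g : 𝓢(Plane, ℂ)) :
    mphase θ (axis μ) (mul θ f g) =
      mul θ f (mphase θ (axis μ) g) + (I / 2) • mul θ (pd μ f) g := by
  ext x
  have e : (fun y => (phase θ (axis μ) y : ℂ) • g y) = ⇑(mphase θ (axis μ) g) := by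
    ext y; rw [mphase_apply]; rfl
  have h := phase_smul_moyal (θ := θ) f (axis μ) (g.memLp 2 volume)
    (by rw [e]; exact SchwartzMap.memLp _ 2 volume) x
  rw [e, sub_eq_iff_eq_add'] at h
  rw [mphase_apply]
  exact h

/-- Expressing `z` through the forms `phase θ (axis μ)` makes the known commutator of these forms
with `L(f)` applicable. -/
theorem zCoord_eq_phase (x : Plane) : zCoord x = ((θ / Real.sqrt 2 : ℝ) : ℂ) *
    ((phase θ (axis 1) x : ℂ) - I * (phase θ (axis 0) x : ℂ)) := by
  have := hθ.out.ne'
  have h : (θ : ℂ) ≠ 0 := by exact_mod_cast this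
  rw [phase_eq hθ.out, phase_eq hθ.out, zCoord]
  simp [axis]
  field_simp
  ring

theorem conj_zCoord_eq_phase (x : Plane) : (starRingEnd ℂ) (zCoord x) =
    ((θ / Real.sqrt 2 : ℝ) : ℂ) *
    ((phase θ (axis 1) x : ℂ) + I * (phase θ (axis 0) x : ℂ)) := by
  rw [zCoord_eq_phase (θ := θ)]
  simp only [map_mul, map_sub, Complex.conj_ofReal, Complex.conj_I]
  ring

theorem mz_eq (g : 𝓢(Plane, ℂ)) : mz g = ((θ / Real.sqrt 2 : ℝ) : ℂ) •
    (mphase θ (axis 1) g - I • mphase θ (axis 0) g) := by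
  ext x
  simp only [mz_apply, smul_apply, sub_apply, mphase_apply, zCoord_eq_phase (θ := θ), smul_eq_mul]
  ring

theorem mzb_eq (g : 𝓢(Plane, ℂ)) : mzb g = ((θ / Real.sqrt 2 : ℝ) : ℂ) •
    (mphase θ (axis 1) g + I • mphase θ (axis 0) g) := by
  ext x
  simp only [mzb_apply, smul_apply, add_apply, mphase_apply, conj_zCoord_eq_phase (θ := θ),
    smul_eq_mul]
  ring

omit hθ in
theorem kap_eq : kap θ = ((θ / Real.sqrt 2 : ℝ) : ℂ) * (1 / 2) := by
  rw [kap]; push_cast; ring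

theorem mz_mul (f g : 𝓢(Plane, ℂ)) :
    mz (mul θ f g) = mul θ f (mz g) + kap θ • mul θ (dp f) g := by
  simp only [mz_eq (θ := θ), mphase_mul, dp_eq, add_mul', mul_sub', smul_mul', mul_smul', kap_eq]
  match_scalars <;> first | ring1 | linear_combination (-(θ / Real.sqrt 2) * (1 / 2) : ℂ) * I_sq

theorem mzb_mul (f g : 𝓢(Plane, ℂ)) :
    mzb (mul θ f g) = mul θ f (mzb g) - kap θ • mul θ (dm f) g := by
  simp only [mzb_eq (θ := θ), mphase_mul, dm_eq, sub_mul', mul_add', smul_mul', mul_smul', kap_eq]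
  match_scalars <;> first | ring1 | linear_combination ((θ / Real.sqrt 2) * (1 / 2) : ℂ) * I_sq

theorem conjugate_pd (μ : Fin 2) (f : 𝓢(Plane, ℂ)) : conjugate (pd μ f) = pd μ (conjugate f) := by
  ext x
  have h : HasFDerivAt (conjugate f : Plane → ℂ)
      ((Complex.conjCLE : ℂ →L[ℝ] ℂ) ∘L fderiv ℝ f x) x :=
    (Complex.conjCLE : ℂ →L[ℝ] ℂ).hasFDerivAt.comp x (f.hasFDerivAt x)
  rw [conjugate_apply, pd, pd, lineDerivOp_apply_eq_fderiv, lineDerivOp_apply_eq_fderiv, h.fderiv]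
  rfl

@[simp] theorem conjugate_sub (a b : 𝓢(Plane, ℂ)) :
    conjugate (a - b) = conjugate a - conjugate b := by ext x; simp

theorem conjugate_dp (f : 𝓢(Plane, ℂ)) : conjugate (dp f) = dm (conjugate f) := by
  rw [dp_eq, dm_eq, conjugate_add, conjugate_smul, conjugate_pd, conjugate_pd, Complex.conj_I,
    neg_smul, sub_eq_add_neg]

theorem conjugate_dm (f : 𝓢(Plane, ℂ)) : conjugate (dm f) = dp (conjugate f) := by
  rw [dp_eq, dm_eq, conjugate_sub, conjugate_smul, conjugate_pd, conjugate_pd, Complex.conj_I,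
    neg_smul, sub_neg_eq_add]

theorem conjugate_mz (f : 𝓢(Plane, ℂ)) : conjugate (mz f) = mzb (conjugate f) := by
  ext x; simp

theorem conjugate_mzb (f : 𝓢(Plane, ℂ)) : conjugate (mzb f) = mz (conjugate f) := by
  ext x; simp

omit hθ in
theorem conj_kap : (starRingEnd ℂ) (kap θ) = kap θ := Complex.conj_ofReal _

theorem mz_mul_left (f g : 𝓢(Plane, ℂ)) :
    mz (mul θ f g) = mul θ (mz f) g - kap θ • mul θ f (dp g) := by
  have h := congrArg conjugate (mzb_mul (θ := θ) (conjugate g) (conjugate f))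
  simpa only [conjugate_mzb, conjugate_mul, conjugate_sub, conjugate_smul, conjugate_conjugate,
    conjugate_dm, conj_kap] using h

theorem mzb_mul_left (f g : 𝓢(Plane, ℂ)) :
    mzb (mul θ f g) = mul θ (mzb f) g + kap θ • mul θ f (dm g) := by
  have h := congrArg conjugate (mz_mul (θ := θ) (conjugate g) (conjugate f))
  simpa only [conjugate_mz, conjugate_mul, conjugate_add, conjugate_smul, conjugate_conjugate,
    conjugate_dp, conj_kap] using h

/-- The correction from moving `z` past `f` is exactly the Leibniz term in which `f` is
differentiated, and the two cancel: right multiplication by `z` commutes with left multiplication by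
`f`. -/
theorem Rz_mul (f g : 𝓢(Plane, ℂ)) : Rz θ (mul θ f g) = mul θ f (Rz θ g) := by
  simp only [Rz_eq, mz_mul, dp_mul, mul_sub', mul_smul', smul_add]; abel

theorem Rzb_mul (f g : 𝓢(Plane, ℂ)) : Rzb θ (mul θ f g) = mul θ f (Rzb θ g) := by
  simp only [Rzb_eq, mzb_mul, dm_mul, mul_add', mul_smul', smul_add]; abel

theorem Lz_mul (f g : 𝓢(Plane, ℂ)) : Lz θ (mul θ f g) = mul θ (Lz θ f) g := by
  simp only [Lz_eq, mz_mul_left, dp_mul, add_mul', smul_mul', smul_add]; abel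

theorem Lzb_mul (f g : 𝓢(Plane, ℂ)) : Lzb θ (mul θ f g) = mul θ (Lzb θ f) g := by
  simp only [Lzb_eq, mzb_mul_left, dm_mul, sub_mul', smul_mul', smul_add]; abel

/-- This is `(f ⋆ z) ⋆ g = f ⋆ (z ⋆ g)`. It follows by equating the two formulas for `z · (f ⋆ g)`,
with the coordinate moved onto `g` and onto `f`. -/
theorem mul_Lz (f g : 𝓢(Plane, ℂ)) : mul θ (Rz θ f) g = mul θ f (Lz θ g) := by
  have h := (mz_mul (θ := θ) f g).symm.trans (mz_mul_left f g)
  simp only [Rz_eq, Lz_eq, sub_mul', mul_add', smul_mul', mul_smul']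
  rw [eq_sub_iff_add_eq] at h
  rw [← h]; abel

theorem mul_Lzb (f g : 𝓢(Plane, ℂ)) : mul θ (Rzb θ f) g = mul θ f (Lzb θ g) := by
  have h := (mzb_mul (θ := θ) f g).symm.trans (mzb_mul_left f g)
  simp only [Rzb_eq, Lzb_eq, add_mul', mul_sub', smul_mul', mul_smul']
  rw [← sub_eq_iff_eq_add] at h
  rw [← h]; abel

theorem symbol_injective {a b : 𝓢(Plane, ℂ)} (h : symbol θ a = symbol θ b) : a = b := by
  ext x
  rw [symbol_inversion (θ := θ) a, h, ← symbol_inversion]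

theorem pd_comm (μ ν : Fin 2) (g : 𝓢(Plane, ℂ)) : pd μ (pd ν g) = pd ν (pd μ g) := by
  -- Any positive parameter would do: the symbol map turns both derivatives into multiplications,
  -- which commute.
  have : Fact ((0 : ℝ) < 1) := ⟨one_pos⟩
  refine symbol_injective (θ := 1) ?_
  ext z
  simp only [pd, symbol_lineDeriv]
  ring

theorem zCoord_axis (μ : Fin 2) : zCoord (axis μ) = ![1, I] μ / (Real.sqrt 2 : ℂ) := by
  fin_cases μ <;> simp [zCoord, axis]

theorem pd_mz (μ : Fin 2) (g : 𝓢(Plane, ℂ)) :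
    pd μ (mz g) = zCoord (axis μ) • g + mz (pd μ g) := by
  obtain ⟨T, hT⟩ := zCoord_eq_clm
  ext x
  have h : HasFDerivAt (mz g : Plane → ℂ) (zCoord x • fderiv ℝ g x + g x • T) x := by
    have e : (mz g : Plane → ℂ) = fun y => T y * g y := by ext y; rw [mz_apply, hT]
    rw [e, hT]
    exact T.hasFDerivAt.mul (g.hasFDerivAt x)
  rw [pd, lineDerivOp_apply_eq_fderiv, h.fderiv, hT]
  simp [hT, pd, lineDerivOp_apply_eq_fderiv]
  ring

theorem pd_mzb (μ : Fin 2) (g : 𝓢(Plane, ℂ)) :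
    pd μ (mzb g) = (starRingEnd ℂ) (zCoord (axis μ)) • g + mzb (pd μ g) := by
  have h := congrArg conjugate (pd_mz μ (conjugate g))
  simpa only [conjugate_pd, conjugate_mz, conjugate_add, conjugate_smul, conjugate_conjugate] using h

theorem sqrt_two_mul_self : (Real.sqrt 2 : ℂ) * (Real.sqrt 2 : ℂ) = 2 := by
  rw [← Complex.ofReal_mul, Real.mul_self_sqrt (by norm_num)]; norm_num

theorem sqrt_two_ne_zero : (Real.sqrt 2 : ℂ) ≠ 0 := by
  exact_mod_cast (Real.sqrt_pos.2 (by norm_num : (0 : ℝ) < 2)).ne'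

theorem dp_mzb (g : 𝓢(Plane, ℂ)) : dp (mzb g) = (Real.sqrt 2 : ℂ) • g + mzb (dp g) := by
  have h := sqrt_two_mul_self
  have h0 := sqrt_two_ne_zero
  rw [dp_eq, dp_eq, pd_mzb, pd_mzb, zCoord_axis, zCoord_axis, map_add, map_smul]
  ext x
  simp
  field_simp
  linear_combination (-g x) * h - g x * I_sq

theorem dm_mz (g : 𝓢(Plane, ℂ)) : dm (mz g) = (Real.sqrt 2 : ℂ) • g + mz (dm g) := by
  have h := congrArg conjugate (dp_mzb (conjugate g))
  simpa only [conjugate_dp, conjugate_mzb, conjugate_add, conjugate_smul, conjugate_conjugate,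
    Complex.conj_ofReal] using h

theorem dp_dm (g : 𝓢(Plane, ℂ)) : dp (dm g) = dm (dp g) := by
  have h : ∀ μ (a b : 𝓢(Plane, ℂ)) (c : ℂ), pd μ (a + c • b) = pd μ a + c • pd μ b := fun μ a b c => by
    change LineDeriv.lineDerivOpCLM ℂ 𝓢(Plane, ℂ) (axis μ) _ = _
    rw [map_add, map_smul]; rfl
  have h' : dm g = pd 0 g + (-I) • pd 1 g := by rw [dm_eq, neg_smul, sub_eq_add_neg]
  rw [dp_eq (dm g), dm_eq (dp g), h', dp_eq, h, h, h, h, pd_comm 1 0]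
  module

omit hθ in
/-- The canonical commutation relation. -/
theorem Lz_Lzb (g : 𝓢(Plane, ℂ)) : Lz θ (Lzb θ g) = Lzb θ (Lz θ g) + (θ : ℂ) • g := by
  have h1 : mz (mzb g) = mzb (mz g) := by ext x; simp; ring
  have hk : kap θ * ((Real.sqrt 2 : ℂ) + (Real.sqrt 2 : ℂ)) = θ := by
    have h := sqrt_two_ne_zero
    rw [kap]; push_cast; field_simp; norm_num
  simp only [Lz_eq, Lzb_eq, map_sub, map_add, map_smul, dp_mzb, dm_mz, dp_dm, h1, ← hk]
  module

/-- `g ⋆ z` is computed by `Rz`. -/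
theorem mulZ_eq (g : 𝓢(Plane, ℂ)) : mulZ θ g = ⇑(Rz θ g) := by
  ext x
  -- Multiplying the symbol by `z` amounts to differentiating `g`; together with `z(x + w) = z(x) +
  -- z(w)` this yields both terms of `Rz`.
  have hsym : ∀ w, zCoord w * symbol θ g w = symbol θ (-(kap θ • dp g)) w := by
    intro w
    rw [map_neg, map_smul, dp_eq, map_add, map_smul]
    simp only [neg_apply, smul_apply, add_apply, pd, symbol_lineDeriv, smul_eq_mul,
      zCoord_eq_phase (θ := θ), kap_eq]
    linear_combination ((θ / Real.sqrt 2 : ℝ) * phase θ (axis 1) w * symbol θ g w : ℂ) * I_sq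
  obtain ⟨T, hT⟩ := zCoord_eq_clm
  have hadd : ∀ w, zCoord (x + w) = zCoord x + zCoord w := fun w => by rw [hT, map_add]
  rw [mulZ, moyal_eq_integral]
  have e : ∀ z, (wave θ x z * symbol θ g z) • zCoord (x + z) =
      zCoord x * (wave θ x z * symbol θ g z) + wave θ x z * symbol θ (-(kap θ • dp g)) z := by
    intro z
    rw [← hsym, hadd, smul_eq_mul]; ring
  simp_rw [e]
  have i1 : ∀ b : 𝓢(Plane, ℂ), Integrable fun z => wave θ x z * symbol θ b z := fun b =>
    memLp_one_iff_integrable.1 (memLp_kernel b x 1)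
  rw [integral_add ((i1 g).const_mul _) (i1 _), integral_const_mul, ← symbol_inversion,
    ← symbol_inversion, Rz_eq, sub_apply, mz_apply, neg_apply, sub_eq_add_neg]

omit hθ in
theorem conjugate_Lzb (g : 𝓢(Plane, ℂ)) : conjugate (Lzb θ g) = Rz θ (conjugate g) := by
  rw [Lzb_eq, Rz_eq, conjugate_sub, conjugate_smul, conjugate_mzb, conjugate_dm, conj_kap]

omit hθ in
theorem conjugate_Lz (g : 𝓢(Plane, ℂ)) : conjugate (Lz θ g) = Rzb θ (conjugate g) := by
  rw [Lz_eq, Rzb_eq, conjugate_add, conjugate_smul, conjugate_mz, conjugate_dp, conj_kap]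

theorem zbarMul_eq (g : 𝓢(Plane, ℂ)) : zbarMul θ g = ⇑(Lzb θ g) := by
  ext x
  have h := congrFun (mulZ_eq (θ := θ) (conjugate g)) x
  rw [← conjugate_Lzb, conjugate_apply] at h
  change (starRingEnd ℂ) (mulZ θ (conjugate g) x) = _
  rw [h, Complex.conj_conj]

end Ladder

/-! ### The ground state and the matrix units -/

/-- The function `f₀₀` as an element of the algebra. -/
def gr (θ : ℝ) [hθ : Fact (0 < θ)] : 𝓢(Plane, ℂ) :=
  (2 : ℂ) • postcompCLM (𝕜 := ℝ) Complex.ofRealCLM (gauss (inv_pos.2 hθ.out))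

theorem gr_apply (x : Plane) : gr θ x = ((2 * Real.exp (-θ⁻¹ * ‖x‖ ^ 2) : ℝ) : ℂ) := by
  change (2 : ℂ) * ((gaussFun θ⁻¹ x : ℝ) : ℂ) = _
  rw [gaussFun, Complex.ofReal_mul, Complex.ofReal_ofNat]

theorem norm_sq_plane (x : Plane) : ‖x‖ ^ 2 = x 0 ^ 2 + x 1 ^ 2 := by
  rw [EuclideanSpace.norm_sq_eq]; simp [Fin.sum_univ_two]

theorem ground_eq : ground θ = ⇑(gr θ) := by
  ext x
  rw [gr_apply, ground, norm_sq_plane]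
  push_cast
  congr 2
  have h := sqrt_two_mul_self
  have h0 := sqrt_two_ne_zero
  have h1 : (θ : ℂ) ≠ 0 := by exact_mod_cast hθ.out.ne'
  simp only [zCoord, map_div₀, map_add, map_mul, Complex.conj_ofReal, Complex.conj_I]
  field_simp
  rw [sq (Real.sqrt 2 : ℂ), h]
  linear_combination (2 * (x 1 : ℂ) ^ 2) * I_sq

theorem conjugate_gr : conjugate (gr θ) = gr θ := by
  ext x
  rw [conjugate_apply, gr_apply, Complex.conj_ofReal]

theorem pd_gr (μ : Fin 2) (x : Plane) :
    pd μ (gr θ) x = -(2 / θ : ℂ) * (x μ : ℂ) * gr θ x := by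
  have h := ((hasFDerivAt_gaussFun θ⁻¹ x).const_mul 2)
  have h2 : HasFDerivAt (gr θ : Plane → ℂ) _ x := (Complex.ofRealCLM.hasFDerivAt.comp x h).congr_of_eventuallyEq
    (Filter.Eventually.of_forall fun y => gr_apply y)
  rw [pd, lineDerivOp_apply_eq_fderiv, h2.fderiv, gr_apply]
  simp [gaussFun, axis, EuclideanSpace.inner_single_right]
  ring

theorem kap_mul : kap θ * (2 / θ) = 1 / (Real.sqrt 2 : ℂ) := by
  have h1 : (θ : ℂ) ≠ 0 := by exact_mod_cast hθ.out.ne'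
  have h0 := sqrt_two_ne_zero
  rw [kap]; push_cast; field_simp

theorem Lz_gr : Lz θ (gr θ) = 0 := by
  ext x
  rw [Lz_eq, dp_eq, add_apply, mz_apply, smul_apply, add_apply, smul_apply, pd_gr, pd_gr, zCoord]
  simp only [smul_eq_mul, zero_apply]
  linear_combination (-((x 0 : ℂ) + I * x 1) * gr θ x) * kap_mul (θ := θ)

theorem Rzb_gr : Rzb θ (gr θ) = 0 := by
  have h := congrArg conjugate (Lz_gr (θ := θ))
  rw [conjugate_Lz, conjugate_gr] at h
  rw [h]; ext x; simp

theorem integral_gr : ∫ x, gr θ x = ((2 * Real.pi * θ : ℝ) : ℂ) := by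
  simp_rw [gr_apply]
  rw [integral_complex_ofReal, integral_const_mul,
    GaussianFourier.integral_rexp_neg_mul_sq_norm (inv_pos.2 hθ.out), finrank_euclideanSpace_fin]
  norm_num
  ring

theorem integral_gr_mul_gr : ∫ x, gr θ x * gr θ x = ((2 * Real.pi * θ : ℝ) : ℂ) := by
  have h : ∀ x, gr θ x * gr θ x = ((4 * Real.exp (-(2 * θ⁻¹) * ‖x‖ ^ 2) : ℝ) : ℂ) := by
    intro x
    rw [gr_apply, ← Complex.ofReal_mul]
    congr 1
    have : Real.exp (-(2 * θ⁻¹) * ‖x‖ ^ 2) = Real.exp (-θ⁻¹ * ‖x‖ ^ 2) * Real.exp (-θ⁻¹ * ‖x‖ ^ 2) := by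
      rw [← Real.exp_add]; congr 1; ring
    rw [this]; ring
  simp_rw [h]
  have := hθ.out
  rw [integral_complex_ofReal, integral_const_mul,
    GaussianFourier.integral_rexp_neg_mul_sq_norm (by positivity), finrank_euclideanSpace_fin]
  norm_num
  field_simp
  norm_num

/-- The ground state is determined by its annihilators. -/
theorem eq_smul_gr {h : 𝓢(Plane, ℂ)} (h1 : Lz θ h = 0) (h2 : Rzb θ h = 0) :
    ∃ c : ℂ, h = c • gr θ := by
  have hs := sqrt_two_ne_zero
  have ht : (θ : ℂ) ≠ 0 := by exact_mod_cast hθ.out.ne'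
  have hk := kap_mul (θ := θ)
  have hpd : ∀ μ x, pd μ h x = -(2 / θ : ℂ) * (x μ : ℂ) * h x := by
    have hk0 : kap θ ≠ 0 := by
      intro h0; rw [h0, zero_mul] at hk
      exact one_div_ne_zero hs hk.symm
    intro μ x
    have e1 := DFunLike.congr_fun h1 x
    have e2 := DFunLike.congr_fun h2 x
    rw [Lz_eq, dp_eq, add_apply, mz_apply, smul_apply, add_apply, smul_apply, zCoord] at e1
    rw [Rzb_eq, dm_eq, add_apply, mzb_apply, smul_apply, sub_apply, smul_apply, zCoord] at e2
    simp only [smul_eq_mul, zero_apply, map_div₀, map_add, map_mul,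
      Complex.conj_ofReal, Complex.conj_I] at e1 e2
    -- The sum and the difference of the two annihilation equations isolate the two partial
    -- derivatives, which have the same form as those of the Gaussian.
    have e3 : kap θ * (2 * pd 0 h x) = kap θ * (2 * (-(2 / θ : ℂ) * (x 0 : ℂ) * h x)) := by
      linear_combination e1 + e2 + 2 * (x 0 : ℂ) * h x * hk
    have e4 : kap θ * (2 * I * pd 1 h x) = kap θ * (2 * I * (-(2 / θ : ℂ) * (x 1 : ℂ) * h x)) := by
      linear_combination e1 - e2 + 2 * I * (x 1 : ℂ) * h x * hk
    fin_cases μ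
    · exact mul_left_cancel₀ two_ne_zero (mul_left_cancel₀ hk0 e3)
    · exact mul_left_cancel₀ (mul_ne_zero two_ne_zero I_ne_zero) (mul_left_cancel₀ hk0 e4)
  -- The inverse Gaussian: `h E` has vanishing differential and is therefore constant.
  set E : Plane → ℂ := fun x => ((gaussFun (-θ⁻¹) x : ℝ) : ℂ) with hE
  have hd : ∀ x, HasFDerivAt (fun y => h y * E y) (0 : Plane →L[ℝ] ℂ) x := by
    intro x
    have hEd : HasFDerivAt E _ x :=
      Complex.ofRealCLM.hasFDerivAt.comp x (hasFDerivAt_gaussFun (-θ⁻¹) x)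
    refine ((h.hasFDerivAt x).mul hEd).congr_fderiv ?_
    ext v
    have hv : fderiv ℝ h x v = ∑ μ, (v μ : ℂ) * pd μ h x := by
      conv_lhs => rw [sum_axis v]
      simp [pd, lineDerivOp_apply_eq_fderiv]
    have hin : (inner ℝ x v : ℝ) = x 0 * v 0 + x 1 * v 1 := by
      simp [PiLp.inner_apply, Fin.sum_univ_two, mul_comm]
    simp [hv, hpd, Fin.sum_univ_two, hin, hE]
    field_simp
    ring
  have hconst : ∀ x, h x * E x = h 0 * E 0 := fun x =>
    is_const_of_fderiv_eq_zero (𝕜 := ℝ) (fun y => (hd y).differentiableAt)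
      (fun y => (hd y).fderiv) x 0
  refine ⟨h 0 / 2, ?_⟩
  ext x
  have hEG : E x * gr θ x = 2 := by
    rw [gr_apply, hE]
    simp only [gaussFun]
    rw [← Complex.ofReal_mul, mul_left_comm, ← Real.exp_add]
    simp
  have hE0 : E 0 = 1 := by simp [hE, gaussFun]
  have := hconst x
  rw [hE0, mul_one] at this
  rw [smul_apply, smul_eq_mul, ← this]
  linear_combination (-(h x) / 2) * hEG

/-- The square is annihilated by the same two operators, so it is a multiple of the ground state;
comparing traces shows that the factor is 1. -/
theorem gr_mul_gr : mul θ (gr θ) (gr θ) = gr θ := by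
  obtain ⟨c, hc⟩ := eq_smul_gr (θ := θ) (h := mul θ (gr θ) (gr θ))
    (by rw [Lz_mul, Lz_gr, ← zero_smul ℂ (0 : 𝓢(Plane, ℂ)), smul_mul', zero_smul, zero_smul])
    (by rw [Rzb_mul, Rzb_gr, ← zero_smul ℂ (0 : 𝓢(Plane, ℂ)), mul_smul', zero_smul, zero_smul])
  have h := integral_mul (θ := θ) (gr θ) (gr θ)
  rw [hc, integral_gr_mul_gr] at h
  simp only [smul_apply, smul_eq_mul] at h
  rw [integral_const_mul, integral_gr] at h
  have hne : ((2 * Real.pi * θ : ℝ) : ℂ) ≠ 0 := by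
    have := hθ.out
    have := Real.pi_pos
    exact_mod_cast (by positivity : (2 * Real.pi * θ) ≠ 0)
  have h1 : c = 1 := mul_right_cancel₀ hne (by rw [h, one_mul])
  rw [hc, h1, one_smul]

/-- The normalization `√(θ (m + 1))` of the ladder operators. -/
def rt (θ : ℝ) (m : ℕ) : ℝ := Real.sqrt (θ * (m + 1))

theorem rt_pos (m : ℕ) : 0 < rt θ m := by
  have := hθ.out
  exact Real.sqrt_pos.2 (by positivity)

theorem rt_ne_zero (m : ℕ) : (rt θ m : ℂ) ≠ 0 := by exact_mod_cast (rt_pos m).ne'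

theorem rt_mul_self (m : ℕ) : (rt θ m : ℂ) * rt θ m = θ * (m + 1) := by
  have := hθ.out
  rw [← Complex.ofReal_mul, rt, Real.mul_self_sqrt (by positivity)]
  push_cast; rfl

/-- The functions `f_{m0}`. -/
def ket (θ : ℝ) [hθ : Fact (0 < θ)] : ℕ → 𝓢(Plane, ℂ)
  | 0 => gr θ
  | m + 1 => (rt θ m : ℂ)⁻¹ • Lzb θ (ket θ m)

/-- The functions `f_{0n}`. -/
def bra (θ : ℝ) [hθ : Fact (0 < θ)] (n : ℕ) : 𝓢(Plane, ℂ) := conjugate (ket θ n)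

theorem ket_zero : ket θ 0 = gr θ := rfl

theorem ket_succ (m : ℕ) : ket θ (m + 1) = (rt θ m : ℂ)⁻¹ • Lzb θ (ket θ m) := rfl

theorem Lzb_ket (m : ℕ) : Lzb θ (ket θ m) = (rt θ m : ℂ) • ket θ (m + 1) := by
  rw [ket_succ, smul_smul, mul_inv_cancel₀ (rt_ne_zero m), one_smul]

theorem Lz_ket_zero : Lz θ (ket θ 0) = 0 := Lz_gr

theorem Lz_ket_succ (m : ℕ) : Lz θ (ket θ (m + 1)) = (rt θ m : ℂ) • ket θ m := by
  induction m with
  | zero =>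
    rw [ket_succ, map_smul, Lz_Lzb, Lz_ket_zero, map_zero, zero_add, smul_smul]
    congr 1
    have := rt_mul_self (θ := θ) 0
    have h0 := rt_ne_zero (θ := θ) 0
    field_simp
    rw [sq, this]; simp
  | succ m ih =>
    rw [ket_succ (m + 1), map_smul, Lz_Lzb, ih, map_smul, Lzb_ket, smul_smul, ← add_smul, smul_smul]
    congr 1
    have h1 := rt_mul_self (θ := θ) m
    have h2 := rt_mul_self (θ := θ) (m + 1)
    have h0 := rt_ne_zero (θ := θ) (m + 1)
    field_simp
    rw [sq, sq, h1, h2]; push_cast; ring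

theorem bra_zero : bra θ 0 = gr θ := conjugate_gr

theorem Rz_bra (n : ℕ) : Rz θ (bra θ n) = (rt θ n : ℂ) • bra θ (n + 1) := by
  rw [bra, ← conjugate_Lzb, Lzb_ket, conjugate_smul, Complex.conj_ofReal, bra]

theorem bra_succ (n : ℕ) : bra θ (n + 1) = (rt θ n : ℂ)⁻¹ • Rz θ (bra θ n) := by
  rw [Rz_bra, smul_smul, inv_mul_cancel₀ (rt_ne_zero n), one_smul]

theorem zero_mul' (f : 𝓢(Plane, ℂ)) : mul θ 0 f = 0 := by
  rw [← zero_smul ℂ (0 : 𝓢(Plane, ℂ)), smul_mul', zero_smul, zero_smul]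

theorem mul_zero' (f : 𝓢(Plane, ℂ)) : mul θ f 0 = 0 := by
  rw [← zero_smul ℂ (0 : 𝓢(Plane, ℂ)), mul_smul', zero_smul, zero_smul]

/-- A ladder operator is moved across the product with `mul_Lz` or `mul_Lzb`, lowering both indices
until one factor is annihilated or both are ground states. -/
theorem bra_mul_ket (n k : ℕ) : mul θ (bra θ n) (ket θ k) = if n = k then gr θ else 0 := by
  induction n generalizing k with
  | zero =>
    cases k with
    | zero => rw [bra_zero, ket_zero, gr_mul_gr, if_pos rfl]
    | succ k =>
      rw [ket_succ, mul_smul', ← mul_Lzb, bra_zero, Rzb_gr, zero_mul', smul_zero,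
        if_neg (by simp)]
  | succ n ih =>
    cases k with
    | zero => rw [bra_succ, smul_mul', mul_Lz, Lz_ket_zero, mul_zero', smul_zero, if_neg (by simp)]
    | succ k =>
      rw [bra_succ, smul_mul', mul_Lz, Lz_ket_succ, mul_smul', ih, smul_smul]
      by_cases h : n = k
      · subst h
        rw [if_pos rfl, if_pos rfl, inv_mul_cancel₀ (rt_ne_zero n), one_smul]
      · rw [if_neg h, if_neg (by simpa using h), smul_zero]

theorem ket_mul_gr (m : ℕ) : mul θ (ket θ m) (gr θ) = ket θ m := by
  induction m with
  | zero => exact gr_mul_gr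
  | succ m ih => rw [ket_succ, smul_mul', ← Lzb_mul, ih]

/-- The matrix units `f_{mn}`. -/
def unit (θ : ℝ) [hθ : Fact (0 < θ)] (m n : ℕ) : 𝓢(Plane, ℂ) := mul θ (ket θ m) (bra θ n)

theorem unit_mul_unit (m n k l : ℕ) :
    mul θ (unit θ m n) (unit θ k l) = if n = k then unit θ m l else 0 := by
  rw [unit, unit, mul_assoc', ← mul_assoc' (bra θ n), bra_mul_ket]
  by_cases h : n = k
  · rw [if_pos h, if_pos h, ← mul_assoc', ket_mul_gr]; rfl
  · rw [if_neg h, if_neg h, zero_mul', mul_zero']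

theorem conjugate_unit (m n : ℕ) : conjugate (unit θ m n) = unit θ n m := by
  rw [unit, conjugate_mul, bra, conjugate_conjugate]; rfl

theorem integral_mul_comm (f g : 𝓢(Plane, ℂ)) : ∫ x, mul θ f g x = ∫ x, mul θ g f x := by
  rw [integral_mul, integral_mul]; simp_rw [mul_comm]

theorem integral_unit (m n : ℕ) :
    ∫ x, unit θ m n x = if m = n then ((2 * Real.pi * θ : ℝ) : ℂ) else 0 := by
  rw [unit, integral_mul_comm, bra_mul_ket]
  by_cases h : m = n
  · rw [if_pos h, if_pos h.symm, integral_gr]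
  · rw [if_neg h, if_neg (Ne.symm h)]; simp

theorem Lz_unit_zero (n : ℕ) : Lz θ (unit θ 0 n) = 0 := by
  rw [unit, Lz_mul, Lz_ket_zero, zero_mul']

theorem Lz_unit_succ (m n : ℕ) : Lz θ (unit θ (m + 1) n) = (rt θ m : ℂ) • unit θ m n := by
  rw [unit, Lz_mul, Lz_ket_succ, smul_mul']; rfl

theorem Rz_unit (m n : ℕ) : Rz θ (unit θ m n) = (rt θ n : ℂ) • unit θ m (n + 1) := by
  rw [unit, Rz_mul, Rz_bra, mul_smul']; rfl

/-! ### Identification with the basis `f_{mn}` and its coefficients -/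

theorem iterate_mulZ (n : ℕ) : (mulZ θ)^[n] (ground θ) = ⇑((Rz θ)^[n] (gr θ)) := by
  induction n with
  | zero => exact ground_eq
  | succ n ih => rw [Function.iterate_succ_apply', Function.iterate_succ_apply', ih, mulZ_eq]

theorem iterate_zbarMul (m : ℕ) (g : 𝓢(Plane, ℂ)) :
    (zbarMul θ)^[m] g = ⇑((Lzb θ)^[m] g) := by
  induction m with
  | zero => rfl
  | succ m ih => rw [Function.iterate_succ_apply', Function.iterate_succ_apply', ih, zbarMul_eq]

/-- The normalization `√(θ^m m!)`. -/
def nrm (θ : ℝ) (m : ℕ) : ℝ := Real.sqrt (θ ^ m * m.factorial)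

theorem nrm_succ (m : ℕ) : nrm θ (m + 1) = rt θ m * nrm θ m := by
  have := hθ.out
  rw [nrm, nrm, rt, ← Real.sqrt_mul (by positivity), Nat.factorial_succ]
  congr 1
  push_cast
  ring

theorem iterate_Lzb (m : ℕ) : (Lzb θ)^[m] (gr θ) = (nrm θ m : ℂ) • ket θ m := by
  induction m with
  | zero => simp [nrm, ket_zero]
  | succ m ih =>
    rw [Function.iterate_succ_apply', ih, map_smul, Lzb_ket, smul_smul, nrm_succ]
    congr 1
    push_cast; ring

theorem iterate_Rz (n : ℕ) : (Rz θ)^[n] (gr θ) = (nrm θ n : ℂ) • bra θ n := by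
  induction n with
  | zero => simp [nrm, bra_zero]
  | succ n ih =>
    rw [Function.iterate_succ_apply', ih, map_smul, Rz_bra, smul_smul, nrm_succ]
    congr 1
    push_cast; ring

theorem iterate_Lzb_bra (m n : ℕ) : (Lzb θ)^[m] (bra θ n) = (nrm θ m : ℂ) • unit θ m n := by
  have h1 : mul θ (gr θ) (bra θ n) = bra θ n := by
    have := congrArg conjugate (ket_mul_gr (θ := θ) n)
    rwa [conjugate_mul, conjugate_gr] at this
  have h2 : (Lzb θ)^[m] (bra θ n) = mul θ ((Lzb θ)^[m] (gr θ)) (bra θ n) := by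
    induction m with
    | zero => exact h1.symm
    | succ m ih => rw [Function.iterate_succ_apply', ih, Function.iterate_succ_apply', Lzb_mul]
  rw [h2, iterate_Lzb, smul_mul']; rfl

/-- The prescribed normalization factor is the product of the norms accumulated by the two iterated
ladder operators. -/
theorem basisFun_eq (m n : ℕ) : basisFun θ m n = ⇑(unit θ m n) := by
  have hpos := hθ.out
  have h : (Lzb θ)^[m] ((Rz θ)^[n] (gr θ)) = ((nrm θ n : ℂ) * nrm θ m) • unit θ m n := by
    rw [iterate_Rz, ← smul_smul, ← iterate_Lzb_bra]
    have hs : ∀ (m : ℕ) (c : ℂ) (g : 𝓢(Plane, ℂ)), (Lzb θ)^[m] (c • g) = c • (Lzb θ)^[m] g := by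
      intro m c g
      induction m with
      | zero => rfl
      | succ m ih => rw [Function.iterate_succ_apply', ih, map_smul, Function.iterate_succ_apply']
    exact hs m _ _
  ext x
  rw [basisFun, iterate_mulZ, iterate_zbarMul, h, smul_apply, smul_eq_mul, ← mul_assoc]
  have e : Real.sqrt (θ ^ (m + n) * m.factorial * n.factorial) = nrm θ n * nrm θ m := by
    rw [nrm, nrm, ← Real.sqrt_mul (by positivity)]
    congr 1; ring
  have hne : nrm θ n * nrm θ m ≠ 0 := by
    have : 0 < nrm θ n * nrm θ m := by rw [← e]; exact Real.sqrt_pos.2 (by positivity)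
    exact this.ne'
  rw [e, ← Complex.ofReal_mul, ← Complex.ofReal_mul, one_div, inv_mul_cancel₀ hne]
  simp

theorem tpt_ne_zero : ((2 * Real.pi * θ : ℝ) : ℂ) ≠ 0 := by
  have := hθ.out
  have := Real.pi_pos
  exact_mod_cast (by positivity : (2 * Real.pi * θ) ≠ 0)

theorem coeff_eq (a : 𝓢(Plane, ℂ)) (m n : ℕ) :
    ((2 * Real.pi * θ : ℝ) : ℂ) * coeff θ a m n = ∫ x, (starRingEnd ℂ) (unit θ m n x) * a x := by
  rw [coeff, ← mul_assoc, ← Complex.ofReal_mul, mul_one_div_cancel, basisFun_eq]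
  · simp
  · exact_mod_cast tpt_ne_zero (θ := θ)

theorem coeff_unit (k l m n : ℕ) : coeff θ (unit θ k l) m n = if m = k ∧ n = l then 1 else 0 := by
  have h : ((2 * Real.pi * θ : ℝ) : ℂ) * coeff θ (unit θ k l) m n =
      ((2 * Real.pi * θ : ℝ) : ℂ) * if m = k ∧ n = l then 1 else 0 := by
    rw [coeff_eq]
    simp_rw [← conjugate_apply, conjugate_unit]
    rw [← integral_mul (θ := θ), unit_mul_unit]
    by_cases h : m = k
    · rw [if_pos h, integral_unit]
      simp [h]
    · simp [h]
  exact mul_left_cancel₀ tpt_ne_zero h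

/-- Cyclicity of the trace turns the pairing with `f_{mn}` into a matrix element of `L(a)` between
the functions `f_{m0}` and `f_{n0}`. -/
theorem inner_ket_mul_ket (a : 𝓢(Plane, ℂ)) (m n : ℕ) :
    inner ℂ ((ket θ m).toLp 2 : Hilb) ((mul θ a (ket θ n)).toLp 2) =
      ((2 * Real.pi * θ : ℝ) : ℂ) * coeff θ a m n := by
  rw [inner_toLp, coeff_eq]
  simp_rw [← conjugate_apply, conjugate_unit]
  rw [← integral_mul (θ := θ), ← integral_mul (θ := θ), integral_mul_comm, mul_assoc',
    integral_mul_comm (unit θ n m)]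
  rfl

theorem inner_unit (m n k l : ℕ) :
    inner ℂ ((unit θ m n).toLp 2 : Hilb) ((unit θ k l).toLp 2) =
      if m = k ∧ n = l then ((2 * Real.pi * θ : ℝ) : ℂ) else 0 := by
  rw [inner_toLp, ← coeff_eq, coeff_unit]
  simp

theorem inner_ket (m n : ℕ) :
    inner ℂ ((ket θ m).toLp 2 : Hilb) ((ket θ n).toLp 2) =
      if m = n then ((2 * Real.pi * θ : ℝ) : ℂ) else 0 := by
  rw [inner_toLp]
  simp_rw [← conjugate_apply]
  rw [← integral_mul (θ := θ)]
  change ∫ x, mul θ (bra θ m) (ket θ n) x = _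
  rw [bra_mul_ket]
  by_cases h : m = n
  · rw [if_pos h, if_pos h, integral_gr]
  · simp [h]

/-! ### Zeta weights and the vector states -/

/-- The probability weights `2πθ ψ_m(s)² = 1 / (ζ(s) (m + 1)^s)`. -/
def weight (s : ℝ) (m : ℕ) : ℝ := 1 / ((riemannZeta (s : ℂ)).re * ((m : ℝ) + 1) ^ s)

theorem summable_weight_aux {s : ℝ} (hs : 1 < s) :
    Summable fun m : ℕ => 1 / ((m : ℝ) + 1) ^ s := by
  have h := (summable_nat_add_iff 1).2 (Real.summable_one_div_nat_rpow.2 hs)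
  simpa using h

theorem zeta_re {s : ℝ} (hs : 1 < s) :
    (riemannZeta (s : ℂ)).re = ∑' m : ℕ, 1 / ((m : ℝ) + 1) ^ s := by
  rw [zeta_eq_tsum_one_div_nat_add_one_cpow (by simpa using hs)]
  have h : ∀ m : ℕ, 1 / ((m : ℂ) + 1) ^ (s : ℂ) = ((1 / ((m : ℝ) + 1) ^ s : ℝ) : ℂ) := by
    intro m
    rw [Complex.ofReal_div, Complex.ofReal_cpow (by positivity)]
    push_cast; rfl
  simp_rw [h]
  rw [← Complex.ofReal_tsum, Complex.ofReal_re]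

theorem zeta_re_pos {s : ℝ} (hs : 1 < s) : 0 < (riemannZeta (s : ℂ)).re := by
  rw [zeta_re hs]
  exact (summable_weight_aux hs).tsum_pos (fun m => by positivity) 0 (by simp)

theorem weight_pos {s : ℝ} (hs : 1 < s) (m : ℕ) : 0 < weight s m := by
  have := zeta_re_pos hs
  unfold weight; positivity

theorem hasSum_weight {s : ℝ} (hs : 1 < s) : HasSum (weight s) 1 := by
  have h := (summable_weight_aux hs).hasSum.mul_left (riemannZeta (s : ℂ)).re⁻¹
  rw [← zeta_re hs, inv_mul_cancel₀ (zeta_re_pos hs).ne'] at h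
  have e : weight s = fun m : ℕ => (riemannZeta (s : ℂ)).re⁻¹ * (1 / ((m : ℝ) + 1) ^ s) := by
    ext m
    rw [weight, one_div, one_div, mul_inv]
  rwa [e]

theorem tpt_mul_psi (s : ℝ) (m n : ℕ) :
    2 * Real.pi * θ * (psi θ s m * psi θ s n) = Real.sqrt (weight s m) * Real.sqrt (weight s n) := by
  have := hθ.out
  have := Real.pi_pos
  have h : Real.sqrt (2 * Real.pi * θ) ^ 2 = 2 * Real.pi * θ := Real.sq_sqrt (by positivity)
  have h0 : Real.sqrt (2 * Real.pi * θ) ≠ 0 := (Real.sqrt_pos.2 (by positivity)).ne'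
  unfold psi weight
  generalize Real.sqrt (1 / ((riemannZeta (s : ℂ)).re * ((m : ℝ) + 1) ^ s)) = p
  generalize Real.sqrt (1 / ((riemannZeta (s : ℂ)).re * ((n : ℝ) + 1) ^ s)) = q
  have h1 : Real.sqrt (2 * Real.pi * θ) * (1 / Real.sqrt (2 * Real.pi * θ)) = 1 :=
    mul_one_div_cancel h0
  generalize 1 / Real.sqrt (2 * Real.pi * θ) = c at h1 ⊢
  generalize Real.sqrt (2 * Real.pi * θ) = d at h h1
  linear_combination (-c * c * p * q) * h + (d * c + 1) * p * q * h1

/-- The normalization factor `(2πθ)^{-1/2}`. -/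
def rtpi (θ : ℝ) : ℂ := ((Real.sqrt (2 * Real.pi * θ))⁻¹ : ℝ)

omit hθ in
theorem conj_rtpi : (starRingEnd ℂ) (rtpi θ) = rtpi θ := Complex.conj_ofReal _

theorem rtpi_mul : rtpi θ * (rtpi θ * ((2 * Real.pi * θ : ℝ) : ℂ)) = 1 := by
  have := hθ.out
  have := Real.pi_pos
  have h : Real.sqrt (2 * Real.pi * θ) ^ 2 = 2 * Real.pi * θ := Real.sq_sqrt (by positivity)
  have h0 : Real.sqrt (2 * Real.pi * θ) ≠ 0 := (Real.sqrt_pos.2 (by positivity)).ne'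
  rw [rtpi, ← Complex.ofReal_mul, ← Complex.ofReal_mul, ← Complex.ofReal_one]
  congr 1
  conv_lhs => rw [← h]
  rw [Real.sqrt_sq (Real.sqrt_nonneg _)]
  field_simp

/-- The orthonormal family proportional to the functions `f_{m0}`. -/
def nket (θ : ℝ) [hθ : Fact (0 < θ)] (m : ℕ) : Hilb := rtpi θ • ((ket θ m).toLp 2 : Hilb)

theorem orthonormal_nket : Orthonormal ℂ (nket θ) := by
  rw [orthonormal_iff_ite]
  intro m n
  rw [nket, nket, inner_smul_left, inner_smul_right, conj_rtpi, inner_ket]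
  split_ifs
  · exact rtpi_mul
  · simp

theorem orthonormal_unit :
    Orthonormal ℂ fun p : ℕ × ℕ => rtpi θ • ((unit θ p.1 p.2).toLp 2 : Hilb) := by
  rw [orthonormal_iff_ite]
  rintro ⟨m, n⟩ ⟨k, l⟩
  simp only [inner_smul_left, inner_smul_right, conj_rtpi, inner_unit, Prod.mk.injEq]
  split_ifs
  · exact rtpi_mul
  · simp

theorem inner_nket (a : 𝓢(Plane, ℂ)) (m n : ℕ) :
    inner ℂ (nket θ m) (leftRep θ a (nket θ n)) = coeff θ a m n := by
  rw [nket, nket, map_smul, leftRep_toLp, inner_smul_left, inner_smul_right, conj_rtpi,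
    inner_ket_mul_ket]
  linear_combination coeff θ a m n * rtpi_mul (θ := θ)

/-- Bessel's inequality for the orthonormal family of normalized matrix units in `L²`. -/
theorem summable_coeff_sq (a : 𝓢(Plane, ℂ)) :
    Summable fun p : ℕ × ℕ => ‖coeff θ a p.1 p.2‖ ^ 2 := by
  have hpos : 0 < 2 * Real.pi * θ := by
    have := hθ.out
    have := Real.pi_pos
    positivity
  have h : Summable fun p : ℕ × ℕ =>
      ‖inner ℂ (rtpi θ • ((unit θ p.1 p.2).toLp 2 : Hilb)) (a.toLp 2 : Hilb)‖ ^ 2 :=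
    (orthonormal_unit (θ := θ)).inner_products_summable _
  refine (h.mul_left (2 * Real.pi * θ)⁻¹).congr fun p => ?_
  rw [inner_smul_left, conj_rtpi, inner_toLp, ← coeff_eq, norm_mul, norm_mul, mul_pow, mul_pow]
  have h1 := congrArg norm (rtpi_mul (θ := θ))
  have h2 : ‖((2 * Real.pi * θ : ℝ) : ℂ)‖ = 2 * Real.pi * θ := by
    rw [Complex.norm_real, Real.norm_of_nonneg hpos.le]
  rw [norm_mul, norm_mul, norm_one, h2] at h1
  rw [h2]
  have h3 : ‖rtpi θ‖ ^ 2 * (2 * Real.pi * θ) = 1 := by linear_combination h1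
  have h4 := inv_mul_cancel₀ hpos.ne'
  linear_combination ((2 * Real.pi * θ)⁻¹ * (2 * Real.pi * θ) * ‖coeff θ a p.1 p.2‖ ^ 2) * h3 +
    ‖coeff θ a p.1 p.2‖ ^ 2 * h4

theorem summable_psiVec {s : ℝ} (hs : 1 < s) :
    Summable fun m => (Real.sqrt (weight s m) : ℂ) • nket θ m := by
  have h := ((orthonormal_nket (θ := θ)).orthogonalFamily.summable_iff_norm_sq_summable
    (fun m => (Real.sqrt (weight s m) : ℂ))).2 (by
      refine (hasSum_weight hs).summable.congr fun m => ?_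
      rw [Complex.norm_real, Real.norm_of_nonneg (Real.sqrt_nonneg _),
        Real.sq_sqrt (weight_pos hs m).le])
  simpa using h

/-- The unit vector which implements the state `ω_{ψ(s)}`. -/
def psiVec (θ : ℝ) [hθ : Fact (0 < θ)] (s : ℝ) : Hilb :=
  ∑' m, (Real.sqrt (weight s m) : ℂ) • nket θ m

theorem hasSum_inner_left {s : ℝ} (hs : 1 < s) (v : Hilb) :
    HasSum (fun m => (Real.sqrt (weight s m) : ℂ) * inner ℂ (nket θ m) v)
      (inner ℂ (psiVec θ s) v) := by
  have h := ((innerSL ℂ v).hasSum (summable_psiVec (θ := θ) hs).hasSum).star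
  simp only [innerSL_apply_apply, inner_smul_right, star_mul', RCLike.star_def,
    Complex.conj_ofReal, inner_conj_symm] at h
  exact h

theorem hasSum_inner_right {s : ℝ} (hs : 1 < s) (v : Hilb) (A : Hilb →L[ℂ] Hilb) :
    HasSum (fun m => (Real.sqrt (weight s m) : ℂ) * inner ℂ v (A (nket θ m)))
      (inner ℂ v (A (psiVec θ s))) := by
  have h := ((innerSL ℂ v) ∘L A).hasSum (summable_psiVec (θ := θ) hs).hasSum
  simp only [ContinuousLinearMap.comp_apply, innerSL_apply_apply, map_smul] at h
  exact h

theorem inner_self_eq_norm_sq' (x : Hilb) : inner ℂ x x = ((‖x‖ ^ 2 : ℝ) : ℂ) := by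
  rw [inner_self_eq_norm_sq_to_K]; push_cast; rfl

theorem norm_psiVec {s : ℝ} (hs : 1 < s) : ‖psiVec θ s‖ = 1 := by
  have h1 := hasSum_inner_left (θ := θ) hs (psiVec θ s)
  have h2 : ∀ m, inner ℂ (nket θ m) (psiVec θ s) = (Real.sqrt (weight s m) : ℂ) := by
    intro m
    have h := hasSum_inner_right (θ := θ) hs (nket θ m) (ContinuousLinearMap.id ℂ Hilb)
    refine h.unique ?_
    simp_rw [ContinuousLinearMap.id_apply, orthonormal_iff_ite.1 (orthonormal_nket (θ := θ)) m]
    convert hasSum_ite_eq m (Real.sqrt (weight s m) : ℂ) using 2 with n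
    by_cases h : m = n
    · simp [h]
    · simp [h, Ne.symm h]
  simp_rw [h2, ← Complex.ofReal_mul, Real.mul_self_sqrt (weight_pos hs _).le] at h1
  have h3 := h1.unique (Complex.hasSum_ofReal.2 (hasSum_weight hs))
  rw [inner_self_eq_norm_sq'] at h3
  have h4 : ‖psiVec θ s‖ ^ 2 = 1 := Complex.ofReal_injective h3
  exact (pow_eq_one_iff_of_nonneg (norm_nonneg _) two_ne_zero).1 h4

/-- The terms are dominated by `w_m w_n + |a_{mn}|²`, which is summable, so the double sum may be
evaluated row by row; each row is a matrix element of `L(a)` at the vector `psiVec`. -/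
theorem hasSum_psi {s : ℝ} (hs : 1 < s) (a : 𝓢(Plane, ℂ)) :
    HasSum (fun p : ℕ × ℕ => ((2 * Real.pi * θ : ℝ) : ℂ) *
      ((psi θ s p.1 : ℂ) * (psi θ s p.2 : ℂ) * coeff θ a p.1 p.2))
      (inner ℂ (psiVec θ s) (leftRep θ a (psiVec θ s))) := by
  have e : ∀ p : ℕ × ℕ, ((2 * Real.pi * θ : ℝ) : ℂ) *
      ((psi θ s p.1 : ℂ) * (psi θ s p.2 : ℂ) * coeff θ a p.1 p.2) =
      (Real.sqrt (weight s p.1) : ℂ) * ((Real.sqrt (weight s p.2) : ℂ) * coeff θ a p.1 p.2) := by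
    intro p
    have := congrArg (fun r : ℝ => (r : ℂ)) (tpt_mul_psi (θ := θ) s p.1 p.2)
    push_cast at this ⊢
    linear_combination coeff θ a p.1 p.2 * this
  simp_rw [e]
  have hw := hasSum_weight hs
  have hsum : Summable fun p : ℕ × ℕ =>
      (Real.sqrt (weight s p.1) : ℂ) * ((Real.sqrt (weight s p.2) : ℂ) * coeff θ a p.1 p.2) := by
    have h1 : Summable fun p : ℕ × ℕ => weight s p.1 * weight s p.2 :=
      hw.summable.mul_of_nonneg hw.summable (fun m => (weight_pos hs m).le)
        (fun m => (weight_pos hs m).le)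
    refine Summable.of_norm_bounded (h1.add (summable_coeff_sq (θ := θ) a)) fun p => ?_
    rw [norm_mul, norm_mul, Complex.norm_real, Complex.norm_real,
      Real.norm_of_nonneg (Real.sqrt_nonneg _), Real.norm_of_nonneg (Real.sqrt_nonneg _)]
    have h2 := Real.sq_sqrt (weight_pos hs p.1).le
    have h3 := Real.sq_sqrt (weight_pos hs p.2).le
    have h4 := two_mul_le_add_sq (Real.sqrt (weight s p.1) * Real.sqrt (weight s p.2))
      ‖coeff θ a p.1 p.2‖
    rw [mul_pow, h2, h3] at h4
    have h5 : 0 ≤ Real.sqrt (weight s p.1) * Real.sqrt (weight s p.2) * ‖coeff θ a p.1 p.2‖ := by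
      positivity
    linarith
  have h1 := hsum.hasSum.prod_fiberwise (g := fun m => (Real.sqrt (weight s m) : ℂ) *
    inner ℂ (nket θ m) (leftRep θ a (psiVec θ s))) fun m => by
      refine HasSum.mul_left _ ?_
      simp_rw [← inner_nket]
      exact hasSum_inner_right hs _ _
  rw [← h1.unique (hasSum_inner_left hs _)]
  exact hsum.hasSum

/-! ### Operator norms of generalized diagonals -/

/-- The operators of the matrix units. -/
def opUnit (θ : ℝ) [hθ : Fact (0 < θ)] (m n : ℕ) : Hilb →L[ℂ] Hilb := leftRep θ (unit θ m n)

theorem inner_opUnit (m n k l : ℕ) (x y : Hilb) :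
    inner ℂ (opUnit θ m n x) (opUnit θ k l y) =
      if m = k then inner ℂ x (opUnit θ n l y) else 0 := by
  rw [← ContinuousLinearMap.adjoint_inner_right, ← ContinuousLinearMap.star_eq_adjoint, opUnit,
    opUnit, ← leftRep_conjugate, conjugate_unit, ← mul_apply_eq_comp, ← leftRep_mul, unit_mul_unit]
  split_ifs
  · rfl
  · simp

/-- Matrix units with different first indices have orthogonal ranges, so Pythagoras applies, and
`f_{mn} x` has the same norm as `f_{nn} x`. -/
theorem norm_sq_sum_opUnit (β : ℕ → ℂ) (σ : ℕ → ℕ) (N : ℕ) (x : Hilb) :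
    ‖∑ m ∈ Finset.range N, β m • opUnit θ m (σ m) x‖ ^ 2 =
      ∑ m ∈ Finset.range N, ‖β m‖ ^ 2 * ‖opUnit θ (σ m) (σ m) x‖ ^ 2 := by
  have h : inner ℂ (∑ m ∈ Finset.range N, β m • opUnit θ m (σ m) x)
      (∑ m ∈ Finset.range N, β m • opUnit θ m (σ m) x) =
      ∑ m ∈ Finset.range N, ((‖β m‖ ^ 2 * ‖opUnit θ (σ m) (σ m) x‖ ^ 2 : ℝ) : ℂ) := by
    rw [sum_inner]
    refine Finset.sum_congr rfl fun m hm => ?_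
    rw [inner_sum]
    simp_rw [inner_smul_left, inner_smul_right, inner_opUnit]
    rw [Finset.sum_eq_single m (fun k _ hk => by rw [if_neg (Ne.symm hk)]; simp)
      (fun h => absurd hm h), if_pos rfl, ← mul_assoc, ← Complex.normSq_eq_conj_mul_self]
    have e := inner_opUnit (θ := θ) (σ m) (σ m) (σ m) (σ m) x x
    rw [if_pos rfl, inner_self_eq_norm_sq'] at e
    rw [← e, Complex.normSq_eq_norm_sq]
    push_cast; rfl
  rw [inner_self_eq_norm_sq', ← Complex.ofReal_sum] at h
  exact Complex.ofReal_injective h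

/-- An operator with one entry in each row and at most one in each column is bounded by its largest
entry. It is needed for `σ = id` and for the shift `σ = succ`. -/
theorem norm_sum_unit_le {β : ℕ → ℂ} {B : ℝ} (hB : 0 ≤ B) {σ : ℕ → ℕ} (hσ : σ.Injective) (N : ℕ)
    (hβ : ∀ m < N, ‖β m‖ ≤ B) :
    ‖leftRep θ (∑ m ∈ Finset.range N, β m • unit θ m (σ m))‖ ≤ B := by
  refine ContinuousLinearMap.opNorm_le_bound _ hB fun x => ?_
  have e : leftRep θ (∑ m ∈ Finset.range N, β m • unit θ m (σ m)) x =
      ∑ m ∈ Finset.range N, β m • opUnit θ m (σ m) x := by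
    rw [map_sum, sum_apply]
    simp_rw [map_smul]; rfl
  rw [e]
  have h1 := norm_sq_sum_opUnit (θ := θ) β σ N x
  -- Bessel's inequality: injectivity of `σ` makes the projections orthogonal, so their sum `q`
  -- satisfies `S = ‖q‖² = ⟨x, q⟩ ≤ ‖x‖ ‖q‖`.
  have hQ : ∑ m ∈ Finset.range N, ‖opUnit θ (σ m) (σ m) x‖ ^ 2 ≤ ‖x‖ ^ 2 := by
    set q : Hilb := ∑ m ∈ Finset.range N, opUnit θ (σ m) (σ m) x with hq
    have hd : ∀ m, inner ℂ x (opUnit θ (σ m) (σ m) x) = ((‖opUnit θ (σ m) (σ m) x‖ ^ 2 : ℝ) : ℂ) := by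
      intro m
      have e := inner_opUnit (θ := θ) (σ m) (σ m) (σ m) (σ m) x x
      rw [if_pos rfl, inner_self_eq_norm_sq'] at e
      exact e.symm
    have h2 : inner ℂ x q = ((∑ m ∈ Finset.range N, ‖opUnit θ (σ m) (σ m) x‖ ^ 2 : ℝ) : ℂ) := by
      rw [hq, inner_sum, Complex.ofReal_sum]
      exact Finset.sum_congr rfl fun m _ => hd m
    have h3 : inner ℂ q q = ((∑ m ∈ Finset.range N, ‖opUnit θ (σ m) (σ m) x‖ ^ 2 : ℝ) : ℂ) := by
      rw [Complex.ofReal_sum]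
      nth_rewrite 1 [hq]
      rw [sum_inner]
      refine Finset.sum_congr rfl fun m hm => ?_
      rw [hq, inner_sum]
      simp_rw [inner_opUnit, hσ.eq_iff]
      rw [Finset.sum_ite_eq, if_pos hm, hd]
    set S := ∑ m ∈ Finset.range N, ‖opUnit θ (σ m) (σ m) x‖ ^ 2
    have h4 : ‖q‖ ^ 2 = S := by
      rw [inner_self_eq_norm_sq'] at h3; exact Complex.ofReal_injective h3
    have h5 : S ≤ ‖x‖ * ‖q‖ := by
      have := norm_inner_le_norm (𝕜 := ℂ) x q
      rw [h2, Complex.norm_real] at this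
      exact (le_abs_self S).trans this
    nlinarith [sq_nonneg (‖x‖ - ‖q‖)]
  refine abs_le_of_sq_le_sq' ?_ (by positivity) |>.2
  rw [h1, mul_pow]
  calc ∑ m ∈ Finset.range N, ‖β m‖ ^ 2 * ‖opUnit θ (σ m) (σ m) x‖ ^ 2
      ≤ ∑ m ∈ Finset.range N, B ^ 2 * ‖opUnit θ (σ m) (σ m) x‖ ^ 2 := by
        refine Finset.sum_le_sum fun m hm => ?_
        have := hβ m (Finset.mem_range.1 hm)
        gcongr
    _ ≤ _ := by rw [← Finset.mul_sum]; gcongr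

theorem inner_psiVec_diagonal {s : ℝ} (hs : 1 < s) (α : ℕ → ℂ) (N : ℕ) :
    inner ℂ (psiVec θ s) (leftRep θ (∑ m ∈ Finset.range N, α m • unit θ m m) (psiVec θ s)) =
      ∑ m ∈ Finset.range N, (weight s m : ℂ) * α m := by
  rw [map_sum, sum_apply, inner_sum]
  refine Finset.sum_congr rfl fun m _ => ?_
  rw [map_smul, smul_apply, inner_smul_right, mul_comm]
  congr 1
  refine (hasSum_psi hs (unit θ m m)).unique ?_
  simp_rw [coeff_unit]
  convert hasSum_ite_eq (m, m) (weight s m : ℂ) using 2 with p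
  obtain ⟨k, l⟩ := p
  by_cases h : k = m ∧ l = m
  · obtain ⟨rfl, rfl⟩ := h
    simp only [and_self, if_true, mul_one]
    rw [← Complex.ofReal_mul, ← Complex.ofReal_mul, tpt_mul_psi,
      Real.mul_self_sqrt (weight_pos hs _).le]
  · rw [if_neg h, if_neg (by simpa using h)]; simp

open scoped ComplexOrder in
/-- The state `ω_{ψ(s)}`. -/
def psiState (θ : ℝ) [hθ : Fact (0 < θ)] {s : ℝ} (hs : 1 < s) : State θ where
  toLin :=
    { toFun := fun a => inner ℂ (psiVec θ s) (leftRep θ a (psiVec θ s))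
      map_add' := fun a b => by rw [map_add, add_apply, inner_add_right]
      map_smul' := fun c a => by rw [map_smul, smul_apply, inner_smul_right]; rfl }
  positive a := by
    change 0 ≤ inner ℂ (psiVec θ s) (leftRep θ (mul θ (conjugate a) a) (psiVec θ s))
    rw [leftRep_mul, leftRep_conjugate, ContinuousLinearMap.star_eq_adjoint, mul_apply_eq_comp,
      ContinuousLinearMap.adjoint_inner_right]
    rw [inner_self_eq_norm_sq', Complex.zero_le_real]
    positivity
  norm_one := by
    constructor
    · rintro _ ⟨a, ha, rfl⟩
      rw [cstarNorm_le_one_iff] at ha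
      change ‖inner ℂ (psiVec θ s) (leftRep θ a (psiVec θ s))‖ ≤ 1
      refine (norm_inner_le_norm _ _).trans ?_
      have := (leftRep θ a).le_opNorm (psiVec θ s)
      rw [norm_psiVec hs, mul_one] at this
      rw [norm_psiVec hs, one_mul]
      exact this.trans ha
    · intro b hb
      -- The projections onto the first `N` levels have norm at most 1, and their values, the
      -- partial sums of the weights, tend to 1.
      refine le_of_tendsto (hasSum_weight hs).tendsto_sum_nat (Filter.Eventually.of_forall
        fun N => hb ⟨∑ m ∈ Finset.range N, (1 : ℂ) • unit θ m m, ?_, ?_⟩)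
      · rw [cstarNorm_le_one_iff]
        exact norm_sum_unit_le zero_le_one Function.injective_id N (by simp)
      · change _ = ‖inner ℂ (psiVec θ s) (leftRep θ _ (psiVec θ s))‖
        rw [inner_psiVec_diagonal hs]
        simp_rw [mul_one]
        rw [← Complex.ofReal_sum, Complex.norm_real, Real.norm_of_nonneg]
        exact Finset.sum_nonneg fun m _ => (weight_pos hs m).le

/-! ### Admissible diagonal elements -/

theorem conj_diagonal (α : ℕ → ℝ) (N : ℕ) :
    conjugate (∑ m ∈ Finset.range N, (α m : ℂ) • unit θ m m) =
      ∑ m ∈ Finset.range N, (α m : ℂ) • unit θ m m := by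
  induction N with
  | zero => ext x; simp
  | succ N ih =>
    rw [Finset.sum_range_succ, conjugate_add, ih, conjugate_smul, conjugate_unit,
      Complex.conj_ofReal]

/-- The left side is `z ⋆ a - a ⋆ z`. One product lowers the first index and the other raises the
second, so both live on the entries `(m, m + 1)`; `α N = 0` lets the first sum be extended by one
term to match the second. -/
theorem two_kap_smul_dp_diagonal (α : ℕ → ℂ) {N : ℕ} (hN : α N = 0) :
    (2 * kap θ) • dp (∑ m ∈ Finset.range N, α m • unit θ m m) =
      ∑ m ∈ Finset.range N, ((α (m + 1) - α m) * rt θ m) • unit θ m (m + 1) := by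
  set a := ∑ m ∈ Finset.range N, α m • unit θ m m with ha
  have h1 : (2 * kap θ) • dp a = Lz θ a - Rz θ a := by
    rw [Lz_eq, Rz_eq, two_mul, add_smul]; abel
  have hL : Lz θ a = ∑ m ∈ Finset.range N, (α (m + 1) * rt θ m) • unit θ m (m + 1) := by
    have : a = ∑ m ∈ Finset.range (N + 1), α m • unit θ m m := by
      rw [Finset.sum_range_succ, hN, zero_smul, add_zero]
    rw [this, Finset.sum_range_succ', map_add, map_sum, map_smul, Lz_unit_zero, smul_zero, add_zero]
    simp_rw [map_smul, Lz_unit_succ, smul_smul]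
  have hR : Rz θ a = ∑ m ∈ Finset.range N, (α m * rt θ m) • unit θ m (m + 1) := by
    rw [ha, map_sum]
    simp_rw [map_smul, Rz_unit, smul_smul]
  rw [h1, hL, hR, ← Finset.sum_sub_distrib]
  simp_rw [← sub_smul, ← sub_mul]

theorem kap_ne_zero : kap θ ≠ 0 := by
  have := hθ.out
  rw [kap, Complex.ofReal_ne_zero]
  positivity

theorem norm_leftRep_dp_diagonal_le (α : ℕ → ℂ) {N : ℕ} (hN : α N = 0) {B : ℝ} (hB : 0 ≤ B)
    (h : ∀ m < N, ‖α (m + 1) - α m‖ * rt θ m ≤ B) :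
    ‖leftRep θ (dp (∑ m ∈ Finset.range N, α m • unit θ m m))‖ ≤ ‖(2 * kap θ)⁻¹‖ * B := by
  have e := two_kap_smul_dp_diagonal (θ := θ) α hN
  have hk : 2 * kap θ ≠ 0 := mul_ne_zero two_ne_zero kap_ne_zero
  have e2 := congrArg (fun g => (2 * kap θ)⁻¹ • g) e
  simp only [smul_smul, inv_mul_cancel₀ hk, one_smul] at e2
  rw [e2, map_smul, norm_smul]
  gcongr
  refine norm_sum_unit_le hB (Nat.succ_injective) N fun m hm => ?_
  rw [norm_mul, Complex.norm_real, Real.norm_of_nonneg (rt_pos m).le]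
  exact h m hm

/-- For real `a` the two complex derivatives are conjugate, hence of equal norm, and each partial
derivative is half their sum or difference up to a unimodular factor. -/
theorem norm_leftRep_pd_le {a : 𝓢(Plane, ℂ)} (ha : conjugate a = a) (μ : Fin 2) :
    ‖leftRep θ (pd μ a)‖ ≤ ‖leftRep θ (dp a)‖ := by
  have hm : ‖leftRep θ (dm a)‖ = ‖leftRep θ (dp a)‖ := by
    rw [← norm_leftRep_conjugate (dp a), conjugate_dp, ha]
  have h0 : pd 0 a = (1 / 2 : ℂ) • (dp a + dm a) := by
    rw [dp_eq, dm_eq]; ext x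
    simp only [smul_apply, add_apply, sub_apply, smul_eq_mul]; ring
  have h1 : pd 1 a = (-I / 2 : ℂ) • (dp a - dm a) := by
    rw [dp_eq, dm_eq]; ext x
    simp only [smul_apply, add_apply, sub_apply, smul_eq_mul]
    linear_combination (pd 1 a x) * I_sq
  fin_cases μ
  · change ‖leftRep θ (pd 0 a)‖ ≤ _
    rw [h0, map_smul, map_add, norm_smul]
    have := norm_add_le (leftRep θ (dp a)) (leftRep θ (dm a))
    have e : ‖(1 / 2 : ℂ)‖ = 1 / 2 := by simp
    rw [e]; linarith
  · change ‖leftRep θ (pd 1 a)‖ ≤ _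
    rw [h1, map_smul, map_sub, norm_smul]
    have := norm_sub_le (leftRep θ (dp a)) (leftRep θ (dm a))
    have e : ‖(-I / 2 : ℂ)‖ = 1 / 2 := by simp
    rw [e]; linarith

/-- The diagonal coefficients of the elements which separate the states `ω_{ψ(s)}`. -/
def ramp (c : ℝ) (N m : ℕ) : ℝ := c * (Real.sqrt N - Real.sqrt m)

/-- The increment of the square root is at most `1/√(m+1)`, which compensates the ladder weight
`√(θ(m+1))` exactly. -/
theorem ramp_step {c : ℝ} (hc : 0 ≤ c) (N m : ℕ) :
    ‖((ramp c N (m + 1) : ℝ) : ℂ) - (ramp c N m : ℝ)‖ * rt θ m ≤ c * Real.sqrt θ := by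
  have hp := hθ.out
  have hm : Real.sqrt (m : ℝ) ≤ Real.sqrt ((m : ℝ) + 1) := Real.sqrt_le_sqrt (by linarith)
  have e : ramp c N (m + 1) - ramp c N m = -(c * (Real.sqrt ((m : ℝ) + 1) - Real.sqrt m)) := by
    rw [ramp, ramp]; push_cast; ring
  rw [← Complex.ofReal_sub, Complex.norm_real, e, norm_neg,
    Real.norm_of_nonneg (mul_nonneg hc (by linarith)), rt, Real.sqrt_mul hp.le]
  have h1 := Real.mul_self_sqrt (by positivity : (0 : ℝ) ≤ (m : ℝ) + 1)
  have h2 := Real.mul_self_sqrt (by positivity : (0 : ℝ) ≤ (m : ℝ))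
  have h3 : (Real.sqrt ((m : ℝ) + 1) - Real.sqrt m) * Real.sqrt ((m : ℝ) + 1) ≤ 1 := by
    nlinarith [Real.sqrt_nonneg (m : ℝ)]
  calc _ = (c * Real.sqrt θ) *
        ((Real.sqrt ((m : ℝ) + 1) - Real.sqrt m) * Real.sqrt ((m : ℝ) + 1)) := by ring
    _ ≤ (c * Real.sqrt θ) * 1 := by gcongr
    _ = _ := mul_one _

theorem exists_ramp_lipNorm_le (Ω : ℝ) (k : Fin 3) : ∃ c : ℝ, 0 < c ∧ ∀ N : ℕ,
    lipNorm θ Ω k (∑ m ∈ Finset.range N, (ramp c N m : ℂ) • unit θ m m) ≤ 1 := by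
  obtain ⟨K, hK, h⟩ := exists_lipNorm_le (θ := θ) Ω k
  set C : ℝ := ‖(2 * kap θ)⁻¹‖ * Real.sqrt θ with hC
  have hC0 : 0 ≤ C := by positivity
  have hpos : 0 < 2 * K.toReal * C + 1 := by positivity
  -- Each of the two partial derivatives has norm at most `c C`; the summand 1 keeps the denominator
  -- positive. Nothing here depends on `N`.
  refine ⟨(2 * K.toReal * C + 1)⁻¹, inv_pos.2 hpos, fun N => (h _).trans ?_⟩
  set c := (2 * K.toReal * C + 1)⁻¹ with hc
  have hc0 : 0 < c := inv_pos.2 hpos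
  have hb : ∀ μ, cstarNorm θ (pd μ (∑ m ∈ Finset.range N, (ramp c N m : ℂ) • unit θ m m)) ≤
      ENNReal.ofReal (c * C) := by
    intro μ
    rw [cstarNorm_eq]
    refine ENNReal.ofReal_le_ofReal ((norm_leftRep_pd_le (conj_diagonal _ N) μ).trans ?_)
    refine (norm_leftRep_dp_diagonal_le (fun m => (ramp c N m : ℂ)) (by simp [ramp])
      (by positivity) fun m _ => ramp_step hc0.le N m).trans_eq ?_
    rw [hC]; ring
  calc K * ∑ μ, cstarNorm θ (pd μ (∑ m ∈ Finset.range N, (ramp c N m : ℂ) • unit θ m m))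
      ≤ ENNReal.ofReal K.toReal * ∑ μ : Fin 2, ENNReal.ofReal (c * C) := by
        rw [ENNReal.ofReal_toReal hK]
        gcongr with μ
        exact hb μ
    _ = ENNReal.ofReal (c * (2 * K.toReal * C)) := by
        rw [Fin.sum_univ_two, ← ENNReal.ofReal_add (by positivity) (by positivity),
          ← ENNReal.ofReal_mul ENNReal.toReal_nonneg]
        congr 1; ring
    _ ≤ 1 := by
        rw [ENNReal.ofReal_le_one, hc, inv_mul_le_one₀ hpos]
        linarith

/-! ### Divergence of the expectation gap -/

/-- The ratio of the two weights is a constant times `(m+1)^{-(s₂ - s₁)}` and eventually drops below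
`1/2`. -/
theorem exists_weight_gap {s₁ s₂ : ℝ} (h₁ : 1 < s₁) (h : s₁ < s₂) :
    ∃ M : ℕ, ∀ m, M ≤ m → weight s₁ m / 2 ≤ weight s₁ m - weight s₂ m := by
  have z₁ := zeta_re_pos h₁
  have z₂ := zeta_re_pos (h₁.trans h)
  have ht : Filter.Tendsto (fun m : ℕ => ((m : ℝ) + 1) ^ (s₂ - s₁)) Filter.atTop Filter.atTop :=
    (tendsto_rpow_atTop (sub_pos.2 h)).comp
      (Filter.tendsto_atTop_add_const_right _ 1 tendsto_natCast_atTop_atTop)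
  obtain ⟨M, hM⟩ := Filter.eventually_atTop.1 (ht.eventually_ge_atTop
    (2 * (riemannZeta (s₁ : ℂ)).re / (riemannZeta (s₂ : ℂ)).re))
  refine ⟨M, fun m hm => ?_⟩
  have hx : (0 : ℝ) < (m : ℝ) + 1 := by positivity
  have h3 := hM m hm
  rw [div_le_iff₀ z₂] at h3
  have h4 : weight s₂ m ≤ weight s₁ m / 2 := by
    rw [weight, weight, div_div, one_div_le_one_div (by positivity) (by positivity)]
    have e : ((m : ℝ) + 1) ^ s₂ = ((m : ℝ) + 1) ^ (s₂ - s₁) * ((m : ℝ) + 1) ^ s₁ := by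
      rw [← Real.rpow_add hx]; congr 1; ring
    rw [e]
    have := mul_le_mul_of_nonneg_right h3 (Real.rpow_nonneg hx.le s₁)
    linarith
  linarith

/-- For large `m` the summand dominates a multiple of `(m+1)^{-(s₁ - 1/2)}`, whose series diverges
because `s₁ - 1/2 ≤ 1`. -/
theorem exists_sum_weight_sqrt_ge {s₁ s₂ : ℝ} (h₁ : 1 < s₁) (h : s₁ < s₂) (h₂ : s₁ ≤ 3 / 2)
    (R : ℝ) (M : ℕ) : ∃ N : ℕ, M ≤ N ∧
      R ≤ ∑ m ∈ Finset.range N, (weight s₁ m - weight s₂ m) * Real.sqrt m := by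
  obtain ⟨M₁, hM₁⟩ := exists_weight_gap h₁ h
  have z₁ := zeta_re_pos h₁
  set L := max M (max M₁ 1) with hL
  -- The factor 4 combines the half lost in `exists_weight_gap` with `√(m+1) ≤ 2√m`, which needs `m
  -- ≥ 1`.
  set g : ℕ → ℝ := fun m => (4 * (riemannZeta (s₁ : ℂ)).re)⁻¹ * (1 / ((m : ℝ) + 1) ^ (s₁ - 1 / 2))
    with hg
  have hg0 : ∀ m, 0 ≤ g m := fun m => by rw [hg]; positivity
  have hns : ¬ Summable g := by
    intro hs
    rw [hg, summable_mul_left_iff (by positivity)] at hs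
    have h3 : Summable fun m : ℕ => 1 / (m : ℝ) ^ (s₁ - 1 / 2) :=
      (summable_nat_add_iff 1).1 (by simpa using hs)
    rw [Real.summable_one_div_nat_rpow] at h3
    linarith
  have hgt := (not_summable_iff_tendsto_nat_atTop_of_nonneg hg0).1 hns
  have hd : ∀ m, L ≤ m → g m ≤ (weight s₁ m - weight s₂ m) * Real.sqrt m := by
    intro m hm
    have hm1 : 1 ≤ m := (le_max_right M₁ 1).trans ((le_max_right M _).trans hm)
    have hx : (0 : ℝ) < (m : ℝ) + 1 := by positivity
    have h4 : Real.sqrt ((m : ℝ) + 1) / 2 ≤ Real.sqrt m := by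
      have : (1 : ℝ) ≤ m := by exact_mod_cast hm1
      rw [div_le_iff₀ two_pos]
      refine Real.sqrt_le_iff.2 ⟨by positivity, ?_⟩
      rw [mul_pow, Real.sq_sqrt (by positivity)]; linarith
    have h5 := hM₁ m ((le_max_left M₁ 1).trans ((le_max_right M _).trans hm))
    have e : ((m : ℝ) + 1) ^ s₁ = ((m : ℝ) + 1) ^ (s₁ - 1 / 2) * Real.sqrt ((m : ℝ) + 1) := by
      rw [Real.sqrt_eq_rpow, ← Real.rpow_add hx]; congr 1; ring
    have hs0 : Real.sqrt ((m : ℝ) + 1) ≠ 0 := (Real.sqrt_pos.2 hx).ne'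
    have hp0 := (Real.rpow_pos_of_pos hx (s₁ - 1 / 2)).ne'
    calc g m = weight s₁ m / 2 * (Real.sqrt ((m : ℝ) + 1) / 2) := by
          rw [hg, weight, e]; field_simp; norm_num
      _ ≤ weight s₁ m / 2 * Real.sqrt m :=
          mul_le_mul_of_nonneg_left h4 (by have := weight_pos h₁ m; linarith)
      _ ≤ _ := mul_le_mul_of_nonneg_right h5 (Real.sqrt_nonneg _)
  set S : ℕ → ℝ := fun N => ∑ m ∈ Finset.range N, (weight s₁ m - weight s₂ m) * Real.sqrt m
  set G : ℕ → ℝ := fun N => ∑ m ∈ Finset.range N, g m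
  have hmono : ∀ N, L ≤ N → S L - G L ≤ S N - G N := by
    intro N hN
    induction N, hN using Nat.le_induction with
    | base => exact le_rfl
    | succ n hn ih =>
      have := hd n hn
      simp only [S, G, Finset.sum_range_succ] at ih ⊢
      linarith
  obtain ⟨N, hN, hLN⟩ := ((hgt.eventually_ge_atTop (R - (S L - G L))).and
    (Filter.eventually_ge_atTop L)).exists
  refine ⟨N, (le_max_left M _).trans hLN, ?_⟩
  have := hmono N hLN
  change R ≤ S N
  change R - (S L - G L) ≤ G N at hN
  linarith

/-- Both weights have total mass 1, so the partial sum of their differences is minus the tail, which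
is positive past `M`. The term with `√N` therefore has the same sign as the divergent one and cannot
cancel it. -/
theorem exists_sum_ramp_ge {s₁ s₂ : ℝ} (h₁ : 1 < s₁) (h : s₁ < s₂) (h₂ : s₁ ≤ 3 / 2) {c : ℝ}
    (hc : 0 < c) (R : ℝ) : ∃ N : ℕ,
      R ≤ |∑ m ∈ Finset.range N, (weight s₁ m - weight s₂ m) * ramp c N m| := by
  obtain ⟨M, hM⟩ := exists_weight_gap h₁ h
  obtain ⟨N, hMN, hN⟩ := exists_sum_weight_sqrt_ge h₁ h h₂ (R / c) M
  refine ⟨N, ?_⟩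
  have hs : HasSum (fun m => weight s₁ m - weight s₂ m) 0 := by
    simpa using (hasSum_weight h₁).sub (hasSum_weight (h₁.trans h))
  have hneg : ∑ m ∈ Finset.range N, (weight s₁ m - weight s₂ m) ≤ 0 := by
    have h3 := hs.summable.sum_add_tsum_nat_add N
    rw [hs.tsum_eq] at h3
    have h4 : 0 ≤ ∑' m, (weight s₁ (m + N) - weight s₂ (m + N)) :=
      tsum_nonneg fun m => by
        have := hM (m + N) (by omega)
        have := weight_pos h₁ (m + N)
        linarith
    linarith
  have e : ∑ m ∈ Finset.range N, (weight s₁ m - weight s₂ m) * ramp c N m =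
      c * (Real.sqrt N * ∑ m ∈ Finset.range N, (weight s₁ m - weight s₂ m) -
        ∑ m ∈ Finset.range N, (weight s₁ m - weight s₂ m) * Real.sqrt m) := by
    rw [Finset.mul_sum, ← Finset.sum_sub_distrib, Finset.mul_sum]
    refine Finset.sum_congr rfl fun m _ => ?_
    rw [ramp]; ring
  rw [e, ← abs_neg]
  refine le_trans ?_ (le_abs_self _)
  rw [div_le_iff₀ hc] at hN
  have := mul_nonneg hc.le (mul_nonneg (Real.sqrt_nonneg N) (neg_nonneg.2 hneg))
  linarith

/-! ### Infinite distances and distinct components -/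

variable {Ω : ℝ} {k : Fin 3}

/-- The state `ω_{ψ(s)}` as a point of the metric space of states. -/
def psiPoint (θ Ω : ℝ) (k : Fin 3) [hθ : Fact (0 < θ)] (s : Set.Ioi (1 : ℝ)) : StateSpace θ Ω k :=
  psiState θ s.2

theorem isPsiState_psiPoint (s : Set.Ioi (1 : ℝ)) : IsPsiState s.1 (psiPoint θ Ω k s) :=
  fun a => hasSum_psi s.2 a

/-- A finite distance would bound the difference of the two states on every ramp element, whereas
those differences are unbounded in `N`. -/
theorem edist_psiPoint_of_lt {s₁ s₂ : Set.Ioi (1 : ℝ)} (h : s₁.1 < s₂.1) (h₂ : s₁.1 ≤ 3 / 2) :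
    edist (psiPoint θ Ω k s₁) (psiPoint θ Ω k s₂) = ⊤ := by
  by_contra hne
  obtain ⟨c, hc, hlip⟩ := exists_ramp_lipNorm_le (θ := θ) Ω k
  obtain ⟨N, hN⟩ := exists_sum_ramp_ge s₁.2 h h₂ hc
    ((edist (psiPoint θ Ω k s₁) (psiPoint θ Ω k s₂)).toReal + 1)
  have h3 := le_iSup₂ (f := fun (a : 𝓢(Plane, ℂ)) (_ : lipNorm θ Ω k a ≤ 1) => ENNReal.ofReal
    ‖State.toLin (psiPoint θ Ω k s₁) a - State.toLin (psiPoint θ Ω k s₂) a‖) _ (hlip N)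
  rw [← edist_eq, ENNReal.ofReal_le_iff_le_toReal hne] at h3
  have e : State.toLin (psiPoint θ Ω k s₁) (∑ m ∈ Finset.range N, (ramp c N m : ℂ) • unit θ m m) -
      State.toLin (psiPoint θ Ω k s₂) (∑ m ∈ Finset.range N, (ramp c N m : ℂ) • unit θ m m) =
      ((∑ m ∈ Finset.range N, (weight s₁ m - weight s₂ m) * ramp c N m : ℝ) : ℂ) := by
    change inner ℂ (psiVec θ s₁.1) (leftRep θ _ (psiVec θ s₁.1)) -
      inner ℂ (psiVec θ s₂.1) (leftRep θ _ (psiVec θ s₂.1)) = _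
    rw [inner_psiVec_diagonal s₁.2, inner_psiVec_diagonal s₂.2, ← Finset.sum_sub_distrib]
    push_cast
    exact Finset.sum_congr rfl fun m _ => by ring
  rw [e, Complex.norm_real, Real.norm_eq_abs] at h3
  linarith

theorem edist_psiPoint {s₁ s₂ : Set.Ioi (1 : ℝ)} (h : s₁ ≠ s₂) (h₁ : s₁.1 ≤ 3 / 2)
    (h₂ : s₂.1 ≤ 3 / 2) : edist (psiPoint θ Ω k s₁) (psiPoint θ Ω k s₂) = ⊤ := by
  rcases lt_or_gt_of_ne (Subtype.coe_ne_coe.2 h) with h | h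
  · exact edist_psiPoint_of_lt h h₁
  · rw [edist_comm]; exact edist_psiPoint_of_lt h h₂

theorem psiPoint_notMem {s₁ s₂ : Set.Ioi (1 : ℝ)} (h : s₁ ≠ s₂) (h₁ : s₁.1 ≤ 3 / 2)
    (h₂ : s₂.1 ≤ 3 / 2) : psiPoint θ Ω k s₂ ∉ finiteClass (psiPoint θ Ω k s₁) := fun hm =>
  hm.ne (edist_psiPoint h.symm h₂ h₁)

theorem finiteClass_psiPoint_ne {s₁ s₂ : Set.Ioi (1 : ℝ)} (h : s₁ ≠ s₂) (h₁ : s₁.1 ≤ 3 / 2)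
    (h₂ : s₂.1 ≤ 3 / 2) :
    finiteClass (psiPoint θ Ω k s₁) ≠ finiteClass (psiPoint θ Ω k s₂) := fun he =>
  psiPoint_notMem h h₁ h₂ (he ▸ self_mem_finiteClass (psiPoint θ Ω k s₂))

theorem infinite_connectedComponents : Infinite (ConnectedComponents (StateSpace θ Ω k)) := by
  have := Set.Ioc.infinite (show (1 : ℝ) < 3 / 2 by norm_num)
  refine Infinite.of_injective (fun s : Set.Ioc (1 : ℝ) (3 / 2) =>
    (psiPoint θ Ω k ⟨s.1, s.2.1⟩ : ConnectedComponents (StateSpace θ Ω k))) fun s t hst => ?_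
  by_contra hne
  rw [ConnectedComponents.coe_eq_coe, connectedComponent_eq_finiteClass,
    connectedComponent_eq_finiteClass] at hst
  exact finiteClass_psiPoint_ne (fun he => hne (Subtype.ext (Subtype.mk.inj he)))
    s.2.2 t.2.2 hst

end Moyal

end

theorem mainTheorem3 (θ Ω : ℝ) [Fact (0 < θ)] (hΩ : 0 < Ω) (hΩ' : Ω ≤ 1) (k : Fin 3) :
    Infinite (ConnectedComponents (Moyal.StateSpace θ Ω k)) ∧
    (∀ ω : Moyal.StateSpace θ Ω k,
      IsPathConnected (connectedComponent ω) ∧ Moyal.SegmentConnected (connectedComponent ω)) ∧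
    ∃ Ψ : Set.Ioi (1 : ℝ) → Moyal.StateSpace θ Ω k,
      (∀ s : Set.Ioi (1 : ℝ), Moyal.IsPsiState s.1 (Ψ s)) ∧
      (∀ s, IsClopen (Moyal.finiteClass (Ψ s)) ∧ IsPathConnected (Moyal.finiteClass (Ψ s)) ∧
        Moyal.SegmentConnected (Moyal.finiteClass (Ψ s))) ∧
      ∀ s₁ s₂ : Set.Ioi (1 : ℝ),
        s₁.1 ∈ Set.Ioo (1 : ℝ) (5 / 4) ∪ Set.Ioc (5 / 4 : ℝ) (3 / 2) →
        s₂.1 ∈ Set.Ioo (1 : ℝ) (5 / 4) ∪ Set.Ioc (5 / 4 : ℝ) (3 / 2) →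
        s₁ ≠ s₂ →
          Ψ s₂ ∉ Moyal.finiteClass (Ψ s₁) ∧
          Moyal.finiteClass (Ψ s₁) ≠ Moyal.finiteClass (Ψ s₂) ∧
          connectedComponent (Ψ s₁) ≠ connectedComponent (Ψ s₂) := by
  have le : ∀ {s : ℝ}, s ∈ Set.Ioo (1 : ℝ) (5 / 4) ∪ Set.Ioc (5 / 4 : ℝ) (3 / 2) → s ≤ 3 / 2 := by
    rintro s (h | h)
    · linarith [h.2]
    · exact h.2
  refine ⟨Moyal.infinite_connectedComponents, fun ω => ?_, Moyal.psiPoint θ Ω k,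
    Moyal.isPsiState_psiPoint, fun s => ⟨Moyal.isClopen_finiteClass _,
      Moyal.isPathConnected_finiteClass _, Moyal.segmentConnected_finiteClass _⟩,
    fun s₁ s₂ h₁ h₂ h => ⟨Moyal.psiPoint_notMem h (le h₁) (le h₂),
      Moyal.finiteClass_psiPoint_ne h (le h₁) (le h₂), ?_⟩⟩
  · rw [Moyal.connectedComponent_eq_finiteClass]
    exact ⟨Moyal.isPathConnected_finiteClass _, Moyal.segmentConnected_finiteClass _⟩
  · rw [Moyal.connectedComponent_eq_finiteClass, Moyal.connectedComponent_eq_finiteClass]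
    exact Moyal.finiteClass_psiPoint_ne h (le h₁) (le h₂)
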